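/- Let $k\ge 1$ be an integer, $s\in(k-1,k)$, $\Lambda=(-1,1)$, $(g,h)=\int_\Lambda gh\,dx$, $\omega^{(\alpha,\beta)}(x)=(1-x)^\alpha(1+x)^\beta$, and let $\|g\|_{\omega}=\big(\int_\Lambda g^2\omega\,dx\big)^{1/2}$ be the norm of the real weighted space $L^2_{\omega}(\Lambda)$. Let $D^k$ be the $k$-th (weak) derivative on $\Lambda$, and let $$D_+^su=(-1)^kD^kI_+^{k-s}u,\qquad I_+^{\rho}u(x)=\frac1{\Gamma(\rho)}\int_x^1\frac{u(y)}{(y-x)^{1-\rho}}\,dy ,$$ be the right-sided Riemann–Liouville derivative of order $s$. Let $$U=\{u\in L^2_{\omega^{(-s,-k)}}(\Lambda): D_+^su\in L^2_{\omega^{(0,s-k)}}(\Lambda),\ u^{(l)}(\pm1)=0,\ 0\le l\le k-1\},$$ $$V=\{v\in L^2_{\omega^{(-k,-s)}}(\Lambda): D^kv\in L^2_{\omega^{(0,k-s)}}(\Lambda),\ v^{(l)}(\pm1)=0,\ 0\le l\le k-1\},$$ with the norms $\|u\|_U=(\|u\|^2_{\omega^{(-s,-k)}}+\|D_+^su\|^2_{\omega^{(0,s-k)}})^{1/2}$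 and $\|v\|_V=(\|v\|^2_{\omega^{(-k,-s)}}+\|D^kv\|^2_{\omega^{(0,k-s)}})^{1/2}$, where the boundary conditions are understood in the usual generalized sense that $u$ (respectively $v$) is a limit of functions in $C_c^\infty(\Lambda)$ in the norm $\|\cdot\|_U$ (respectively $\|\cdot\|_V$). For $N\in\mathbb N_0$ let $\mathcal P_N$ be the space of real polynomials of degree at most $N$ and let $${}^+\mathcal F_N^{(-s,-k)}=\{(1-x)^s\psi:\ \psi\in\mathcal P_N,\ \psi^{(l)}(-1)=0,\ 0\le l\le k-1\},$$ $${}^-\mathcal F_N^{(-k,-s)}=\{(1+x)^s\psi:\ \psi\in\mathcal P_N,\ \psi^{(l)}(1)=0,\ 0\le l\le k-1\}.$$ Put $a(u,v)=(D_+^su,D^kv)$ and let $f\in L^2_{\omega^{(s,k)}}(\Lambda)$. Then $fv$ is integrable on $\Lambda$ for every $v\in V$, and: 1. there is a unique $u\in U$ (up to equality almost everywhere) such that $a(u,v)=(f,v)$ for all $v\in V$; 2. for every $N$ there is a unique $u_N\in{}^+\mathcal F_N^{(-s,-k)}$ such that $a(u_N,v_N)=(f,v_N)$ for all $v_N\in{}^-\mathcal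 F_N^{(-k,-s)}$. -/

import Mathlib

open MeasureTheory Polynomial
open scoped ENNReal ContDiff

noncomputable section

namespace GJF

/-- The interval `Λ = (-1, 1)`. -/
def Lam : Set ℝ := Set.Ioo (-1) 1

/-- The measure `ω^{(α,β)}(x) dx` on `Λ`, with Jacobi weight
`ω^{(α,β)}(x) = (1 - x)^α (1 + x)^β`. The weighted space `L²_{ω^{(α,β)}}(Λ)` consists of the `f`
with `MemLp f 2 (jacobiMeasure α β)`, and its norm is `eLpNorm f 2 (jacobiMeasure α β)`. -/
def jacobiMeasure (α β : ℝ) : Measure ℝ :=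
  (volume.restrict Lam).withDensity
    (fun x => ENNReal.ofReal ((1 - x) ^ α * (1 + x) ^ β))

/-- The unweighted pairing `(f, g) = ∫_Λ f g dx`. -/
def pairing (f g : ℝ → ℝ) : ℝ := ∫ x in Lam, f x * g x

/-- The space `C_c^∞(Λ)`. -/
def IsTest (φ : ℝ → ℝ) : Prop :=
  ContDiff ℝ ∞ φ ∧ HasCompactSupport φ ∧ tsupport φ ⊆ Lam

/-- `g` is a weak `m`-th derivative of `w` on `Λ`. -/
def HasWeakDeriv (m : ℕ) (w g : ℝ → ℝ) : Prop :=
  LocallyIntegrableOn w Lam ∧ LocallyIntegrableOn g Lam ∧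
    ∀ φ : ℝ → ℝ, IsTest φ →
      pairing w (iteratedDeriv m φ) = (-1) ^ m * pairing g φ

open Classical in
/-- The weak `m`-th derivative `D^m w` on `Λ` (unique up to null sets; `0` if there is none). -/
def weakDeriv (m : ℕ) (w : ℝ → ℝ) : ℝ → ℝ :=
  if h : ∃ g, HasWeakDeriv m w g then h.choose else 0

/-- The right fractional integral
`I_+^ρ v (x) = Γ(ρ)⁻¹ ∫_x^1 (y - x)^{ρ-1} v(y) dy`. -/
def fracInt (ρ : ℝ) (v : ℝ → ℝ) (x : ℝ) : ℝ :=
  (Real.Gamma ρ)⁻¹ * ∫ y in Set.Ioo x 1, (y - x) ^ (ρ - 1) * v y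

/-- The right Riemann–Liouville derivative `D_+^s v = (-1)^k D^k I_+^{k-s} v`
of order `s ∈ [k-1, k)`. -/
def rlDeriv (s : ℝ) (k : ℕ) (v : ℝ → ℝ) (x : ℝ) : ℝ :=
  (-1) ^ k * weakDeriv k (fracInt (k - s) v) x

/-- `‖u‖_U = (‖u‖²_{ω^{(-s,-k)}} + ‖D_+^s u‖²_{ω^{(0,s-k)}})^{1/2}`. -/
def normU (s : ℝ) (k : ℕ) (u : ℝ → ℝ) : ℝ≥0∞ :=
  (eLpNorm u 2 (jacobiMeasure (-s) (-k)) ^ 2 +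
    eLpNorm (rlDeriv s k u) 2 (jacobiMeasure 0 (s - k)) ^ 2) ^ (1 / 2 : ℝ)

/-- `‖v‖_V = (‖v‖²_{ω^{(-k,-s)}} + ‖D^k v‖²_{ω^{(0,k-s)}})^{1/2}`. -/
def normV (s : ℝ) (k : ℕ) (v : ℝ → ℝ) : ℝ≥0∞ :=
  (eLpNorm v 2 (jacobiMeasure (-k) (-s)) ^ 2 +
    eLpNorm (weakDeriv k v) 2 (jacobiMeasure 0 (k - s)) ^ 2) ^ (1 / 2 : ℝ)

/-- The solution space `U`: the `u ∈ L²_{ω^{(-s,-k)}}` with `D_+^s u ∈ L²_{ω^{(0,s-k)}}` that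
satisfy the homogeneous boundary conditions `u^{(l)}(±1) = 0`, `0 ≤ l ≤ k - 1`. As the functions
`u^{(l)}` need not have pointwise boundary values, the conditions are imposed as usual:
`u` is a limit of functions in `C_c^∞(Λ)` in the norm of `U`. -/
def spaceU (s : ℝ) (k : ℕ) : Set (ℝ → ℝ) :=
  {u | MemLp u 2 (jacobiMeasure (-s) (-k)) ∧
    (∃ g, HasWeakDeriv k (fracInt (k - s) u) g) ∧
    MemLp (rlDeriv s k u) 2 (jacobiMeasure 0 (s - k)) ∧
    ∀ ε : ℝ≥0∞, 0 < ε → ∃ φ, IsTest φ ∧ normU s k (u - φ) < ε}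

/-- The test space `V`: the `v ∈ L²_{ω^{(-k,-s)}}` with `D^k v ∈ L²_{ω^{(0,k-s)}}` that satisfy the
homogeneous boundary conditions `v^{(l)}(±1) = 0`, `0 ≤ l ≤ k - 1`, imposed as for `U`. -/
def spaceV (s : ℝ) (k : ℕ) : Set (ℝ → ℝ) :=
  {v | MemLp v 2 (jacobiMeasure (-k) (-s)) ∧
    (∃ g, HasWeakDeriv k v g) ∧
    MemLp (weakDeriv k v) 2 (jacobiMeasure 0 (k - s)) ∧
    ∀ ε : ℝ≥0∞, 0 < ε → ∃ φ, IsTest φ ∧ normV s k (v - φ) < ε}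

/-- The bilinear form `a(u, v) = (D_+^s u, D^k v)`. -/
def bilin (s : ℝ) (k : ℕ) (u v : ℝ → ℝ) : ℝ :=
  pairing (rlDeriv s k u) (weakDeriv k v)

/-- `u ∈ U` and `a(u, v) = (f, v)` for all `v ∈ V`. -/
def IsWeakSolution (s : ℝ) (k : ℕ) (f u : ℝ → ℝ) : Prop :=
  u ∈ spaceU s k ∧ ∀ v ∈ spaceV s k, bilin s k u v = pairing f v

/-- The space `⁺F_N^{(-s,-k)}` of the functions `(1 - x)^s ψ(x)` with `ψ` a polynomial of degree at
most `N` and `ψ^{(l)}(-1) = 0` for `0 ≤ l ≤ k - 1`. -/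
def discreteU (s : ℝ) (k N : ℕ) : Set (ℝ → ℝ) :=
  {u | ∃ ψ : ℝ[X], ψ.natDegree ≤ N ∧ (∀ l < k, (derivative^[l] ψ).eval (-1) = 0) ∧
    u = fun x => (1 - x) ^ s * ψ.eval x}

/-- The space `⁻F_N^{(-k,-s)}` of the functions `(1 + x)^s ψ(x)` with `ψ` a polynomial of degree at
most `N` and `ψ^{(l)}(1) = 0` for `0 ≤ l ≤ k - 1`. -/
def discreteV (s : ℝ) (k N : ℕ) : Set (ℝ → ℝ) :=
  {v | ∃ ψ : ℝ[X], ψ.natDegree ≤ N ∧ (∀ l < k, (derivative^[l] ψ).eval 1 = 0) ∧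
    v = fun x => (1 + x) ^ s * ψ.eval x}

/-- `u_N ∈ ⁺F_N^{(-s,-k)}` and `a(u_N, v_N) = (f, v_N)` for all `v_N ∈ ⁻F_N^{(-k,-s)}`. -/
def IsDiscreteSolution (s : ℝ) (k N : ℕ) (f uN : ℝ → ℝ) : Prop :=
  uN ∈ discreteU s k N ∧ ∀ vN ∈ discreteV s k N, bilin s k uN vN = pairing f vN

end GJF

end

noncomputable section

namespace GJF

/-! Both spaces are parametrized by one Hilbert space H = L²_{ω^{(0,s-k)}} (`HSpace`). For u ∈ U put
g = D_+^s u, and for v ∈ V put h = (1+x)^{k-s} D^k v. Both lie in H, and a(u,v) = ⟨g,h⟩_H since the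
weights cancel. Let P ⊆ H be the polynomials of degree less than k (`lowPoly`). As φ runs through
the test functions, the functions g and the functions h each form a dense subspace of P^⊥
(`closure_range_rlH`, `closure_range_derivH`). The continuous problem is therefore the Riesz
representation theorem on P^⊥.

Density is proved by computing orthogonal complements. For h this is the lemma of du Bois-Reymond.
For g one moves the fractional integral to the other factor, applies the same lemma, and uses that
I_+^ρ, ρ = k - s, is injective and maps (1-x)^{-ρ} times polynomials of degree less than n onto the
polynomials of degree less than n.

Two estimates make this correspondence usable. First, I_+^s is bounded from P^⊥ to L²_{ω^{(-s,-k)}}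
(`exists_fracInt_estimate`), so U is exactly the set of I_+^s g with g ∈ P^⊥, up to null sets. Near
the diagonal this is a Schur test. Far from it, the kernel is a Taylor polynomial in (1+x)/(1+y),
which amounts to (1+y)^{s-k} times a polynomial of degree less than k in y and is annihilated by g,
plus a small remainder. Secondly, a test function is bounded pointwise by an explicit Jacobi weight
times ‖h‖ (`exists_test_bound`). This makes (f,·) continuous and f v integrable although the weights
of f and V are not dual to each other.

For the discrete problem, D_+^s((1-x)^s ψ) is a polynomial Gψ, with G linear
(`exists_linearMap_rlDeriv`), and k integrations by parts give a(u_N,v_N) = (-1)^k ∫ (1+x)^s q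
D^k(Gψ) for v_N = (1+x)^s q. Testing with q = (1-x)^k D^k(Gψ) shows injectivity. Trial and test
spaces have equal dimension by reflection, so the finite system is uniquely solvable. -/

/-! ### The fractional kernel, the Beta integral and the semigroup property. -/

/-- The normalized kernel `(y - x)_+^{a-1} / Γ(a)` of the right fractional integral. -/
def rk (a x y : ℝ) : ℝ := if x < y then (Real.Gamma a)⁻¹ * (y - x) ^ (a - 1) else 0

theorem rk_nonneg {a : ℝ} (ha : 0 < a) (x y : ℝ) : 0 ≤ rk a x y := by
  unfold rk
  split_ifs with h
  · exact mul_nonneg (inv_nonneg.2 (Real.Gamma_pos_of_pos ha).le)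
      (Real.rpow_nonneg (sub_nonneg.2 h.le) _)
  · exact le_rfl

theorem measurable_rk (a : ℝ) : Measurable (fun p : ℝ × ℝ => rk a p.1 p.2) := by
  unfold rk
  refine Measurable.ite (measurableSet_lt measurable_fst measurable_snd) ?_ measurable_const
  fun_prop

theorem measurable_rk_right (a x : ℝ) : Measurable (fun y => rk a x y) :=
  (measurable_rk a).comp (measurable_const.prodMk measurable_id)

/-- This symmetry turns left fractional integrals into right ones, so only `fracInt` has to be
studied. -/
theorem rk_neg_neg (a x y : ℝ) : rk a (-y) (-x) = rk a x y := by
  unfold rk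
  simp only [neg_lt_neg_iff, neg_sub_neg]

theorem rk_of_lt {a x y : ℝ} (h : x < y) : rk a x y = (Real.Gamma a)⁻¹ * (y - x) ^ (a - 1) :=
  if_pos h

theorem rk_of_le {a x y : ℝ} (h : y ≤ x) : rk a x y = 0 := if_neg (not_lt.2 h)

theorem rk_one (x y : ℝ) : rk 1 x y = if x < y then 1 else 0 := by
  simp [rk]

theorem integral_beta_zero {a b : ℝ} (ha : 0 < a) (hb : 0 < b) {c : ℝ} (hc : 0 < c) :
    IntervalIntegrable (fun y => y ^ (a - 1) * (c - y) ^ (b - 1)) volume 0 c ∧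
    ∫ y in (0 : ℝ)..c, y ^ (a - 1) * (c - y) ^ (b - 1) =
      Real.Gamma a * Real.Gamma b / Real.Gamma (a + b) * c ^ (a + b - 1) := by
  have hpt : ∀ y ∈ Set.Ioc (0 : ℝ) c, (y : ℂ) ^ ((a : ℂ) - 1) * ((c : ℂ) - y) ^ ((b : ℂ) - 1) =
      ((y ^ (a - 1) * (c - y) ^ (b - 1) : ℝ) : ℂ) := by
    intro y hy
    rw [Complex.ofReal_mul, Complex.ofReal_cpow hy.1.le, Complex.ofReal_cpow (sub_nonneg.2 hy.2)]
    push_cast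
    rfl
  have hscaled := Complex.betaIntegral_scaled (a : ℂ) (b : ℂ) hc
  have heq : ∫ y in (0 : ℝ)..c, (y : ℂ) ^ ((a : ℂ) - 1) * ((c : ℂ) - y) ^ ((b : ℂ) - 1) =
      ((∫ y in (0 : ℝ)..c, y ^ (a - 1) * (c - y) ^ (b - 1) : ℝ) : ℂ) := by
    rw [← intervalIntegral.integral_ofReal]
    refine intervalIntegral.integral_congr_ae (Filter.Eventually.of_forall fun y hy => ?_)
    rw [Set.uIoc_of_le hc.le] at hy
    exact hpt y hy
  have hGab : Complex.betaIntegral a b = ((Real.Gamma a * Real.Gamma b / Real.Gamma (a + b) : ℝ) : ℂ) := by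
    have h := Complex.Gamma_mul_Gamma_eq_betaIntegral (s := (a : ℂ)) (t := (b : ℂ))
      (by simpa using ha) (by simpa using hb)
    have hne : Complex.Gamma ((a : ℂ) + b) ≠ 0 := by
      rw [← Complex.ofReal_add, Complex.Gamma_ofReal]
      exact_mod_cast (Real.Gamma_pos_of_pos (add_pos ha hb)).ne'
    rw [← Complex.ofReal_add, Complex.Gamma_ofReal, Complex.Gamma_ofReal, Complex.Gamma_ofReal] at h
    rw [← Complex.ofReal_add, Complex.Gamma_ofReal] at hne
    push_cast
    rw [eq_div_iff hne, mul_comm, ← h]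
  have hval : ∫ y in (0 : ℝ)..c, y ^ (a - 1) * (c - y) ^ (b - 1) =
      Real.Gamma a * Real.Gamma b / Real.Gamma (a + b) * c ^ (a + b - 1) := by
    have : ((∫ y in (0 : ℝ)..c, y ^ (a - 1) * (c - y) ^ (b - 1) : ℝ) : ℂ) =
        ((Real.Gamma a * Real.Gamma b / Real.Gamma (a + b) * c ^ (a + b - 1) : ℝ) : ℂ) := by
      rw [← heq, hscaled, hGab, Complex.ofReal_mul, Complex.ofReal_cpow hc.le]
      push_cast
      ring
    exact_mod_cast this
  refine ⟨?_, hval⟩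
  -- A non-integrable function has integral 0 by convention, so the positive value just computed
  -- forces integrability.
  by_contra hcon
  have h0 := intervalIntegral.integral_undef hcon
  rw [hval] at h0
  have : 0 < Real.Gamma a * Real.Gamma b / Real.Gamma (a + b) * c ^ (a + b - 1) := by
    have := Real.Gamma_pos_of_pos ha
    have := Real.Gamma_pos_of_pos hb
    have := Real.Gamma_pos_of_pos (add_pos ha hb)
    positivity
  exact this.ne' h0

/-- The semigroup law on the level of kernels: after translation it is the Beta integral, and
dividing by Γ removes all constants. -/
theorem integral_rk_mul_rk {a b : ℝ} (ha : 0 < a) (hb : 0 < b) (x z : ℝ) :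
    Integrable (fun y => rk a x y * rk b y z) ∧ ∫ y, rk a x y * rk b y z = rk (a + b) x z := by
  rcases le_or_gt z x with hzx | hxz
  · have h0 : (fun y => rk a x y * rk b y z) = 0 := by
      funext y
      rcases le_or_gt y x with h | h
      · simp [rk_of_le h]
      · simp [rk_of_le (hzx.trans h.le)]
    rw [h0, rk_of_le hzx]
    exact ⟨integrable_zero _ _ _, by simp⟩
  have hind : (fun y => rk a x y * rk b y z) = (Set.Ioo x z).indicator
      (fun y => (Real.Gamma a)⁻¹ * (Real.Gamma b)⁻¹ * ((y - x) ^ (a - 1) * (z - y) ^ (b - 1))) := by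
    funext y
    by_cases hy : y ∈ Set.Ioo x z
    · rw [Set.indicator_of_mem hy, rk_of_lt hy.1, rk_of_lt hy.2]; ring
    · rw [Set.indicator_of_notMem hy]
      rcases le_or_gt y x with h | h
      · simp [rk_of_le h]
      · simp [rk_of_le (not_lt.1 fun h' => hy ⟨h, h'⟩)]
  obtain ⟨hi, hv⟩ := integral_beta_zero ha hb (sub_pos.2 hxz)
  have hshift : ∫ y in x..z, (y - x) ^ (a - 1) * (z - y) ^ (b - 1) =
      Real.Gamma a * Real.Gamma b / Real.Gamma (a + b) * (z - x) ^ (a + b - 1) := by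
    rw [← hv, ← sub_self x,
      ← intervalIntegral.integral_comp_sub_right (fun y => y ^ (a - 1) * (z - x - y) ^ (b - 1)) x]
    refine intervalIntegral.integral_congr fun y _ => ?_
    simp
  have hishift : IntervalIntegrable (fun y => (y - x) ^ (a - 1) * (z - y) ^ (b - 1)) volume x z := by
    have := hi.comp_sub_right x
    simpa using this
  have hion : IntegrableOn (fun y => (y - x) ^ (a - 1) * (z - y) ^ (b - 1)) (Set.Ioo x z) :=
    ((intervalIntegrable_iff_integrableOn_Ioo_of_le hxz.le).1 hishift)
  rw [hind]
  refine ⟨IntegrableOn.integrable_indicator (hion.const_mul _) measurableSet_Ioo, ?_⟩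
  rw [integral_indicator measurableSet_Ioo, integral_const_mul, ← integral_Ioc_eq_integral_Ioo,
    ← intervalIntegral.integral_of_le hxz.le, hshift, rk_of_lt hxz]
  have := Real.Gamma_pos_of_pos ha
  have := Real.Gamma_pos_of_pos hb
  field_simp

theorem integrable_rk_mul_rk {a b : ℝ} (ha : 0 < a) (hb : 0 < b) (x z : ℝ) :
    Integrable (fun y => rk a x y * rk b y z) := (integral_rk_mul_rk ha hb x z).1

theorem measurableSet_Lam : MeasurableSet Lam := measurableSet_Ioo

theorem isOpen_Lam : IsOpen Lam := isOpen_Ioo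

theorem neg_mem_Lam {x : ℝ} : -x ∈ Lam ↔ x ∈ Lam := by
  simp only [Lam, Set.mem_Ioo]
  constructor <;> rintro ⟨h1, h2⟩ <;> constructor <;> linarith

/-- Integration over `Λ` against a product of kernels whose support lies in `Λ`. -/
theorem setIntegral_rk_mul_rk {a b : ℝ} (ha : 0 < a) (hb : 0 < b) {x z : ℝ} (hx : -1 ≤ x)
    (hz : z ≤ 1) : ∫ y in Lam, rk a x y * rk b y z = rk (a + b) x z := by
  rw [← (integral_rk_mul_rk ha hb x z).2, setIntegral_eq_integral_of_forall_compl_eq_zero]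
  intro y hy
  rcases le_or_gt y x with h | h
  · simp [rk_of_le h]
  · rcases le_or_gt z y with h' | h'
    · simp [rk_of_le h']
    · exact absurd ⟨by linarith, by linarith⟩ hy

theorem setIntegral_rk_right {a : ℝ} (ha : 0 < a) {x : ℝ} (hx : -1 ≤ x) :
    ∫ y in Lam, rk a x y = rk (a + 1) x 1 := by
  rw [← setIntegral_rk_mul_rk ha one_pos hx le_rfl]
  refine setIntegral_congr_fun measurableSet_Lam fun y hy => ?_
  simp [rk_one, hy.2]

theorem setIntegral_rk_left {a : ℝ} (ha : 0 < a) {y : ℝ} (hy : y ≤ 1) :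
    ∫ x in Lam, rk a x y = rk (a + 1) (-1) y := by
  rw [add_comm, ← setIntegral_rk_mul_rk one_pos ha le_rfl hy]
  refine setIntegral_congr_fun measurableSet_Lam fun x hx => ?_
  simp [rk_one, hx.1]

theorem integrableOn_rk_right {a : ℝ} (ha : 0 < a) (x : ℝ) :
    IntegrableOn (fun y => rk a x y) Lam := by
  refine (integrable_rk_mul_rk ha one_pos x 1).integrableOn.congr_fun (fun y hy => ?_)
    measurableSet_Lam
  simp [rk_one, hy.2]

theorem integrableOn_rk_left {a : ℝ} (ha : 0 < a) (y : ℝ) :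
    IntegrableOn (fun x => rk a x y) Lam := by
  refine (integrable_rk_mul_rk one_pos ha (-1) y).integrableOn.congr_fun (fun x hx => ?_)
    measurableSet_Lam
  simp [rk_one, hx.1]

theorem rk_le {a : ℝ} (ha : 1 ≤ a) {x y : ℝ} (hx : -1 ≤ x) (hy : y ≤ 1) :
    rk a x y ≤ (Real.Gamma a)⁻¹ * 2 ^ (a - 1) := by
  have hG := Real.Gamma_pos_of_pos (by linarith : 0 < a)
  rcases lt_or_ge x y with h | h
  · rw [rk_of_lt h]
    gcongr
    linarith
  · rw [rk_of_le h]; positivity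

theorem fracInt_eq {a : ℝ} (w : ℝ → ℝ) {x : ℝ} (hx : -1 ≤ x) :
    fracInt a w x = ∫ y in Lam, rk a x y * w y := by
  unfold fracInt
  rw [← integral_const_mul, ← integral_indicator measurableSet_Ioo,
    ← integral_indicator measurableSet_Lam]
  congr 1
  funext y
  by_cases hy : y ∈ Set.Ioo x 1
  · have : y ∈ Lam := ⟨by linarith [hy.1], hy.2⟩
    rw [Set.indicator_of_mem hy, Set.indicator_of_mem this, rk_of_lt hy.1, mul_assoc]
  · rw [Set.indicator_of_notMem hy]
    by_cases hy' : y ∈ Lam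
    · rw [Set.indicator_of_mem hy', rk_of_le (not_lt.1 fun h => hy ⟨h, hy'.2⟩), zero_mul]
    · rw [Set.indicator_of_notMem hy']

theorem fracInt_congr {a : ℝ} {w w' : ℝ → ℝ} (h : w =ᵐ[volume.restrict Lam] w') {x : ℝ}
    (hx : -1 ≤ x) : fracInt a w x = fracInt a w' x := by
  rw [fracInt_eq w hx, fracInt_eq w' hx]
  refine integral_congr_ae ?_
  filter_upwards [h] with y hy
  rw [hy]

/-- Integrating in the first variable leaves the bounded function `rk (a + 1) (-1) y`, so Tonelli
applies for every a > 0, although the kernel itself is unbounded when a < 1. -/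
theorem integrable_prod_rk {a : ℝ} (ha : 0 < a) {w : ℝ → ℝ} (hw : IntegrableOn w Lam) :
    Integrable (fun p : ℝ × ℝ => rk a p.1 p.2 * w p.2)
      ((volume.restrict Lam).prod (volume.restrict Lam)) := by
  have hm : AEStronglyMeasurable (fun p : ℝ × ℝ => rk a p.1 p.2 * w p.2)
      ((volume.restrict Lam).prod (volume.restrict Lam)) :=
    (measurable_rk a).aestronglyMeasurable.mul hw.aestronglyMeasurable.comp_snd
  rw [integrable_prod_iff' hm]
  refine ⟨Filter.Eventually.of_forall fun y => Integrable.mul_const (integrableOn_rk_left ha y) (w y), ?_⟩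
  have h1 : ∀ᵐ y ∂(volume.restrict Lam), ∫ x in Lam, ‖rk a x y * w y‖ = rk (a + 1) (-1) y * ‖w y‖ := by
    filter_upwards [ae_restrict_mem measurableSet_Lam] with y hy
    rw [← setIntegral_rk_left ha hy.2.le, ← integral_mul_const]
    simp [abs_of_nonneg (rk_nonneg ha _ _)]
  refine Integrable.congr ?_ (h1.mono fun y hy => hy.symm)
  refine Integrable.bdd_mul (c := (Real.Gamma (a + 1))⁻¹ * 2 ^ (a + 1 - 1)) hw.norm
    (measurable_rk_right _ _).aestronglyMeasurable ?_
  filter_upwards [ae_restrict_mem measurableSet_Lam] with y hy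
  rw [Real.norm_of_nonneg (rk_nonneg (by linarith) _ _)]
  exact rk_le (by linarith) le_rfl hy.2.le

theorem integrableOn_fracInt {a : ℝ} (ha : 0 < a) {w : ℝ → ℝ} (hw : IntegrableOn w Lam) :
    IntegrableOn (fracInt a w) Lam := by
  refine (integrable_prod_rk ha hw).integral_prod_left.congr ?_
  filter_upwards [ae_restrict_mem measurableSet_Lam] with x hx
  rw [fracInt_eq w hx.1.le]

theorem ae_integrable_rk {a : ℝ} (ha : 0 < a) {w : ℝ → ℝ} (hw : IntegrableOn w Lam) :
    ∀ᵐ x ∂(volume.restrict Lam), IntegrableOn (fun y => rk a x y * w y) Lam :=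
  (integrable_prod_rk ha hw).prod_right_ae

theorem integrable_rk_mul {a : ℝ} (ha : 1 ≤ a) {w : ℝ → ℝ} (hw : IntegrableOn w Lam) {x : ℝ}
    (hx : -1 ≤ x) : IntegrableOn (fun y => rk a x y * w y) Lam := by
  refine Integrable.bdd_mul (c := (Real.Gamma a)⁻¹ * 2 ^ (a - 1)) hw
    (measurable_rk_right _ _).aestronglyMeasurable ?_
  filter_upwards [ae_restrict_mem measurableSet_Lam] with y hy
  rw [Real.norm_of_nonneg (rk_nonneg (by linarith) _ _)]
  exact rk_le ha hx hy.2.le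

/-- The semigroup property `I_+^a I_+^b = I_+^{a+b}`. -/
theorem fracInt_fracInt {a b : ℝ} (ha : 0 < a) (hb : 0 < b) (hab : 1 ≤ a + b) {w : ℝ → ℝ}
    (hw : IntegrableOn w Lam) {x : ℝ} (hx : -1 ≤ x) :
    fracInt a (fracInt b w) x = fracInt (a + b) w x := by
  have hint : Integrable (fun p : ℝ × ℝ => rk a x p.1 * (rk b p.1 p.2 * w p.2))
      ((volume.restrict Lam).prod (volume.restrict Lam)) := by
    have hm : AEStronglyMeasurable (fun p : ℝ × ℝ => rk a x p.1 * (rk b p.1 p.2 * w p.2))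
        ((volume.restrict Lam).prod (volume.restrict Lam)) :=
      ((measurable_rk_right a x).comp measurable_fst).aestronglyMeasurable.mul
        ((measurable_rk b).aestronglyMeasurable.mul hw.aestronglyMeasurable.comp_snd)
    rw [integrable_prod_iff' hm]
    constructor
    · refine Filter.Eventually.of_forall fun z => ?_
      have := (integrable_rk_mul_rk ha hb x z).integrableOn (s := Lam)
      simpa only [mul_assoc] using Integrable.mul_const this (w z)
    · have h1 : ∀ᵐ z ∂(volume.restrict Lam), ∫ y in Lam, ‖rk a x y * (rk b y z * w z)‖ =
          rk (a + b) x z * ‖w z‖ := by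
        filter_upwards [ae_restrict_mem measurableSet_Lam] with z hz
        rw [← setIntegral_rk_mul_rk ha hb hx hz.2.le, ← integral_mul_const]
        simp [abs_of_nonneg (rk_nonneg ha _ _), abs_of_nonneg (rk_nonneg hb _ _), mul_assoc]
      -- Since a + b ≥ 1, the composed kernel is bounded. Hence the identity holds at every point
      -- and not only almost everywhere.
      exact (integrable_rk_mul hab hw.norm hx).congr (h1.mono fun z hz => hz.symm)
  rw [fracInt_eq _ hx, fracInt_eq _ hx]
  have h2 : ∫ y in Lam, rk a x y * fracInt b w y =
      ∫ y in Lam, ∫ z in Lam, rk a x y * (rk b y z * w z) := by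
    refine setIntegral_congr_fun measurableSet_Lam fun y hy => ?_
    simp only [fracInt_eq w hy.1.le]
    rw [integral_const_mul]
  rw [h2, integral_integral_swap hint]
  refine setIntegral_congr_fun measurableSet_Lam fun z hz => ?_
  simp only [← mul_assoc]
  rw [integral_mul_const, setIntegral_rk_mul_rk ha hb hx hz.2.le]

/-- `I_+^a` of a power of `1 - x`. -/
theorem fracInt_rpow {a c : ℝ} (ha : 0 < a) (hc : -1 < c) {x : ℝ} (hx : x ∈ Set.Ico (-1 : ℝ) 1) :
    fracInt a (fun y => (1 - y) ^ c) x =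
      Real.Gamma (c + 1) / Real.Gamma (c + a + 1) * (1 - x) ^ (c + a) := by
  have hG := Real.Gamma_pos_of_pos (by linarith : 0 < c + 1)
  rw [fracInt_eq _ hx.1]
  have : ∀ y ∈ Lam, rk a x y * (1 - y) ^ c = Real.Gamma (c + 1) * (rk a x y * rk (c + 1) y 1) := by
    intro y hy
    rw [rk_of_lt hy.2, add_sub_cancel_right]
    field_simp
  rw [setIntegral_congr_fun measurableSet_Lam this, integral_const_mul,
    setIntegral_rk_mul_rk ha (by linarith) hx.1 le_rfl, rk_of_lt hx.2,
    show a + (c + 1) - 1 = c + a by ring, show a + (c + 1) = c + a + 1 by ring]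
  ring

/-! ### Reflection of the interval and duality with the left fractional integral. -/

theorem measurePreserving_neg_Lam :
    MeasurePreserving (fun x : ℝ => -x) (volume.restrict Lam) (volume.restrict Lam) := by
  have h := (Measure.measurePreserving_neg (volume : Measure ℝ)).restrict_preimage
    measurableSet_Lam
  have h2 : (Neg.neg : ℝ → ℝ) ⁻¹' Lam = Lam := by
    ext x
    exact neg_mem_Lam
  rw [h2] at h
  exact h

theorem measurableEmbedding_neg_real : MeasurableEmbedding (fun x : ℝ => -x) :=
  (MeasurableEquiv.neg ℝ).measurableEmbedding

theorem setIntegral_comp_neg (f : ℝ → ℝ) : ∫ x in Lam, f (-x) = ∫ x in Lam, f x :=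
  measurePreserving_neg_Lam.integral_comp measurableEmbedding_neg_real f

theorem integrableOn_comp_neg {f : ℝ → ℝ} (hf : IntegrableOn f Lam) :
    IntegrableOn (fun x => f (-x)) Lam :=
  (measurePreserving_neg_Lam.integrable_comp_emb measurableEmbedding_neg_real).2 hf

theorem ae_comp_neg {p : ℝ → Prop} (h : ∀ᵐ x ∂(volume.restrict Lam), p x) :
    ∀ᵐ x ∂(volume.restrict Lam), p (-x) :=
  measurePreserving_neg_Lam.quasiMeasurePreserving.ae h

/-- Integrating the kernel in its first variable is the left fractional integral; by reflection it
is a right one. -/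
theorem setIntegral_rk_mul_eq_fracInt (a : ℝ) (q : ℝ → ℝ) {y : ℝ} (hy : y ≤ 1) :
    ∫ x in Lam, rk a x y * q x = fracInt a (fun x => q (-x)) (-y) := by
  rw [fracInt_eq _ (by linarith), ← setIntegral_comp_neg fun x => rk a (-y) x * q (-x)]
  simp only [rk_neg_neg, neg_neg]

theorem ae_integrable_rk_left {a : ℝ} (ha : 0 < a) {q : ℝ → ℝ} (hq : IntegrableOn q Lam) :
    ∀ᵐ y ∂(volume.restrict Lam), IntegrableOn (fun x => rk a x y * q x) Lam := by
  filter_upwards [ae_comp_neg (ae_integrable_rk ha (integrableOn_comp_neg hq))] with y hy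
  have := integrableOn_comp_neg hy
  simpa [rk_neg_neg] using this

theorem integrableOn_integral_rk_left {a : ℝ} (ha : 0 < a) {q : ℝ → ℝ} (hq : IntegrableOn q Lam) :
    IntegrableOn (fun y => ∫ x in Lam, rk a x y * q x) Lam := by
  refine (integrableOn_comp_neg (integrableOn_fracInt ha (integrableOn_comp_neg hq))).congr_fun
    (fun y hy => ?_) measurableSet_Lam
  exact (setIntegral_rk_mul_eq_fracInt a q hy.2.le).symm

/-- Duality of the right and the left fractional integral. -/
theorem setIntegral_mul_fracInt {a : ℝ} (ha : 0 < a) {w q : ℝ → ℝ} (hw : IntegrableOn w Lam)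
    (hq : IntegrableOn q Lam) {C : ℝ} (hC : ∀ y ∈ Lam, ∫ x in Lam, rk a x y * |q x| ≤ C) :
    ∫ x in Lam, q x * fracInt a w x = ∫ y in Lam, w y * ∫ x in Lam, rk a x y * q x := by
  have hint : Integrable (fun p : ℝ × ℝ => q p.1 * (rk a p.1 p.2 * w p.2))
      ((volume.restrict Lam).prod (volume.restrict Lam)) := by
    have hm : AEStronglyMeasurable (fun p : ℝ × ℝ => q p.1 * (rk a p.1 p.2 * w p.2))
        ((volume.restrict Lam).prod (volume.restrict Lam)) :=
      hq.aestronglyMeasurable.comp_fst.mul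
        ((measurable_rk a).aestronglyMeasurable.mul hw.aestronglyMeasurable.comp_snd)
    rw [integrable_prod_iff' hm]
    constructor
    · filter_upwards [ae_integrable_rk_left ha hq] with y hy
      refine (Integrable.mul_const hy (w y)).congr (Filter.Eventually.of_forall fun x => ?_)
      simp only
      ring
    · have h1 : ∀ y, ∫ x in Lam, ‖q x * (rk a x y * w y)‖ =
          (∫ x in Lam, rk a x y * |q x|) * ‖w y‖ := by
        intro y
        rw [← integral_mul_const]
        congr 1
        funext x
        rw [norm_mul, norm_mul, Real.norm_of_nonneg (rk_nonneg ha x y), Real.norm_eq_abs]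
        ring
      simp only [h1]
      refine Integrable.bdd_mul (c := C) hw.norm
        (integrableOn_integral_rk_left ha hq.abs).aestronglyMeasurable ?_
      filter_upwards [ae_restrict_mem measurableSet_Lam] with y hy
      rw [Real.norm_of_nonneg (integral_nonneg fun x => mul_nonneg (rk_nonneg ha _ _) (abs_nonneg _))]
      exact hC y hy
  have h2 : ∫ x in Lam, q x * fracInt a w x =
      ∫ x in Lam, ∫ y in Lam, q x * (rk a x y * w y) := by
    refine setIntegral_congr_fun measurableSet_Lam fun x hx => ?_
    simp only [fracInt_eq w hx.1.le]
    rw [integral_const_mul]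
  rw [h2, integral_integral_swap hint]
  congr 1
  funext y
  rw [← integral_const_mul]
  congr 1
  funext x
  ring

theorem setIntegral_rk_mul_le {a : ℝ} (ha : 0 < a) {q : ℝ → ℝ} {M : ℝ} (hM : 0 ≤ M)
    (hq : ∀ x ∈ Lam, |q x| ≤ M) {y : ℝ} (hy : y ≤ 1) :
    ∫ x in Lam, rk a x y * |q x| ≤ M * ((Real.Gamma (a + 1))⁻¹ * 2 ^ (a + 1 - 1)) := by
  calc ∫ x in Lam, rk a x y * |q x| ≤ ∫ x in Lam, M * rk a x y := by
        refine integral_mono_of_nonneg (Filter.Eventually.of_forall fun x =>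
          mul_nonneg (rk_nonneg ha _ _) (abs_nonneg _)) ((integrableOn_rk_left ha y).const_mul M) ?_
        filter_upwards [ae_restrict_mem measurableSet_Lam] with x hx
        rw [mul_comm]
        exact mul_le_mul_of_nonneg_right (hq x hx) (rk_nonneg ha _ _)
    _ = M * rk (a + 1) (-1) y := by rw [integral_const_mul, setIntegral_rk_left ha hy]
    _ ≤ _ := mul_le_mul_of_nonneg_left (rk_le (by linarith) le_rfl hy) hM

/-! ### Test functions -/

theorem IsTest.deriv {φ : ℝ → ℝ} (h : IsTest φ) : IsTest (deriv φ) := by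
  refine ⟨?_, h.2.1.deriv, tsupport_deriv_subset.trans h.2.2⟩
  exact ((contDiff_infty_iff_deriv).1 h.1).2

theorem IsTest.iteratedDeriv {φ : ℝ → ℝ} (h : IsTest φ) (n : ℕ) : IsTest (iteratedDeriv n φ) := by
  induction n with
  | zero => simpa using h
  | succ n ih => rw [iteratedDeriv_succ]; exact ih.deriv

theorem IsTest.continuous {φ : ℝ → ℝ} (h : IsTest φ) : Continuous φ := h.1.continuous

theorem IsTest.eq_zero {φ : ℝ → ℝ} (h : IsTest φ) {x : ℝ} (hx : x ∉ Lam) : φ x = 0 :=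
  image_eq_zero_of_notMem_tsupport fun h' => hx (h.2.2 h')

theorem IsTest.hasDerivAt {φ : ℝ → ℝ} (h : IsTest φ) (x : ℝ) : HasDerivAt φ (_root_.deriv φ x) x :=
  ((h.1.differentiable (by simp)) x).hasDerivAt

theorem IsTest.exists_bound {φ : ℝ → ℝ} (h : IsTest φ) : ∃ C, 0 ≤ C ∧ ∀ x, |φ x| ≤ C := by
  obtain ⟨C, hC⟩ := h.2.1.exists_bound_of_continuous h.continuous
  exact ⟨C, (norm_nonneg _).trans (hC 0), hC⟩

theorem IsTest.integrableOn {φ : ℝ → ℝ} (h : IsTest φ) : IntegrableOn φ Lam :=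
  (h.continuous.integrable_of_hasCompactSupport h.2.1).integrableOn

theorem IsTest.zero : IsTest (0 : ℝ → ℝ) := by
  refine ⟨contDiff_const, HasCompactSupport.zero, ?_⟩
  simp [tsupport]

theorem IsTest.add {φ ψ : ℝ → ℝ} (h : IsTest φ) (h' : IsTest ψ) : IsTest (φ + ψ) :=
  ⟨h.1.add h'.1, h.2.1.add h'.2.1,
    (tsupport_add φ ψ).trans (Set.union_subset h.2.2 h'.2.2)⟩

theorem IsTest.smul {φ : ℝ → ℝ} (h : IsTest φ) (c : ℝ) : IsTest (c • φ) :=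
  ⟨contDiff_const.smul h.1, h.2.1.smul_left (f := fun _ => c),
    (tsupport_smul_subset_right (fun _ => c) φ).trans h.2.2⟩

theorem IsTest.integrableOn_mul {φ w : ℝ → ℝ} (h : IsTest φ) (hw : LocallyIntegrableOn w Lam) :
    IntegrableOn (fun x => w x * φ x) Lam := by
  have h1 : IntegrableOn w (tsupport φ) := hw.integrableOn_compact_subset h.2.2 h.2.1
  have h2 : IntegrableOn (fun x => w x * φ x) (tsupport φ) :=
    h1.mul_continuousOn h.continuous.continuousOn h.2.1
  refine h2.of_forall_sdiff_eq_zero measurableSet_Lam fun x hx => ?_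
  rw [image_eq_zero_of_notMem_tsupport hx.2, mul_zero]

/-! ### Weak derivatives -/

theorem ae_eq_of_pairing_eq {g g' : ℝ → ℝ} (hg : LocallyIntegrableOn g Lam)
    (hg' : LocallyIntegrableOn g' Lam) (h : ∀ φ, IsTest φ → pairing g φ = pairing g' φ) :
    g =ᵐ[volume.restrict Lam] g' := by
  have h0 := isOpen_Lam.ae_eq_zero_of_integral_contDiff_smul_eq_zero (hg.sub hg') ?_
  · rw [Filter.EventuallyEq, ae_restrict_iff' measurableSet_Lam]
    filter_upwards [h0] with x hx hxL
    exact sub_eq_zero.1 (hx hxL)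
  · intro φ h1 h2 h3
    have hφ : IsTest φ := ⟨h1, h2, h3⟩
    rw [← setIntegral_eq_integral_of_forall_compl_eq_zero (s := Lam)
      (fun x hx => by rw [hφ.eq_zero hx, zero_smul])]
    have := h φ hφ
    unfold pairing at this
    rw [← sub_eq_zero, ← integral_sub (hφ.integrableOn_mul hg) (hφ.integrableOn_mul hg')] at this
    rw [← this]
    congr 1
    funext x
    simp only [Pi.sub_apply, smul_eq_mul]
    ring

theorem HasWeakDeriv.ae_eq {m : ℕ} {w g g' : ℝ → ℝ} (h : HasWeakDeriv m w g)
    (h' : HasWeakDeriv m w g') : g =ᵐ[volume.restrict Lam] g' := by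
  refine ae_eq_of_pairing_eq h.2.1 h'.2.1 fun φ hφ => ?_
  have := (h.2.2 φ hφ).symm.trans (h'.2.2 φ hφ)
  exact mul_left_cancel₀ (pow_ne_zero m (by norm_num)) this

theorem weakDeriv_spec {m : ℕ} {w : ℝ → ℝ} (h : ∃ g, HasWeakDeriv m w g) :
    HasWeakDeriv m w (weakDeriv m w) := by
  unfold weakDeriv
  rw [dif_pos h]
  exact h.choose_spec

theorem HasWeakDeriv.weakDeriv_ae_eq {m : ℕ} {w g : ℝ → ℝ} (h : HasWeakDeriv m w g) :
    weakDeriv m w =ᵐ[volume.restrict Lam] g := (weakDeriv_spec ⟨g, h⟩).ae_eq h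

theorem HasWeakDeriv.congr {m : ℕ} {w w' g : ℝ → ℝ} (h : HasWeakDeriv m w g)
    (hw : w =ᵐ[volume.restrict Lam] w') : HasWeakDeriv m w' g := by
  refine ⟨h.1.congr hw, h.2.1, fun φ hφ => ?_⟩
  rw [← h.2.2 φ hφ]
  refine integral_congr_ae ?_
  filter_upwards [hw] with x hx
  rw [hx]

theorem HasWeakDeriv.sub {m : ℕ} {w w' g g' : ℝ → ℝ} (h : HasWeakDeriv m w g)
    (h' : HasWeakDeriv m w' g') : HasWeakDeriv m (w - w') (g - g') := by
  refine ⟨h.1.sub h'.1, h.2.1.sub h'.2.1, fun φ hφ => ?_⟩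
  have h1 := h.2.2 φ hφ
  have h2 := h'.2.2 φ hφ
  unfold pairing at *
  simp only [Pi.sub_apply, sub_mul]
  rw [integral_sub ((hφ.iteratedDeriv m).integrableOn_mul h.1)
    ((hφ.iteratedDeriv m).integrableOn_mul h'.1), integral_sub (hφ.integrableOn_mul h.2.1)
    (hφ.integrableOn_mul h'.2.1), h1, h2]
  ring

theorem HasWeakDeriv.const_mul {m : ℕ} {w g : ℝ → ℝ} (h : HasWeakDeriv m w g) (c : ℝ) :
    HasWeakDeriv m (fun x => c * w x) (fun x => c * g x) := by
  refine ⟨h.1.smul c, h.2.1.smul c, fun φ hφ => ?_⟩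
  have h1 := h.2.2 φ hφ
  unfold pairing at *
  simp only [mul_assoc]
  rw [integral_const_mul, integral_const_mul, h1]
  ring

/-- This permits the induction on the order in `hasWeakDeriv_fracInt`. -/
theorem HasWeakDeriv.comp {m : ℕ} {w g g' : ℝ → ℝ} (h : HasWeakDeriv m w g)
    (h' : HasWeakDeriv 1 g g') : HasWeakDeriv (m + 1) w g' := by
  refine ⟨h.1, h'.2.1, fun φ hφ => ?_⟩
  have h2 := h'.2.2 φ hφ
  rw [iteratedDeriv_one] at h2
  rw [iteratedDeriv_succ', h.2.2 _ hφ.deriv, h2]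
  ring

theorem setIntegral_rk_one (q : ℝ → ℝ) {y : ℝ} (hy : y ∈ Lam) :
    ∫ x in Lam, rk 1 x y * q x = ∫ x in (-1)..y, q x := by
  rw [intervalIntegral.integral_of_le hy.1.le, integral_Ioc_eq_integral_Ioo,
    ← integral_indicator measurableSet_Lam, ← integral_indicator measurableSet_Ioo]
  congr 1
  funext x
  by_cases hx : x ∈ Set.Ioo (-1) y
  · rw [Set.indicator_of_mem hx, Set.indicator_of_mem (show x ∈ Lam from ⟨hx.1, hx.2.trans hy.2⟩), rk_one,
      if_pos hx.2, one_mul]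
  · rw [Set.indicator_of_notMem hx]
    by_cases hx' : x ∈ Lam
    · rw [Set.indicator_of_mem hx', rk_of_le (not_lt.1 fun h => hx ⟨hx'.1, h⟩), zero_mul]
    · rw [Set.indicator_of_notMem hx']

theorem fracInt_one (w : ℝ → ℝ) {x : ℝ} (hx : x ≤ 1) :
    fracInt 1 w x = ∫ y in x..1, w y := by
  rw [intervalIntegral.integral_of_le hx, integral_Ioc_eq_integral_Ioo]
  simp [fracInt]

theorem hasWeakDeriv_fracInt_one {w : ℝ → ℝ} (hw : IntegrableOn w Lam) :
    HasWeakDeriv 1 (fracInt 1 w) (fun x => -w x) := by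
  refine ⟨(integrableOn_fracInt one_pos hw).locallyIntegrableOn, hw.neg.locallyIntegrableOn,
    fun φ hφ => ?_⟩
  obtain ⟨M, hM, hb⟩ := hφ.deriv.exists_bound
  have h := setIntegral_mul_fracInt one_pos hw hφ.deriv.integrableOn
    (fun y hy => setIntegral_rk_mul_le one_pos hM (fun x _ => hb x) hy.2.le)
  unfold pairing
  rw [iteratedDeriv_one]
  simp only [mul_comm (fracInt 1 w _)]
  rw [h, ← integral_const_mul]
  refine setIntegral_congr_fun measurableSet_Lam fun y hy => ?_
  rw [setIntegral_rk_one _ hy, intervalIntegral.integral_deriv_eq_sub'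
    φ rfl (fun x _ => (hφ.hasDerivAt x).differentiableAt) hφ.deriv.continuous.continuousOn,
    hφ.eq_zero (x := -1) (by simp [Lam])]
  ring

/-- `D^k I_+^k w = (-1)^k w`. -/
theorem hasWeakDeriv_fracInt {k : ℕ} (hk : 1 ≤ k) {w : ℝ → ℝ} (hw : IntegrableOn w Lam) :
    HasWeakDeriv k (fracInt k w) (fun x => (-1) ^ k * w x) := by
  induction k, hk using Nat.le_induction generalizing w with
  | base => simpa using hasWeakDeriv_fracInt_one hw
  | succ k hk ih =>
    have hk' : (0 : ℝ) < k := by exact_mod_cast hk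
    have h1 := ih (integrableOn_fracInt one_pos hw)
    have h2 := (hasWeakDeriv_fracInt_one hw).const_mul ((-1) ^ k)
    have h3 := h1.comp h2
    have h4 : fracInt k (fracInt 1 w) =ᵐ[volume.restrict Lam] fracInt ((k + 1 : ℕ) : ℝ) w := by
      filter_upwards [ae_restrict_mem measurableSet_Lam] with x hx
      rw [fracInt_fracInt hk' one_pos (by linarith) hw hx.1.le]
      push_cast
      rfl
    have h5 := h3.congr h4
    convert h5 using 2
    ring

theorem fracInt_sub_ae {a : ℝ} (ha : 0 < a) {w w' : ℝ → ℝ} (hw : IntegrableOn w Lam)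
    (hw' : IntegrableOn w' Lam) :
    fracInt a (w - w') =ᵐ[volume.restrict Lam] fracInt a w - fracInt a w' := by
  filter_upwards [ae_integrable_rk ha hw, ae_integrable_rk ha hw',
    ae_restrict_mem measurableSet_Lam] with x h1 h2 hx
  rw [Pi.sub_apply, fracInt_eq _ hx.1.le, fracInt_eq _ hx.1.le, fracInt_eq _ hx.1.le,
    ← integral_sub h1 h2]
  simp only [Pi.sub_apply, mul_sub]

/-- `D_+^s I_+^s g = g`: the weak derivative. -/
theorem hasWeakDeriv_fracInt_fracInt {k : ℕ} {s : ℝ} (hk : 1 ≤ k)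
    (hs : s ∈ Set.Ioo ((k : ℝ) - 1) k) {g u : ℝ → ℝ} (hg : IntegrableOn g Lam)
    (hu : u =ᵐ[volume.restrict Lam] fracInt s g) :
    HasWeakDeriv k (fracInt (k - s) u) (fun x => (-1) ^ k * g x) := by
  have hk1 : (1 : ℝ) ≤ k := by exact_mod_cast hk
  have hs0 : 0 < s := by linarith [hs.1]
  refine (hasWeakDeriv_fracInt hk hg).congr ?_
  filter_upwards [ae_restrict_mem measurableSet_Lam] with x hx
  rw [fracInt_congr hu hx.1.le, fracInt_fracInt (by linarith [hs.2]) hs0 (by linarith) hg hx.1.le,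
    sub_add_cancel]

theorem rlDeriv_ae_eq_of_hasWeakDeriv {k : ℕ} {s : ℝ} {u g : ℝ → ℝ}
    (h : HasWeakDeriv k (fracInt (k - s) u) (fun x => (-1) ^ k * g x)) :
    rlDeriv s k u =ᵐ[volume.restrict Lam] g := by
  filter_upwards [h.weakDeriv_ae_eq] with x hx
  unfold rlDeriv
  rw [hx, ← mul_assoc, ← mul_pow]
  simp

/-- The fractional integral of order `a ∈ (0, 1)` is injective on `L¹(Λ)`. -/
theorem ae_eq_zero_of_fracInt {a : ℝ} (ha : 0 < a) (ha1 : a < 1) {w : ℝ → ℝ}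
    (hw : IntegrableOn w Lam) (h : fracInt a w =ᵐ[volume.restrict Lam] 0) :
    w =ᵐ[volume.restrict Lam] 0 := by
  have h1 : fracInt 1 w =ᵐ[volume.restrict Lam] fracInt 1 0 := by
    filter_upwards [ae_restrict_mem measurableSet_Lam] with x hx
    -- Applying I_+^{1-a} reduces the claim to the ordinary primitive, whose weak derivative
    -- recovers -w.
    have h2 := fracInt_fracInt (sub_pos.2 ha1) ha (by linarith) hw hx.1.le
    rw [sub_add_cancel] at h2
    rw [← h2, fracInt_congr h hx.1.le]
    simp [fracInt]
  have h3 := ((hasWeakDeriv_fracInt_one hw).congr h1).ae_eq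
    (hasWeakDeriv_fracInt_one (integrable_zero _ _ _))
  filter_upwards [h3] with x hx
  simpa using hx

/-! ### Chains of derivatives that vanish at both end points. -/

theorem intervalIntegrable_of_integrableOn_Lam {w : ℝ → ℝ} (hw : IntegrableOn w Lam) {a b : ℝ}
    (ha : -1 ≤ a) (hab : a ≤ b) (hb : b ≤ 1) : IntervalIntegrable w volume a b := by
  rw [intervalIntegrable_iff_integrableOn_Ioo_of_le hab]
  exact IntegrableOn.mono_set hw (Set.Ioo_subset_Ioo ha hb)

theorem setIntegral_Lam (w : ℝ → ℝ) : ∫ x in Lam, w x = ∫ x in (-1)..1, w x := by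
  rw [intervalIntegral.integral_of_le (by norm_num), integral_Ioc_eq_integral_Ioo, Lam]

/-- A chain `F 0, …, F k` with `F j' = -F (j + 1)` on `Λ` such that `F 0, …, F (k - 1)` vanish at
both end points. -/
structure IsChain (k : ℕ) (F : ℕ → ℝ → ℝ) : Prop where
  continuousOn : ∀ j < k, ContinuousOn (F j) (Set.Icc (-1) 1)
  hasDerivAt : ∀ j < k, ∀ x ∈ Lam, HasDerivAt (F j) (-(F (j + 1) x)) x
  integrable : ∀ j ≤ k, IntegrableOn (F j) Lam
  left : ∀ j < k, F j (-1) = 0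
  right : ∀ j < k, F j 1 = 0

/-- The fundamental theorem of calculus on [x, 1]; only the zero at the right end point enters.
Iterating it recovers `F 0` from `F k`. -/
theorem IsChain.fracInt_one_succ {k : ℕ} {F : ℕ → ℝ → ℝ} (h : IsChain k F) {j : ℕ} (hj : j < k)
    {x : ℝ} (hx : x ∈ Lam) : fracInt 1 (F (j + 1)) x = F j x := by
  have hi := intervalIntegrable_of_integrableOn_Lam (h.integrable (j + 1) hj).neg hx.1.le hx.2.le
    le_rfl
  have h1 := intervalIntegral.integral_eq_sub_of_hasDerivAt_of_le hx.2.le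
    ((h.continuousOn j hj).mono (Set.Icc_subset_Icc_left hx.1.le))
    (fun y hy => h.hasDerivAt j hj y ⟨hx.1.trans hy.1, hy.2⟩) hi
  rw [intervalIntegral.integral_neg, h.right j hj] at h1
  rw [fracInt_one _ hx.2.le]
  linarith

theorem IsChain.fracInt_eq {k : ℕ} {F : ℕ → ℝ → ℝ} (h : IsChain k F) (hk : 1 ≤ k) {x : ℝ}
    (hx : x ∈ Lam) : fracInt k (F k) x = F 0 x := by
  have key : ∀ j, 1 ≤ j → j ≤ k → ∀ x ∈ Lam, fracInt j (F j) x = F 0 x := by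
    intro j hj
    induction j, hj using Nat.le_induction with
    | base =>
      intro hjk x hx
      simpa using h.fracInt_one_succ hjk hx
    | succ j hj ih =>
      intro hjk x hx
      have hj' : (0 : ℝ) < j := by exact_mod_cast hj
      rw [← ih (by omega) x hx]
      push_cast
      rw [← fracInt_fracInt hj' one_pos (by linarith) (h.integrable _ hjk) hx.1.le]
      refine fracInt_congr ?_ hx.1.le
      filter_upwards [ae_restrict_mem measurableSet_Lam] with y hy
      exact h.fracInt_one_succ hjk hy
  exact key k hk le_rfl x hx

/-- Each integration by parts moves one derivative to the polynomial. The sign built into the chain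
cancels the sign of the rule, and both boundary terms vanish. -/
theorem IsChain.integral_mul_eval {k : ℕ} {F : ℕ → ℝ → ℝ} (h : IsChain k F) (p : ℝ[X]) :
    ∫ x in Lam, F k x * p.eval x = ∫ x in Lam, F 0 x * (derivative^[k] p).eval x := by
  have key : ∀ j ≤ k, ∀ p : ℝ[X],
      ∫ x in Lam, F j x * p.eval x = ∫ x in Lam, F 0 x * (derivative^[j] p).eval x := by
    intro j
    induction j with
    | zero => intro _ p; simp
    | succ j ih =>
      intro hj p
      rw [Function.iterate_succ_apply, ← ih (by omega), setIntegral_Lam, setIntegral_Lam]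
      have hm : min (-1 : ℝ) 1 = -1 := by norm_num
      have hM : max (-1 : ℝ) 1 = 1 := by norm_num
      have hu : Set.uIcc (-1 : ℝ) 1 = Set.Icc (-1) 1 := Set.uIcc_of_le (by norm_num)
      have := intervalIntegral.integral_mul_deriv_eq_deriv_mul_of_hasDerivAt (a := -1) (b := 1)
        (u := fun x => p.eval x) (v := F j) (u' := fun x => p.derivative.eval x)
        (v' := fun x => -(F (j + 1) x)) p.continuous.continuousOn
        (by rw [hu]; exact h.continuousOn j hj) (fun x _ => p.hasDerivAt x)
        (by rw [hm, hM]; exact h.hasDerivAt j hj)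
        (p.derivative.continuous.intervalIntegrable _ _)
        (intervalIntegrable_of_integrableOn_Lam (h.integrable _ hj).neg le_rfl (by norm_num) le_rfl)
      rw [h.left j hj, h.right j hj] at this
      simp only [mul_neg, intervalIntegral.integral_neg, mul_zero, sub_zero, zero_sub,
        neg_inj] at this
      simp only [mul_comm (F _ _)]
      exact this
  exact key k le_rfl p

theorem iterate_derivative_eq_zero_of_mem_degreeLT {k : ℕ} {p : ℝ[X]} (hp : p ∈ degreeLT ℝ k) :
    derivative^[k] p = 0 :=
  iterate_derivative_eq_zero_of_degree_lt (mem_degreeLT.1 hp)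

theorem IsChain.integral_mul_eval_eq_zero {k : ℕ} {F : ℕ → ℝ → ℝ} (h : IsChain k F) {p : ℝ[X]}
    (hp : p ∈ degreeLT ℝ k) : ∫ x in Lam, F k x * p.eval x = 0 := by
  rw [h.integral_mul_eval, iterate_derivative_eq_zero_of_mem_degreeLT hp]
  simp

theorem IsTest.isChain {φ : ℝ → ℝ} (h : IsTest φ) (k : ℕ) :
    IsChain k (fun j x => (-1) ^ j * _root_.iteratedDeriv j φ x) where
  continuousOn j _ := ((h.iteratedDeriv j).continuous.const_smul ((-1 : ℝ) ^ j)).continuousOn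
  hasDerivAt j _ x _ := by
    have := ((h.iteratedDeriv j).hasDerivAt x).const_mul ((-1 : ℝ) ^ j)
    refine this.congr_deriv ?_
    rw [iteratedDeriv_succ]
    ring
  integrable j _ := (h.iteratedDeriv j).integrableOn.const_mul _
  left j _ := by rw [(h.iteratedDeriv j).eq_zero (by simp [Lam]), mul_zero]
  right j _ := by rw [(h.iteratedDeriv j).eq_zero (by simp [Lam]), mul_zero]

/-! ### Primitives of test functions and the lemma of du Bois-Reymond. -/

theorem IsTest.exists_Icc {φ : ℝ → ℝ} (h : IsTest φ) :
    ∃ a b : ℝ, -1 < a ∧ a ≤ b ∧ b < 1 ∧ tsupport φ ⊆ Set.Icc a b := by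
  rcases (tsupport φ).eq_empty_or_nonempty with he | hne
  · exact ⟨0, 0, by norm_num, le_rfl, by norm_num, by simp [he]⟩
  · obtain ⟨a, ha⟩ := IsCompact.exists_isLeast h.2.1 hne
    obtain ⟨b, hb⟩ := IsCompact.exists_isGreatest h.2.1 hne
    exact ⟨a, b, (h.2.2 ha.1).1, hb.2 ha.1, (h.2.2 hb.1).2, fun x hx => ⟨ha.2 hx, hb.2 hx⟩⟩

/-- A test function with vanishing mean is the derivative of a test function. -/
theorem IsTest.exists_deriv_eq {φ : ℝ → ℝ} (h : IsTest φ) (h0 : ∫ x in Lam, φ x = 0) :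
    ∃ ψ, IsTest ψ ∧ _root_.deriv ψ = φ := by
  obtain ⟨a, b, ha, hab, hb, hsupp⟩ := h.exists_Icc
  have hz : ∀ x, x ∉ Set.Icc a b → φ x = 0 := fun x hx =>
    image_eq_zero_of_notMem_tsupport fun h' => hx (hsupp h')
  set ψ : ℝ → ℝ := fun x => ∫ y in (-1)..x, φ y with hψ
  have hint : ∀ c d, IntervalIntegrable φ volume c d := fun c d =>
    h.continuous.intervalIntegrable c d
  have hd : ∀ x, HasDerivAt ψ (φ x) x := fun x =>
    intervalIntegral.integral_hasDerivAt_right (hint _ _)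
      h.continuous.stronglyMeasurable.stronglyMeasurableAtFilter h.continuous.continuousAt
  have hderiv : _root_.deriv ψ = φ := funext fun x => (hd x).deriv
  have hout : ∀ x, x ∉ Set.Icc a b → ψ x = 0 := by
    intro x hx
    rw [Set.mem_Icc, not_and_or, not_le, not_le] at hx
    rcases hx with hx | hx
    · simp only [hψ]
      rw [intervalIntegral.integral_congr (g := fun _ => 0), intervalIntegral.integral_zero]
      intro y hy
      refine hz y fun hy' => ?_
      rcases Set.mem_uIcc.1 hy with h1 | h1 <;> linarith [hy'.1, h1.1, h1.2]
    -- To the right of the support the primitive equals its value at 1, which is the vanishing mean.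
    · have h1 : ψ x = ψ 1 + ∫ y in (1 : ℝ)..x, φ y :=
        (intervalIntegral.integral_add_adjacent_intervals (hint _ _) (hint _ _)).symm
      have h2 : ψ 1 = 0 := by rw [← h0, setIntegral_Lam]
      rw [h1, h2, zero_add, intervalIntegral.integral_congr (g := fun _ => 0),
        intervalIntegral.integral_zero]
      intro y hy
      refine hz y fun hy' => ?_
      rcases Set.mem_uIcc.1 hy with h1 | h1 <;> linarith [hy'.2, h1.1, h1.2]
  have hts : tsupport ψ ⊆ Set.Icc a b := by
    refine closure_minimal (fun x hx => ?_) isClosed_Icc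
    by_contra hcon
    exact hx (hout x hcon)
  refine ⟨ψ, ⟨?_, ?_, hts.trans fun x hx => ⟨ha.trans_le hx.1, hx.2.trans_lt hb⟩⟩, hderiv⟩
  · rw [contDiff_infty_iff_deriv, hderiv]
    exact ⟨fun x => (hd x).differentiableAt, h.1⟩
  · exact isCompact_Icc.of_isClosed_subset (isClosed_tsupport _) hts

theorem exists_isTest_integral_eq_one : ∃ η, IsTest η ∧ ∫ x in Lam, η x = 1 := by
  let b : ContDiffBump (0 : ℝ) := ⟨1 / 4, 1 / 2, by norm_num, by norm_num⟩
  have hs : tsupport (b.normed volume) ⊆ Lam := by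
    rw [b.tsupport_normed_eq, Real.closedBall_eq_Icc]
    intro x hx
    have h1 : (0 : ℝ) - 1 / 2 ≤ x := hx.1
    have h2 : x ≤ 0 + 1 / 2 := hx.2
    exact ⟨by linarith, by linarith⟩
  have ht : IsTest (b.normed volume) := ⟨b.contDiff_normed, b.hasCompactSupport_normed, hs⟩
  refine ⟨_, ht, ?_⟩
  rw [setIntegral_eq_integral_of_forall_compl_eq_zero fun x hx => ht.eq_zero hx]
  exact b.integral_normed

theorem IsTest.setIntegral_iteratedDeriv_mul_eval {φ : ℝ → ℝ} (h : IsTest φ) (k : ℕ) (p : ℝ[X]) :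
    ∫ x in Lam, _root_.iteratedDeriv k φ x * p.eval x =
      (-1) ^ k * ∫ x in Lam, φ x * (derivative^[k] p).eval x := by
  have h1 := (h.isChain k).integral_mul_eval p
  simp only [mul_assoc, integral_const_mul] at h1
  simp only [pow_zero, one_mul, iteratedDeriv_zero] at h1
  rw [← h1, ← mul_assoc, ← mul_pow]
  simp

/-- The lemma of du Bois-Reymond of order `k`. -/
theorem exists_polynomial_of_pairing_iteratedDeriv_eq_zero {k : ℕ} {g : ℝ → ℝ}
    (hg : LocallyIntegrableOn g Lam)
    (h : ∀ φ, IsTest φ → pairing g (iteratedDeriv k φ) = 0) :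
    ∃ p ∈ degreeLT ℝ k, g =ᵐ[volume.restrict Lam] fun x => p.eval x := by
  induction k generalizing g with
  | zero =>
    refine ⟨0, Submodule.zero_mem _, ?_⟩
    have : g =ᵐ[volume.restrict Lam] fun _ => 0 := by
      refine ae_eq_of_pairing_eq hg locallyIntegrableOn_zero fun φ hφ => ?_
      have := h φ hφ
      rw [iteratedDeriv_zero] at this
      rw [this]
      simp [pairing]
    simpa using this
  | succ k ih =>
    obtain ⟨η, hη, hη1⟩ := exists_isTest_integral_eq_one
    set c := pairing g (iteratedDeriv k η) with hc
    -- Chosen so that d x^k and g have the same pairing with D^k η: pairing x^k with D^k φ gives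
    -- (-1)^k k! times the mean of φ, and η has mean 1.
    set d : ℝ := c * (-1) ^ k / k.factorial with hd
    have hcont : ∀ n : ℕ, LocallyIntegrableOn (fun x : ℝ => d * x ^ n) Lam := fun n =>
      (by fun_prop : Continuous fun x : ℝ => d * x ^ n).locallyIntegrable.locallyIntegrableOn _
    have hpair : ∀ φ, IsTest φ → pairing (fun x => g x - d * x ^ k) (iteratedDeriv k φ) = 0 := by
      intro φ hφ
      set m := ∫ x in Lam, φ x with hm
      -- Removing the mean makes this function the derivative of a test function, to which the
      -- hypothesis of order k + 1 applies.
      have hφη : IsTest (φ + (-m) • η) := hφ.add (hη.smul _)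
      obtain ⟨ψ, hψ, hψd⟩ := hφη.exists_deriv_eq (by
        simp only [Pi.add_apply, Pi.smul_apply, smul_eq_mul]
        rw [integral_add hφ.integrableOn (hη.integrableOn.const_mul _), integral_const_mul, hη1]
        ring)
      have h1 := h ψ hψ
      rw [iteratedDeriv_succ', hψd] at h1
      have h2 : iteratedDeriv k (φ + (-m) • η) = fun x => iteratedDeriv k φ x +
          (-m) * iteratedDeriv k η x := by
        funext x
        rw [iteratedDeriv_add (hφ.1.contDiffAt.of_le (by exact_mod_cast le_top))
          ((hη.smul (-m)).1.contDiffAt.of_le (by exact_mod_cast le_top)),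
          iteratedDeriv_const_smul (hη.1.contDiffAt.of_le (by exact_mod_cast le_top)), smul_eq_mul]
      have hi1 := (hφ.iteratedDeriv k).integrableOn_mul hg
      have hi2 := (hη.iteratedDeriv k).integrableOn_mul hg
      have h3 : pairing g (iteratedDeriv k φ) = m * c := by
        unfold pairing at h1 hc ⊢
        rw [h2] at h1
        have h4 : ∀ x, g x * (iteratedDeriv k φ x + -m * iteratedDeriv k η x) =
            g x * iteratedDeriv k φ x + -m * (g x * iteratedDeriv k η x) := fun x => by ring
        simp only [h4] at h1
        rw [integral_add hi1 (hi2.const_mul _), integral_const_mul, ← hc] at h1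
        linarith
      have h5 := hφ.setIntegral_iteratedDeriv_mul_eval k (X ^ k)
      rw [iterate_derivative_X_pow_eq_natCast_mul, Nat.sub_self, pow_zero, mul_one,
        Nat.descFactorial_self] at h5
      simp only [eval_natCast, eval_pow, eval_X] at h5
      rw [integral_mul_const, ← hm] at h5
      unfold pairing at h3 ⊢
      have h6 : ∀ x, (g x - d * x ^ k) * iteratedDeriv k φ x =
          g x * iteratedDeriv k φ x - d * (iteratedDeriv k φ x * x ^ k) := fun x => by ring
      simp only [h6]
      have hi3 : IntegrableOn (fun x => iteratedDeriv k φ x * x ^ k) Lam := by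
        have := (hφ.iteratedDeriv k).integrableOn_mul
          ((by fun_prop : Continuous fun x : ℝ => x ^ k).locallyIntegrable.locallyIntegrableOn Lam)
        simpa only [mul_comm] using this
      rw [integral_sub hi1 (hi3.const_mul _), integral_const_mul, h3, h5, hd]
      have hf : (k.factorial : ℝ) ≠ 0 := by exact_mod_cast k.factorial_ne_zero
      have hs : ((-1 : ℝ) ^ k) * (-1) ^ k = 1 := by rw [← mul_pow]; simp
      field_simp
      linear_combination (-m * c) * hs
    obtain ⟨p, hp, hpe⟩ := ih (g := fun x => g x - d * x ^ k) (hg.sub (hcont k)) hpair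
    refine ⟨p + Polynomial.C d * X ^ k, Submodule.add_mem _ (degreeLT_mono (Nat.le_succ k) hp) ?_, ?_⟩
    · rw [mem_degreeLT]
      exact (degree_C_mul_X_pow_le k d).trans_lt (by exact_mod_cast Nat.lt_succ_self k)
    · filter_upwards [hpe] with x hx
      simp only [eval_add, eval_mul, eval_C, eval_pow, eval_X]
      linarith

/-! ### Jacobi weights and weighted square-integrable functions. -/

/-- The Jacobi weight `(1 - x)^α (1 + x)^β`. -/
def jw (α β x : ℝ) : ℝ := (1 - x) ^ α * (1 + x) ^ β

theorem jw_pos (α β : ℝ) {x : ℝ} (hx : x ∈ Lam) : 0 < jw α β x :=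
  mul_pos (Real.rpow_pos_of_pos (by linarith [hx.2]) _)
    (Real.rpow_pos_of_pos (by linarith [hx.1]) _)

theorem measurable_jw (α β : ℝ) : Measurable (jw α β) := by
  unfold jw
  fun_prop

theorem jw_mul_jw (α β α' β' : ℝ) {x : ℝ} (hx : x ∈ Lam) :
    jw α β x * jw α' β' x = jw (α + α') (β + β') x := by
  have h1 : 0 < 1 - x := by linarith [hx.2]
  have h2 : 0 < 1 + x := by linarith [hx.1]
  unfold jw
  rw [Real.rpow_add h1, Real.rpow_add h2]
  ring

theorem jw_zero_zero (x : ℝ) : jw 0 0 x = 1 := by simp [jw]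

theorem jw_half_sq (α β : ℝ) {x : ℝ} (hx : x ∈ Lam) : jw (α / 2) (β / 2) x ^ 2 = jw α β x := by
  rw [sq, jw_mul_jw _ _ _ _ hx]
  simp

theorem integrableOn_jw {α β : ℝ} (hα : -1 < α) (hβ : -1 < β) : IntegrableOn (jw α β) Lam := by
  have h1 := (integrable_rk_mul_rk (by linarith : 0 < β + 1) (by linarith : 0 < α + 1) (-1) 1).const_mul
    (Real.Gamma (β + 1) * Real.Gamma (α + 1))
  refine h1.integrableOn.congr_fun (fun x hx => ?_) measurableSet_Lam
  have := Real.Gamma_pos_of_pos (by linarith : 0 < β + 1)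
  have := Real.Gamma_pos_of_pos (by linarith : 0 < α + 1)
  simp only [rk_of_lt hx.1, rk_of_lt hx.2, jw, add_sub_cancel_right, sub_neg_eq_add, add_comm x]
  field_simp

theorem jacobiMeasure_eq (α β : ℝ) :
    jacobiMeasure α β = (volume.restrict Lam).withDensity (fun x => ENNReal.ofReal (jw α β x)) :=
  rfl

/-- The weight is positive on Λ, so all the measures `jacobiMeasure α β` have the null sets of
Lebesgue measure on Λ. -/
theorem ae_jacobiMeasure_iff {α β : ℝ} {p : ℝ → Prop} :
    (∀ᵐ x ∂(jacobiMeasure α β), p x) ↔ ∀ᵐ x ∂(volume.restrict Lam), p x := by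
  rw [jacobiMeasure_eq, ae_withDensity_iff (measurable_jw α β).ennreal_ofReal]
  constructor
  · intro h
    filter_upwards [h, ae_restrict_mem measurableSet_Lam] with x hx hxL
    exact hx (by simpa using jw_pos α β hxL)
  · intro h
    filter_upwards [h] with x hx _
    exact hx

theorem aestronglyMeasurable_jacobi_iff {α β : ℝ} {f : ℝ → ℝ} :
    AEStronglyMeasurable f (jacobiMeasure α β) ↔ AEStronglyMeasurable f (volume.restrict Lam) := by
  constructor <;> rintro ⟨g, hg, h⟩
  · exact ⟨g, hg, ae_jacobiMeasure_iff.1 h⟩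
  · exact ⟨g, hg, ae_jacobiMeasure_iff.2 h⟩

theorem integrable_jacobi_iff {α β : ℝ} {f : ℝ → ℝ} :
    Integrable f (jacobiMeasure α β) ↔ IntegrableOn (fun x => jw α β x * f x) Lam := by
  rw [jacobiMeasure_eq, integrable_withDensity_iff_integrable_smul'
    (measurable_jw α β).ennreal_ofReal (by simp)]
  refine integrable_congr ?_
  filter_upwards [ae_restrict_mem measurableSet_Lam] with x hx
  rw [ENNReal.toReal_ofReal (jw_pos α β hx).le, smul_eq_mul]

theorem integral_jacobi (α β : ℝ) (f : ℝ → ℝ) :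
    ∫ x, f x ∂(jacobiMeasure α β) = ∫ x in Lam, jw α β x * f x := by
  rw [jacobiMeasure_eq, integral_withDensity_eq_integral_toReal_smul
    (measurable_jw α β).ennreal_ofReal (by simp)]
  refine setIntegral_congr_fun measurableSet_Lam fun x hx => ?_
  simp only [ENNReal.toReal_ofReal (jw_pos α β hx).le, smul_eq_mul]

theorem lintegral_jacobi (α β : ℝ) (f : ℝ → ℝ≥0∞) :
    ∫⁻ x, f x ∂(jacobiMeasure α β) = ∫⁻ x in Lam, ENNReal.ofReal (jw α β x) * f x := by
  rw [jacobiMeasure_eq, lintegral_withDensity_eq_lintegral_mul_non_measurable _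
    (measurable_jw α β).ennreal_ofReal (by simp)]
  rfl

theorem eLpNorm_two_sq {μ : Measure ℝ} (f : ℝ → ℝ) :
    eLpNorm f 2 μ ^ 2 = ∫⁻ x, ENNReal.ofReal (f x ^ 2) ∂μ := by
  have := eLpNorm_nnreal_pow_eq_lintegral (f := f) (μ := μ) (p := 2) (by norm_num)
  have h2 : ((2 : NNReal) : ℝ) = (2 : ℕ) := by norm_num
  rw [h2, ENNReal.rpow_natCast] at this
  simp only [ENNReal.rpow_natCast] at this
  rw [show (2 : ℝ≥0∞) = ((2 : NNReal) : ℝ≥0∞) by norm_num, this]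
  congr 1
  funext x
  rw [Real.enorm_eq_ofReal_abs, ← ENNReal.ofReal_pow (abs_nonneg _), sq_abs]

theorem eLpNorm_sq_jacobi (α β : ℝ) (f : ℝ → ℝ) :
    eLpNorm f 2 (jacobiMeasure α β) ^ 2 = ∫⁻ x in Lam, ENNReal.ofReal (jw α β x * f x ^ 2) := by
  rw [eLpNorm_two_sq, lintegral_jacobi]
  refine setLIntegral_congr_fun measurableSet_Lam fun x hx => ?_
  simp only [ENNReal.ofReal_mul (jw_pos α β hx).le]

theorem memLp_jacobi_iff {α β : ℝ} {f : ℝ → ℝ} :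
    MemLp f 2 (jacobiMeasure α β) ↔ AEStronglyMeasurable f (volume.restrict Lam) ∧
      IntegrableOn (fun x => jw α β x * f x ^ 2) Lam := by
  constructor
  · intro h
    refine ⟨aestronglyMeasurable_jacobi_iff.1 h.1, ?_⟩
    rwa [memLp_two_iff_integrable_sq h.1, integrable_jacobi_iff] at h
  · rintro ⟨h1, h2⟩
    rw [memLp_two_iff_integrable_sq (aestronglyMeasurable_jacobi_iff.2 h1), integrable_jacobi_iff]
    exact h2

theorem memLp_jacobi_iff_memLp {α β : ℝ} {f : ℝ → ℝ} :
    MemLp f 2 (jacobiMeasure α β) ↔ AEStronglyMeasurable f (volume.restrict Lam) ∧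
      MemLp (fun x => jw (α / 2) (β / 2) x * f x) 2 (volume.restrict Lam) := by
  rw [memLp_jacobi_iff]
  refine and_congr_right fun h => ?_
  have hm : AEStronglyMeasurable (fun x => jw (α / 2) (β / 2) x * f x) (volume.restrict Lam) :=
    (measurable_jw _ _).aestronglyMeasurable.mul h
  rw [memLp_two_iff_integrable_sq hm]
  refine integrable_congr ?_
  filter_upwards [ae_restrict_mem measurableSet_Lam] with x hx
  rw [mul_pow, jw_half_sq α β hx]

/-- The Hölder inequality for dual weights: the square roots of the two weights multiply to 1. -/
theorem integrableOn_mul_of_memLp_jacobi {α β : ℝ} {f g : ℝ → ℝ} (hf : MemLp f 2 (jacobiMeasure α β))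
    (hg : MemLp g 2 (jacobiMeasure (-α) (-β))) : IntegrableOn (fun x => f x * g x) Lam := by
  have h := (memLp_jacobi_iff_memLp.1 hf).2.integrable_mul (memLp_jacobi_iff_memLp.1 hg).2
  refine Integrable.congr h ?_
  filter_upwards [ae_restrict_mem measurableSet_Lam] with x hx
  have h1 : jw (α / 2) (β / 2) x * jw (-α / 2) (-β / 2) x = 1 := by
    rw [jw_mul_jw _ _ _ _ hx, ← jw_zero_zero x]
    congr 1 <;> ring
  simp only [Pi.mul_apply]
  linear_combination (f x * g x) * h1

theorem memLp_jacobi_of_bound {α β : ℝ} (hα : -1 < α) (hβ : -1 < β) {f : ℝ → ℝ}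
    (hf : AEStronglyMeasurable f (volume.restrict Lam)) {C : ℝ} (hC : ∀ x ∈ Lam, |f x| ≤ C) :
    MemLp f 2 (jacobiMeasure α β) := by
  rw [memLp_jacobi_iff]
  refine ⟨hf, ?_⟩
  have h1 := (integrableOn_jw hα hβ).mul_const (C ^ 2)
  refine Integrable.mono' h1 ((measurable_jw _ _).aestronglyMeasurable.mul (hf.pow 2)) ?_
  filter_upwards [ae_restrict_mem measurableSet_Lam] with x hx
  rw [Real.norm_of_nonneg (mul_nonneg (jw_pos α β hx).le (sq_nonneg _)), ← sq_abs]
  have := jw_pos α β hx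
  gcongr
  exact hC x hx

theorem integrableOn_of_memLp_jacobi {α β : ℝ} (hα : α < 1) (hβ : β < 1) {f : ℝ → ℝ}
    (hf : MemLp f 2 (jacobiMeasure α β)) : IntegrableOn f Lam := by
  have h1 : MemLp (fun _ : ℝ => (1 : ℝ)) 2 (jacobiMeasure (-α) (-β)) :=
    memLp_jacobi_of_bound (by linarith) (by linarith) aestronglyMeasurable_const (C := 1) (by simp)
  simpa using integrableOn_mul_of_memLp_jacobi hf h1

theorem memLp_jacobi_congr {α β : ℝ} {f g : ℝ → ℝ} (h : f =ᵐ[volume.restrict Lam] g)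
    (hf : MemLp f 2 (jacobiMeasure α β)) : MemLp g 2 (jacobiMeasure α β) :=
  (memLp_congr_ae (ae_jacobiMeasure_iff.2 h)).1 hf

theorem eLpNorm_jacobi_congr {α β : ℝ} {f g : ℝ → ℝ} (h : f =ᵐ[volume.restrict Lam] g) :
    eLpNorm f 2 (jacobiMeasure α β) = eLpNorm g 2 (jacobiMeasure α β) :=
  eLpNorm_congr_ae (ae_jacobiMeasure_iff.2 h)

/-- Test functions belong to all weighted spaces. -/
theorem IsTest.memLp {φ : ℝ → ℝ} (h : IsTest φ) (α β : ℝ) : MemLp φ 2 (jacobiMeasure α β) := by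
  rw [memLp_jacobi_iff]
  refine ⟨h.continuous.aestronglyMeasurable, ?_⟩
  have hc : ContinuousOn (fun x => jw α β x * φ x) Lam := by
    refine ContinuousOn.mul ?_ h.continuous.continuousOn
    unfold jw
    refine ContinuousOn.mul ?_ ?_
    · exact ContinuousOn.rpow_const (by fun_prop) fun x hx => Or.inl (by linarith [hx.2])
    · exact ContinuousOn.rpow_const (by fun_prop) fun x hx => Or.inl (by linarith [hx.1])
  have := h.integrableOn_mul (hc.locallyIntegrableOn measurableSet_Lam)
  simpa only [sq, mul_assoc] using this

theorem memLp_eval {α β : ℝ} (hα : -1 < α) (hβ : -1 < β) (p : ℝ[X]) :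
    MemLp (fun x => p.eval x) 2 (jacobiMeasure α β) := by
  obtain ⟨C, hC⟩ := (isCompact_Icc (a := (-1 : ℝ)) (b := 1)).exists_bound_of_continuousOn
    p.continuous.continuousOn
  exact memLp_jacobi_of_bound hα hβ p.continuous.aestronglyMeasurable
    fun x hx => hC x ⟨hx.1.le, hx.2.le⟩

/-- Duality of the right and the left fractional integral, with the bound on the other factor. -/
theorem setIntegral_mul_fracInt' {a : ℝ} (ha : 0 < a) {w q : ℝ → ℝ} (hw : IntegrableOn w Lam)
    (hq : IntegrableOn q Lam) {M : ℝ} (hM : 0 ≤ M) (hb : ∀ x ∈ Lam, |w x| ≤ M) :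
    ∫ x in Lam, q x * fracInt a w x = ∫ y in Lam, w y * ∫ x in Lam, rk a x y * q x := by
  have h := setIntegral_mul_fracInt ha (integrableOn_comp_neg hq) (integrableOn_comp_neg hw)
    (fun y hy => setIntegral_rk_mul_le ha hM (fun x hx => hb _ (neg_mem_Lam.2 hx)) hy.2.le)
  have h1 : ∫ x in Lam, w (-x) * fracInt a (fun x => q (-x)) x =
      ∫ y in Lam, w y * ∫ x in Lam, rk a x y * q x := by
    rw [← setIntegral_comp_neg]
    refine setIntegral_congr_fun measurableSet_Lam fun y hy => ?_
    simp only [setIntegral_rk_mul_eq_fracInt a q hy.2.le, neg_neg]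
  have h2 : ∫ y in Lam, q (-y) * ∫ x in Lam, rk a x y * w (-x) =
      ∫ x in Lam, q x * fracInt a w x := by
    rw [← setIntegral_comp_neg fun x => q x * fracInt a w x]
    refine setIntegral_congr_fun measurableSet_Lam fun y hy => ?_
    simp only [setIntegral_rk_mul_eq_fracInt a (fun x => w (-x)) hy.2.le, neg_neg]
  rw [← h1, ← h2, h]

/-! ### Fractional integrals of weighted polynomials. -/

theorem natDegree_one_sub_X : (1 - X : ℝ[X]).natDegree = 1 := by
  rw [← natDegree_neg, neg_sub]
  exact natDegree_X_sub_C (1 : ℝ)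

theorem comp_mem_degreeLT {n : ℕ} {p q : ℝ[X]} (hp : p ∈ degreeLT ℝ n) (hq : q.natDegree ≤ 1) :
    p.comp q ∈ degreeLT ℝ n := by
  rcases eq_or_ne p 0 with rfl | hp0
  · simp
  rw [mem_degreeLT] at hp ⊢
  rw [degree_eq_natDegree hp0] at hp
  refine (degree_le_natDegree).trans_lt (lt_of_le_of_lt ?_ hp)
  norm_cast
  rw [natDegree_comp]
  nlinarith

theorem exists_eq_sum_one_sub {n : ℕ} {p : ℝ[X]} (hp : p ∈ degreeLT ℝ n) :
    ∃ c : ℕ → ℝ, ∀ x, p.eval x = ∑ i ∈ Finset.range n, c i * (1 - x) ^ i := by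
  have h1 := comp_mem_degreeLT hp natDegree_one_sub_X.le
  refine ⟨(p.comp (1 - X)).coeff, fun x => ?_⟩
  have h2 : p.eval x = (p.comp (1 - X)).eval (1 - x) := by simp
  rw [h2]
  rcases eq_or_ne (p.comp (1 - X)) 0 with h0 | h0
  · simp [h0]
  · refine eval_eq_sum_range' ?_ _
    rw [mem_degreeLT, degree_eq_natDegree h0] at h1
    exact_mod_cast h1

theorem sum_one_sub_mem_degreeLT (n : ℕ) (c : ℕ → ℝ) :
    ∑ i ∈ Finset.range n, C (c i) * (1 - X) ^ i ∈ degreeLT ℝ n := by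
  refine Submodule.sum_mem _ fun i hi => ?_
  rw [C_mul']
  refine Submodule.smul_mem _ _ ?_
  rw [mem_degreeLT]
  refine (degree_pow_le _ _).trans_lt ?_
  have h1 : (1 - X : ℝ[X]).degree ≤ 1 := by
    have := degree_le_natDegree (p := (1 - X : ℝ[X]))
    rwa [natDegree_one_sub_X] at this
  have h2 : i < n := Finset.mem_range.1 hi
  calc i • (1 - X : ℝ[X]).degree ≤ i • (1 : WithBot ℕ) := by gcongr
    _ = i := by simp
    _ < n := by exact_mod_cast h2

theorem integrableOn_one_sub_rpow {c : ℝ} (hc : -1 < c) :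
    IntegrableOn (fun x : ℝ => (1 - x) ^ c) Lam := by
  refine (integrableOn_jw hc (by norm_num : (-1 : ℝ) < 0)).congr_fun (fun x _ => ?_)
    measurableSet_Lam
  simp [jw]

theorem integrable_rk_mul_one_sub_rpow {a c : ℝ} (ha : 0 < a) (hc : -1 < c) (x : ℝ) :
    IntegrableOn (fun y => rk a x y * (1 - y) ^ c) Lam := by
  refine ((integrable_rk_mul_rk ha (by linarith : 0 < c + 1) x 1).const_mul
    (Real.Gamma (c + 1))).integrableOn.congr_fun (fun y hy => ?_) measurableSet_Lam
  have := Real.Gamma_pos_of_pos (by linarith : 0 < c + 1)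
  simp only [rk_of_lt hy.2, add_sub_cancel_right]
  field_simp

/-- In powers of 1 - x the map r ↦ I_+^ρ((1-x)^{-ρ} r) is diagonal with nonzero entries
Γ(i+1-ρ)/Γ(i+1). It therefore preserves degree bounds and can be inverted on polynomials. -/
theorem fracInt_sum_one_sub {ρ : ℝ} (h0 : 0 < ρ) (h1 : ρ < 1) (n : ℕ) (c : ℕ → ℝ) {x : ℝ}
    (hx : x ∈ Set.Ico (-1 : ℝ) 1) :
    fracInt ρ (fun y => (1 - y) ^ (-ρ) * ∑ i ∈ Finset.range n, c i * (1 - y) ^ i) x =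
      ∑ i ∈ Finset.range n, c i * (Real.Gamma (i + 1 - ρ) / Real.Gamma (i + 1)) * (1 - x) ^ i := by
  have hterm : ∀ y ∈ Lam, rk ρ x y * ((1 - y) ^ (-ρ) * ∑ i ∈ Finset.range n, c i * (1 - y) ^ i) =
      ∑ i ∈ Finset.range n, c i * (rk ρ x y * (1 - y) ^ ((i : ℝ) - ρ)) := by
    intro y hy
    rw [Finset.mul_sum, Finset.mul_sum]
    refine Finset.sum_congr rfl fun i _ => ?_
    rw [sub_eq_neg_add (i : ℝ), Real.rpow_add (by linarith [hy.2]), Real.rpow_natCast]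
    ring
  have hi : ∀ i : ℕ, -1 < (i : ℝ) - ρ := fun i => by
    have : (0 : ℝ) ≤ i := i.cast_nonneg
    linarith
  rw [fracInt_eq _ hx.1, setIntegral_congr_fun measurableSet_Lam hterm, integral_finsetSum _
    fun i _ => (integrable_rk_mul_one_sub_rpow h0 (hi i) x).const_mul _]
  refine Finset.sum_congr rfl fun i _ => ?_
  rw [integral_const_mul, ← fracInt_eq (fun y => (1 - y) ^ ((i : ℝ) - ρ)) hx.1,
    fracInt_rpow h0 (hi i) hx, sub_add_cancel, Real.rpow_natCast,
    show (i : ℝ) - ρ + 1 = i + 1 - ρ by ring]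
  ring

/-- `I_+^ρ` maps `(1 - x)^{-ρ}` times a polynomial to a polynomial. -/
theorem exists_fracInt_eq_eval {ρ : ℝ} (h0 : 0 < ρ) (h1 : ρ < 1) {n : ℕ} {r : ℝ[X]}
    (hr : r ∈ degreeLT ℝ n) :
    ∃ p ∈ degreeLT ℝ n, ∀ x ∈ Set.Ico (-1 : ℝ) 1,
      fracInt ρ (fun y => (1 - y) ^ (-ρ) * r.eval y) x = p.eval x := by
  obtain ⟨c, hc⟩ := exists_eq_sum_one_sub hr
  refine ⟨_, sum_one_sub_mem_degreeLT n
    fun i => c i * (Real.Gamma (i + 1 - ρ) / Real.Gamma (i + 1)), fun x hx => ?_⟩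
  simp only [hc]
  rw [fracInt_sum_one_sub h0 h1 n c hx]
  simp [eval_finsetSum]

/-- Every polynomial is `I_+^ρ` of `(1 - x)^{-ρ}` times a polynomial. -/
theorem exists_eval_eq_fracInt {ρ : ℝ} (h0 : 0 < ρ) (h1 : ρ < 1) {n : ℕ} {p : ℝ[X]}
    (hp : p ∈ degreeLT ℝ n) :
    ∃ r ∈ degreeLT ℝ n, ∀ x ∈ Set.Ico (-1 : ℝ) 1,
      fracInt ρ (fun y => (1 - y) ^ (-ρ) * r.eval y) x = p.eval x := by
  obtain ⟨c, hc⟩ := exists_eq_sum_one_sub hp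
  set d : ℕ → ℝ := fun i => c i * (Real.Gamma (i + 1) / Real.Gamma (i + 1 - ρ)) with hd
  refine ⟨_, sum_one_sub_mem_degreeLT n d, fun x hx => ?_⟩
  have : ∀ y, (∑ i ∈ Finset.range n, C (d i) * (1 - X) ^ i).eval y =
      ∑ i ∈ Finset.range n, d i * (1 - y) ^ i := fun y => by simp [eval_finsetSum]
  simp only [this]
  rw [fracInt_sum_one_sub h0 h1 n d hx, hc]
  refine Finset.sum_congr rfl fun i _ => ?_
  have hi : (0 : ℝ) ≤ i := i.cast_nonneg
  have := Real.Gamma_pos_of_pos (by linarith : (0 : ℝ) < i + 1)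
  have := Real.Gamma_pos_of_pos (by linarith : (0 : ℝ) < i + 1 - ρ)
  simp only [hd]
  field_simp

theorem exists_bound_eval (p : ℝ[X]) : ∃ M, 0 ≤ M ∧ ∀ x ∈ Set.Icc (-1 : ℝ) 1, |p.eval x| ≤ M := by
  obtain ⟨C, hC⟩ := (isCompact_Icc (a := (-1 : ℝ)) (b := 1)).exists_bound_of_continuousOn
    p.continuous.continuousOn
  exact ⟨C, (norm_nonneg _).trans (hC 0 (by simp)), hC⟩

theorem integrableOn_one_sub_rpow_mul_eval {c : ℝ} (hc : -1 < c) (p : ℝ[X]) :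
    IntegrableOn (fun x : ℝ => (1 - x) ^ c * p.eval x) Lam := by
  obtain ⟨M, _, hM⟩ := exists_bound_eval p
  refine Integrable.mul_bdd (c := M) (integrableOn_one_sub_rpow hc)
    p.continuous.aestronglyMeasurable ?_
  filter_upwards [ae_restrict_mem measurableSet_Lam] with x hx
  exact hM x ⟨hx.1.le, hx.2.le⟩

theorem integrableOn_one_add_rpow_mul_eval {c : ℝ} (hc : -1 < c) (p : ℝ[X]) :
    IntegrableOn (fun x : ℝ => (1 + x) ^ c * p.eval x) Lam := by
  have := integrableOn_comp_neg (integrableOn_one_sub_rpow_mul_eval hc (p.comp (-X)))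
  simpa using this

/-! ### Fractional integrals and orthogonality to polynomials. -/

/-- If `w` is orthogonal to the polynomials of degree less than `k`, then `I_+^ρ w` is orthogonal to
them with respect to the weight `(1 + x)^{-ρ}`. -/
theorem setIntegral_weight_mul_fracInt_eq_zero {ρ : ℝ} (h0 : 0 < ρ) (h1 : ρ < 1) {k : ℕ}
    {w : ℝ → ℝ} (hw : IntegrableOn w Lam)
    (hw0 : ∀ p ∈ degreeLT ℝ k, ∫ x in Lam, w x * p.eval x = 0) {p : ℝ[X]}
    (hp : p ∈ degreeLT ℝ k) :
    ∫ x in Lam, (1 + x) ^ (-ρ) * p.eval x * fracInt ρ w x = 0 := by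
  have hnX : (-X : ℝ[X]).natDegree ≤ 1 := by simp
  obtain ⟨M, hM0, hM⟩ := exists_bound_eval p
  have hq := integrableOn_one_add_rpow_mul_eval (by linarith : -1 < -ρ) p
  have hb : ∀ y ∈ Lam, ∫ x in Lam, rk ρ x y * |(1 + x) ^ (-ρ) * p.eval x| ≤
      M * Real.Gamma (1 - ρ) := by
    intro y hy
    have hy' : -y ∈ Set.Ico (-1 : ℝ) 1 := ⟨by linarith [hy.2], by linarith [hy.1]⟩
    -- The left fractional integral of order ρ of (1+x)^{-ρ} is constant, which gives the uniform
    -- bound required for exchanging the integrals.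
    have e1 : ∫ x in Lam, rk ρ x y * (1 + x) ^ (-ρ) = Real.Gamma (1 - ρ) := by
      rw [setIntegral_rk_mul_eq_fracInt ρ (fun x => (1 + x) ^ (-ρ)) hy.2.le]
      have := fracInt_rpow h0 (by linarith : -1 < -ρ) hy'
      simp only [← sub_eq_add_neg]
      rw [this]
      simp [add_comm, sub_eq_add_neg]
    have e2 : IntegrableOn (fun x => rk ρ x y * (1 + x) ^ (-ρ)) Lam := by
      have := integrableOn_comp_neg
        (integrable_rk_mul_one_sub_rpow h0 (by linarith : -1 < -ρ) (-y))
      simpa [rk_neg_neg] using this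
    rw [← e1, ← integral_const_mul]
    refine integral_mono_of_nonneg (Filter.Eventually.of_forall fun x =>
      mul_nonneg (rk_nonneg h0 _ _) (abs_nonneg _)) (e2.const_mul M) ?_
    filter_upwards [ae_restrict_mem measurableSet_Lam] with x hx
    have hpos : 0 ≤ (1 + x) ^ (-ρ) := Real.rpow_nonneg (by linarith [hx.1]) _
    rw [abs_mul, abs_of_nonneg hpos]
    have := hM x ⟨hx.1.le, hx.2.le⟩
    have := mul_nonneg (rk_nonneg h0 x y) hpos
    calc rk ρ x y * ((1 + x) ^ (-ρ) * |p.eval x|) = rk ρ x y * (1 + x) ^ (-ρ) * |p.eval x| := by ring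
      _ ≤ rk ρ x y * (1 + x) ^ (-ρ) * M := by gcongr
      _ = _ := by ring
  rw [setIntegral_mul_fracInt h0 hw hq hb]
  -- After the exchange, w is integrated against the left fractional integral of (1+x)^{-ρ} p, again
  -- a polynomial of degree less than k.
  obtain ⟨r, hr, hre⟩ := exists_fracInt_eq_eval h0 h1 (comp_mem_degreeLT hp hnX)
  rw [← hw0 _ (comp_mem_degreeLT hr hnX)]
  refine setIntegral_congr_fun measurableSet_Lam fun y hy => ?_
  have := hre (-y) ⟨by linarith [hy.2], by linarith [hy.1]⟩
  simp only [setIntegral_rk_mul_eq_fracInt ρ (fun x => (1 + x) ^ (-ρ) * p.eval x) hy.2.le]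
  simp only [eval_comp, eval_neg, eval_X, sub_eq_add_neg] at this ⊢
  rw [this]

/-- If `I_-^ρ m` is orthogonal to all `φ^{(k)}`, then `m` is `(1 + x)^{-ρ}` times a polynomial of
degree less than `k`. -/
theorem exists_polynomial_of_fracInt_orthogonal {ρ : ℝ} (h0 : 0 < ρ) (h1 : ρ < 1) {k : ℕ}
    {m : ℝ → ℝ} (hm : IntegrableOn m Lam)
    (h : ∀ φ, IsTest φ → ∫ x in Lam, m x * fracInt ρ (iteratedDeriv k φ) x = 0) :
    ∃ p ∈ degreeLT ℝ k, m =ᵐ[volume.restrict Lam] fun x => (1 + x) ^ (-ρ) * p.eval x := by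
  have hnX : (-X : ℝ[X]).natDegree ≤ 1 := by simp
  -- By duality the left fractional integral of m annihilates all D^k φ, hence it is a polynomial of
  -- degree less than k.
  obtain ⟨p, hp, hpe⟩ := exists_polynomial_of_pairing_iteratedDeriv_eq_zero (k := k)
    (integrableOn_integral_rk_left h0 hm).locallyIntegrableOn (fun φ hφ => by
      obtain ⟨M, hM0, hM⟩ := (hφ.iteratedDeriv k).exists_bound
      rw [← h φ hφ, setIntegral_mul_fracInt' h0 (hφ.iteratedDeriv k).integrableOn hm hM0
        fun x _ => hM x]
      simp only [pairing, mul_comm])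
  -- That polynomial is also the fractional integral of a weighted polynomial; injectivity of I_+^ρ
  -- then identifies m.
  obtain ⟨r, hr, hre⟩ := exists_eval_eq_fracInt h0 h1 (comp_mem_degreeLT hp hnX)
  have hmn := integrableOn_comp_neg hm
  have hrn := integrableOn_one_sub_rpow_mul_eval (by linarith : -1 < -ρ) r
  have h2 : fracInt ρ ((fun x => m (-x)) - fun x => (1 - x) ^ (-ρ) * r.eval x)
      =ᵐ[volume.restrict Lam] 0 := by
    filter_upwards [fracInt_sub_ae h0 hmn hrn, ae_comp_neg hpe,
      ae_restrict_mem measurableSet_Lam] with x hx1 hx2 hx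
    rw [hx1, Pi.sub_apply, hre x ⟨hx.1.le, hx.2⟩]
    rw [setIntegral_rk_mul_eq_fracInt ρ m (by linarith [hx.1]), neg_neg] at hx2
    rw [hx2]
    simp
  have h3 := ae_eq_zero_of_fracInt h0 h1 (Integrable.sub hmn hrn) h2
  refine ⟨r.comp (-X), comp_mem_degreeLT hr hnX, ?_⟩
  filter_upwards [ae_comp_neg h3] with x hx
  simp only [Pi.sub_apply, neg_neg, Pi.zero_apply, sub_neg_eq_add] at hx
  simp only [eval_comp, eval_neg, eval_X]
  linarith

theorem abs_fracInt_le {a : ℝ} (ha : 0 < a) {w : ℝ → ℝ} {M : ℝ} (hM : 0 ≤ M)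
    (hw : ∀ x ∈ Lam, |w x| ≤ M) {x : ℝ} (hx : -1 ≤ x) :
    |fracInt a w x| ≤ M * ((Real.Gamma (a + 1))⁻¹ * 2 ^ (a + 1 - 1)) := by
  rw [fracInt_eq _ hx]
  calc |∫ y in Lam, rk a x y * w y| ≤ ∫ y in Lam, |rk a x y * w y| := abs_integral_le_integral_abs
    _ ≤ ∫ y in Lam, M * rk a x y := by
        refine integral_mono_of_nonneg (Filter.Eventually.of_forall fun x => abs_nonneg _)
          ((integrableOn_rk_right ha x).const_mul M) ?_
        filter_upwards [ae_restrict_mem measurableSet_Lam] with y hy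
        rw [abs_mul, abs_of_nonneg (rk_nonneg ha _ _), mul_comm]
        exact mul_le_mul_of_nonneg_right (hw y hy) (rk_nonneg ha _ _)
    _ = M * rk (a + 1) x 1 := by rw [integral_const_mul, setIntegral_rk_right ha hx]
    _ ≤ _ := mul_le_mul_of_nonneg_left (rk_le (by linarith) hx le_rfl) hM

theorem fracInt_const_mul (a c : ℝ) (w : ℝ → ℝ) (x : ℝ) :
    fracInt a (fun y => c * w y) x = c * fracInt a w x := by
  unfold fracInt
  simp only [mul_left_comm _ c]
  rw [integral_const_mul]
  ring

theorem aestronglyMeasurable_one_add_rpow (c : ℝ) :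
    AEStronglyMeasurable (fun x : ℝ => (1 + x) ^ c) (volume.restrict Lam) :=
  ((measurable_const.add measurable_id).pow_const c).aestronglyMeasurable

/-! ### The Hilbert space and the images of the test functions in it. -/

/-- The space of test functions as a submodule. -/
def testSpace : Submodule ℝ (ℝ → ℝ) where
  carrier := {φ | IsTest φ}
  add_mem' h h' := IsTest.add h h'
  zero_mem' := IsTest.zero
  smul_mem' c _ h := IsTest.smul h c

theorem iteratedDeriv_add_of_isTest {φ ψ : ℝ → ℝ} (hφ : IsTest φ) (hψ : IsTest ψ) (k : ℕ) (x : ℝ) :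
    iteratedDeriv k (φ + ψ) x = iteratedDeriv k φ x + iteratedDeriv k ψ x :=
  iteratedDeriv_add (hφ.1.contDiffAt.of_le (by exact_mod_cast le_top))
    (hψ.1.contDiffAt.of_le (by exact_mod_cast le_top))

theorem iteratedDeriv_smul_of_isTest {φ : ℝ → ℝ} (hφ : IsTest φ) (c : ℝ) (k : ℕ) (x : ℝ) :
    iteratedDeriv k (c • φ) x = c * iteratedDeriv k φ x := by
  rw [iteratedDeriv_const_smul (hφ.1.contDiffAt.of_le (by exact_mod_cast le_top)), smul_eq_mul]

/-- The Hilbert space `L²_{ω^{(0,s-k)}}(Λ)`. -/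
abbrev HSpace (s : ℝ) (k : ℕ) := Lp ℝ 2 (jacobiMeasure 0 (s - k))

theorem HSpace.ext {s : ℝ} {k : ℕ} {g h : HSpace s k} (hgh : g =ᵐ[volume.restrict Lam] h) :
    g = h :=
  Lp.ext (ae_jacobiMeasure_iff.2 hgh)

theorem coeFn_toLp_ae {s : ℝ} {k : ℕ} {f : ℝ → ℝ} (hf : MemLp f 2 (jacobiMeasure 0 (s - k))) :
    hf.toLp f =ᵐ[volume.restrict Lam] f :=
  ae_jacobiMeasure_iff.1 hf.coeFn_toLp

theorem inner_HSpace {s : ℝ} {k : ℕ} (g h : HSpace s k) :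
    inner ℝ g h = ∫ x in Lam, jw 0 (s - k) x * (g x * h x) := by
  rw [L2.inner_def, integral_jacobi]
  simp [mul_comm]

theorem integrableOn_HSpace {s : ℝ} {k : ℕ} (hs : s ∈ Set.Ioo ((k : ℝ) - 1) k) (g : HSpace s k) :
    IntegrableOn g Lam :=
  integrableOn_of_memLp_jacobi one_pos (by linarith [hs.2]) (Lp.memLp g)

/-- Polynomials as elements of the Hilbert space. -/
def polyH {s : ℝ} {k : ℕ} (hs : s ∈ Set.Ioo ((k : ℝ) - 1) k) : ℝ[X] →ₗ[ℝ] HSpace s k where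
  toFun p := (memLp_eval (by norm_num) (by linarith [hs.1]) p).toLp (fun x => p.eval x)
  map_add' p q := by
    rw [← MemLp.toLp_add]
    congr 1
    funext x
    simp
  map_smul' c p := by
    rw [RingHom.id_apply, ← MemLp.toLp_const_smul]
    congr 1
    funext x
    simp

theorem memLp_weighted_iteratedDeriv {s : ℝ} {k : ℕ} (hs : s ∈ Set.Ioo ((k : ℝ) - 1) k)
    {φ : ℝ → ℝ} (hφ : IsTest φ) :
    MemLp (fun x => (1 + x) ^ ((k : ℝ) - s) * iteratedDeriv k φ x) 2 (jacobiMeasure 0 (s - k)) := by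
  obtain ⟨M, hM0, hM⟩ := (hφ.iteratedDeriv k).exists_bound
  refine memLp_jacobi_of_bound (by norm_num) (by linarith [hs.1])
    (AEStronglyMeasurable.mul (aestronglyMeasurable_one_add_rpow _) (hφ.iteratedDeriv k).continuous.aestronglyMeasurable)
    (C := 2 ^ ((k : ℝ) - s) * M) fun x hx => ?_
  have h1 : 0 ≤ 1 + x := by linarith [hx.1]
  rw [abs_mul, abs_of_nonneg (Real.rpow_nonneg h1 _)]
  have : (1 + x) ^ ((k : ℝ) - s) ≤ 2 ^ ((k : ℝ) - s) :=
    Real.rpow_le_rpow h1 (by linarith [hx.2]) (by linarith [hs.2])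
  gcongr
  exact hM x

/-- The map `φ ↦ (1 + x)^{k-s} D^k φ` on test functions. -/
def derivH {s : ℝ} {k : ℕ} (hs : s ∈ Set.Ioo ((k : ℝ) - 1) k) : testSpace →ₗ[ℝ] HSpace s k where
  toFun φ := (memLp_weighted_iteratedDeriv hs φ.2).toLp _
  map_add' φ ψ := by
    rw [← MemLp.toLp_add]
    congr 1
    funext x
    simp only [Submodule.coe_add, Pi.add_apply]
    rw [iteratedDeriv_add_of_isTest φ.2 ψ.2]
    ring
  map_smul' c φ := by
    rw [RingHom.id_apply, ← MemLp.toLp_const_smul]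
    congr 1
    funext x
    simp only [Submodule.coe_smul, Pi.smul_apply]
    rw [iteratedDeriv_smul_of_isTest φ.2]
    simp only [smul_eq_mul]
    ring

theorem memLp_fracInt_iteratedDeriv {s : ℝ} {k : ℕ} (hs : s ∈ Set.Ioo ((k : ℝ) - 1) k)
    {φ : ℝ → ℝ} (hφ : IsTest φ) :
    MemLp (fracInt (k - s) (fun x => (-1) ^ k * iteratedDeriv k φ x)) 2
      (jacobiMeasure 0 (s - k)) := by
  have h0 : 0 < (k : ℝ) - s := by linarith [hs.2]
  obtain ⟨M, hM0, hM⟩ := (hφ.iteratedDeriv k).exists_bound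
  refine memLp_jacobi_of_bound (by norm_num) (by linarith [hs.1])
    (integrableOn_fracInt h0 ((hφ.iteratedDeriv k).integrableOn.const_mul _)).aestronglyMeasurable
    (fun x hx => abs_fracInt_le h0 hM0 (fun y hy => ?_) hx.1.le)
  simp only [abs_mul, abs_pow, abs_neg, abs_one, one_pow, one_mul]
  exact hM y

/-- The map `φ ↦ D_+^s φ` on test functions. -/
def rlH {s : ℝ} {k : ℕ} (hs : s ∈ Set.Ioo ((k : ℝ) - 1) k) : testSpace →ₗ[ℝ] HSpace s k where
  toFun φ := (memLp_fracInt_iteratedDeriv hs φ.2).toLp _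
  map_add' φ ψ := by
    have h0 : 0 < (k : ℝ) - s := by linarith [hs.2]
    rw [← MemLp.toLp_add, MemLp.toLp_eq_toLp_iff]
    refine ae_jacobiMeasure_iff.2 ?_
    filter_upwards [ae_integrable_rk h0
      ((φ.2.iteratedDeriv k).integrableOn.const_mul ((-1) ^ k)), ae_integrable_rk h0
      ((ψ.2.iteratedDeriv k).integrableOn.const_mul ((-1) ^ k)),
      ae_restrict_mem measurableSet_Lam] with x h1 h2 hx
    rw [Pi.add_apply, fracInt_eq _ hx.1.le, fracInt_eq _ hx.1.le, fracInt_eq _ hx.1.le,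
      ← integral_add h1 h2]
    congr 1
    funext y
    simp only [Submodule.coe_add]
    rw [iteratedDeriv_add_of_isTest φ.2 ψ.2]
    ring
  map_smul' c φ := by
    rw [RingHom.id_apply, ← MemLp.toLp_const_smul]
    congr 1
    funext x
    rw [Pi.smul_apply, smul_eq_mul, ← fracInt_const_mul]
    congr 1
    funext y
    rw [Submodule.coe_smul, iteratedDeriv_smul_of_isTest φ.2]
    ring

theorem polyH_ae {s : ℝ} {k : ℕ} (hs : s ∈ Set.Ioo ((k : ℝ) - 1) k) (p : ℝ[X]) :
    polyH hs p =ᵐ[volume.restrict Lam] fun x => p.eval x :=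
  coeFn_toLp_ae (memLp_eval (by norm_num) (by linarith [hs.1]) p)

theorem derivH_ae {s : ℝ} {k : ℕ} (hs : s ∈ Set.Ioo ((k : ℝ) - 1) k) (φ : testSpace) :
    derivH hs φ =ᵐ[volume.restrict Lam] fun x => (1 + x) ^ ((k : ℝ) - s) * iteratedDeriv k φ x :=
  coeFn_toLp_ae (memLp_weighted_iteratedDeriv hs φ.2)

theorem rlH_ae {s : ℝ} {k : ℕ} (hs : s ∈ Set.Ioo ((k : ℝ) - 1) k) (φ : testSpace) :
    rlH hs φ =ᵐ[volume.restrict Lam]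
      fracInt (k - s) (fun x => (-1) ^ k * iteratedDeriv k φ x) :=
  coeFn_toLp_ae (memLp_fracInt_iteratedDeriv hs φ.2)

/-- The polynomials of degree less than `k` in the Hilbert space. -/
def lowPoly {s : ℝ} {k : ℕ} (hs : s ∈ Set.Ioo ((k : ℝ) - 1) k) : Submodule ℝ (HSpace s k) :=
  (degreeLT ℝ k).map (polyH hs)

/-- The factor (1+x)^{k-s} in `derivH` cancels the weight of the inner product. This is why the
unweighted form a(u,v) becomes an inner product. -/
theorem inner_derivH {s : ℝ} {k : ℕ} (hs : s ∈ Set.Ioo ((k : ℝ) - 1) k) (g : HSpace s k)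
    (φ : testSpace) : inner ℝ g (derivH hs φ) = pairing g (iteratedDeriv k φ) := by
  rw [inner_HSpace]
  refine integral_congr_ae ?_
  filter_upwards [derivH_ae hs φ, ae_restrict_mem measurableSet_Lam] with x hx' hx
  have h1 : 0 < 1 + x := by linarith [hx.1]
  have h2 : (1 + x) ^ (s - k) * (1 + x) ^ ((k : ℝ) - s) = 1 := by
    rw [← Real.rpow_add h1]
    simp
  simp only [hx', jw, Real.rpow_zero, one_mul]
  linear_combination (g x * iteratedDeriv k φ x) * h2

theorem inner_rlH {s : ℝ} {k : ℕ} (hs : s ∈ Set.Ioo ((k : ℝ) - 1) k) (g : HSpace s k)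
    (φ : testSpace) : inner ℝ g (rlH hs φ) = ∫ x in Lam, ((1 + x) ^ (s - k) * g x) *
      fracInt (k - s) (fun x => (-1) ^ k * iteratedDeriv k φ x) x := by
  rw [inner_HSpace]
  refine integral_congr_ae ?_
  filter_upwards [rlH_ae hs φ] with x hx
  simp only [hx, jw, Real.rpow_zero, one_mul, mul_assoc]

theorem inner_polyH_left {s : ℝ} {k : ℕ} (hs : s ∈ Set.Ioo ((k : ℝ) - 1) k) (p : ℝ[X])
    (g : HSpace s k) : inner ℝ (polyH hs p) g =
      ∫ x in Lam, (1 + x) ^ (s - k) * p.eval x * g x := by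
  rw [inner_HSpace]
  refine integral_congr_ae ?_
  filter_upwards [polyH_ae hs p] with x hx
  simp only [hx, jw, Real.rpow_zero, one_mul, mul_assoc]

/-- Orthogonality to this range says that the weak derivative D^k g vanishes, so du Bois-Reymond
gives one inclusion and k integrations by parts give the other. -/
theorem orthogonal_range_derivH {s : ℝ} {k : ℕ} (hs : s ∈ Set.Ioo ((k : ℝ) - 1) k) :
    (LinearMap.range (derivH hs))ᗮ = lowPoly hs := by
  ext g
  rw [Submodule.mem_orthogonal']
  constructor
  · intro h
    obtain ⟨p, hp, hpe⟩ := exists_polynomial_of_pairing_iteratedDeriv_eq_zero (k := k)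
      (integrableOn_HSpace hs g).locallyIntegrableOn (fun φ hφ => by
        exact (inner_derivH hs g ⟨φ, hφ⟩).symm.trans (h _ (LinearMap.mem_range_self _ _)))
    refine ⟨p, hp, HSpace.ext ?_⟩
    exact (polyH_ae hs p).trans hpe.symm
  · rintro ⟨p, hp, rfl⟩ _ ⟨φ, rfl⟩
    rw [inner_derivH]
    have h2 := IsTest.setIntegral_iteratedDeriv_mul_eval φ.2 k p
    rw [iterate_derivative_eq_zero_of_mem_degreeLT hp] at h2
    simp only [eval_zero, mul_zero, integral_zero] at h2
    refine Eq.trans (integral_congr_ae ?_) h2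
    filter_upwards [polyH_ae hs p] with x hx
    rw [hx, mul_comm]

/-- The function m = (1+x)^{s-k} g is orthogonal to all I_+^ρ D^k φ with ρ = k - s, so it is
(1+x)^{-ρ} times a polynomial of degree less than k. The weight drops out and the complement is the
same as for `derivH`. -/
theorem orthogonal_range_rlH {s : ℝ} {k : ℕ} (hs : s ∈ Set.Ioo ((k : ℝ) - 1) k) :
    (LinearMap.range (rlH hs))ᗮ = lowPoly hs := by
  have h0 : 0 < (k : ℝ) - s := by linarith [hs.2]
  have h1 : (k : ℝ) - s < 1 := by linarith [hs.1]
  have hneg : s - k = -((k : ℝ) - s) := by ring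
  ext g
  rw [Submodule.mem_orthogonal']
  constructor
  · intro h
    have hm : IntegrableOn (fun x => (1 + x) ^ (s - k) * g x) Lam := by
      -- Integrability of m follows from Hölder, as (1+x)^{s-k} lies in the space with the dual
      -- weight; `-0` matches the form of the Hölder lemma.
      have h2 : MemLp (fun x => (1 + x) ^ (s - k)) 2 (jacobiMeasure (-0) (-(s - k))) := by
        rw [memLp_jacobi_iff]
        refine ⟨aestronglyMeasurable_one_add_rpow _, ?_⟩
        refine (integrableOn_jw (by norm_num : (-1 : ℝ) < 0)
          (by linarith : (-1 : ℝ) < s - k)).congr_fun (fun x hx => ?_) measurableSet_Lam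
        have hx1 : 0 < 1 + x := by linarith [hx.1]
        simp only [jw, neg_zero, Real.rpow_zero, one_mul]
        rw [sq, ← Real.rpow_add hx1, ← Real.rpow_add hx1]
        congr 1
        ring
      simpa only [mul_comm] using integrableOn_mul_of_memLp_jacobi (Lp.memLp g) h2
    obtain ⟨p, hp, hpe⟩ := exists_polynomial_of_fracInt_orthogonal h0 h1 (k := k) hm
      (fun φ hφ => by
        have h3 := h _ (LinearMap.mem_range_self (rlH hs) ⟨φ, hφ⟩)
        rw [inner_rlH] at h3
        simp only [fracInt_const_mul, mul_left_comm _ ((-1 : ℝ) ^ k)] at h3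
        rw [integral_const_mul] at h3
        exact (mul_eq_zero.1 h3).resolve_left (pow_ne_zero _ (by norm_num)))
    refine ⟨p, hp, HSpace.ext ?_⟩
    filter_upwards [polyH_ae hs p, hpe, ae_restrict_mem measurableSet_Lam] with x hx1 hx2 hx
    have hpos : 0 < (1 + x) ^ (s - k) := Real.rpow_pos_of_pos (by linarith [hx.1]) _
    rw [← hneg] at hx2
    rw [hx1]
    exact (mul_left_cancel₀ hpos.ne' hx2).symm
  · rintro ⟨p, hp, rfl⟩ _ ⟨φ, rfl⟩
    rw [inner_polyH_left]
    have h2 := setIntegral_weight_mul_fracInt_eq_zero h0 h1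
      ((IsTest.isChain φ.2 k).integrable k le_rfl)
      (fun p hp => (IsTest.isChain φ.2 k).integral_mul_eval_eq_zero hp) hp
    refine Eq.trans (integral_congr_ae ?_) h2
    filter_upwards [rlH_ae hs φ] with x hx
    rw [hx, hneg]

theorem closure_range_derivH {s : ℝ} {k : ℕ} (hs : s ∈ Set.Ioo ((k : ℝ) - 1) k) :
    (LinearMap.range (derivH hs)).topologicalClosure = (lowPoly hs)ᗮ := by
  rw [← orthogonal_range_derivH, Submodule.orthogonal_orthogonal_eq_closure]

theorem closure_range_rlH {s : ℝ} {k : ℕ} (hs : s ∈ Set.Ioo ((k : ℝ) - 1) k) :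
    (LinearMap.range (rlH hs)).topologicalClosure = (lowPoly hs)ᗮ := by
  rw [← orthogonal_range_rlH hs, Submodule.orthogonal_orthogonal_eq_closure]

/-! ### The weighted estimate for the fractional integral of order s. -/

/-- Cauchy-Schwarz for a nonnegative kernel. -/
theorem ofReal_integral_mul_sq_le {μ : Measure ℝ} {K g : ℝ → ℝ} (hK : ∀ y, 0 ≤ K y)
    (hKm : AEMeasurable K μ) (hg : AEMeasurable g μ) :
    ENNReal.ofReal ((∫ y, K y * g y ∂μ) ^ 2) ≤
      (∫⁻ y, ENNReal.ofReal (K y) ∂μ) * ∫⁻ y, ENNReal.ofReal (K y * g y ^ 2) ∂μ := by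
  set F : ℝ → ℝ≥0∞ := fun y => ENNReal.ofReal (√(K y)) with hF
  set G : ℝ → ℝ≥0∞ := fun y => ENNReal.ofReal (√(K y) * |g y|) with hG
  have h1 : ‖∫ y, K y * g y ∂μ‖ₑ ≤ ∫⁻ y, (F * G) y ∂μ := by
    refine (enorm_integral_le_lintegral_enorm _).trans (lintegral_mono fun y => ?_)
    simp only [hF, hG, Pi.mul_apply]
    rw [← ENNReal.ofReal_mul (Real.sqrt_nonneg _), ← mul_assoc, Real.mul_self_sqrt (hK y),
      Real.enorm_eq_ofReal_abs, abs_mul, abs_of_nonneg (hK y)]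
  have hFm : AEMeasurable F μ := hKm.sqrt.ennreal_ofReal
  have hGm : AEMeasurable G μ := (hKm.sqrt.mul hg.abs).ennreal_ofReal
  have h2 := ENNReal.lintegral_mul_le_Lp_mul_Lq μ Real.HolderConjugate.two_two hFm hGm
  have h3 := h1.trans h2
  have h4 : ENNReal.ofReal ((∫ y, K y * g y ∂μ) ^ 2) = ‖∫ y, K y * g y ∂μ‖ₑ ^ 2 := by
    rw [Real.enorm_eq_ofReal_abs, ← ENNReal.ofReal_pow (abs_nonneg _), sq_abs]
  have hsq : ∀ a : ℝ≥0∞, (a ^ (1 / 2 : ℝ)) ^ 2 = a := fun a => by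
    rw [← ENNReal.rpow_natCast, ← ENNReal.rpow_mul]
    norm_num
  rw [h4]
  refine (pow_le_pow_left₀ zero_le h3 2).trans (le_of_eq ?_)
  rw [mul_pow, hsq, hsq]
  congr 1
  · refine lintegral_congr fun y => ?_
    simp only [hF]
    rw [ENNReal.ofReal_rpow_of_nonneg (Real.sqrt_nonneg _) (by norm_num)]
    congr 1
    rw [show (2 : ℝ) = (2 : ℕ) by norm_num, Real.rpow_natCast, Real.sq_sqrt (hK y)]
  · refine lintegral_congr fun y => ?_
    simp only [hG]
    rw [ENNReal.ofReal_rpow_of_nonneg (by positivity) (by norm_num)]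
    congr 1
    rw [show (2 : ℝ) = (2 : ℕ) by norm_num, Real.rpow_natCast, mul_pow, Real.sq_sqrt (hK y), sq_abs]

/-- Taylor expansion of `(1 - z)^{s-1}`, cut off at `z = 1 / 2`. -/
theorem exists_taylor_kernel (s : ℝ) {e : ℝ} (he0 : 0 ≤ e) (he1 : e ≤ 1) {k : ℕ} (hk : 1 ≤ k) :
    ∃ c : ℕ → ℝ, ∃ M : ℝ, 0 ≤ M ∧ ∀ z : ℝ, 0 < z →
      |(if z ≤ 1 / 2 then (1 - z) ^ (s - 1) else 0) - ∑ j ∈ Finset.range k, c j * z ^ j| ≤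
        M * (z ^ (k - 1) * z ^ e) := by
  obtain ⟨n, rfl⟩ : ∃ n, k = n + 1 := ⟨k - 1, by omega⟩
  have hcd : ContDiffOn ℝ (n + 1) (fun z : ℝ => (1 - z) ^ (s - 1)) (Set.Icc 0 (1 / 2)) := by
    refine ContDiffOn.rpow_const_of_ne (by fun_prop) fun z hz => ?_
    have := hz.2
    intro h
    linarith
  obtain ⟨M₁, hM₁⟩ := exists_taylor_mean_remainder_bound (by norm_num : (0 : ℝ) ≤ 1 / 2) hcd
  set c : ℕ → ℝ := fun j => ((j.factorial : ℝ)⁻¹) *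
    iteratedDerivWithin j (fun z : ℝ => (1 - z) ^ (s - 1)) (Set.Icc 0 (1 / 2)) 0 with hc
  set M₂ : ℝ := ∑ j ∈ Finset.range (n + 1), |c j| with hM₂
  have hM₂0 : 0 ≤ M₂ := Finset.sum_nonneg fun j _ => abs_nonneg _
  -- The first entry serves z ≤ 1/2, where the Taylor remainder is of order z^k. The second serves z
  -- > 1/2, where only the polynomial remains and the final factor 2 comes from 1 ≤ 2 z^e.
  refine ⟨c, max |M₁| (M₂ * 2 ^ n * 2), by positivity, fun z hz => ?_⟩
  simp only [Nat.add_sub_cancel]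
  have hzn : 0 < z ^ n := pow_pos hz n
  have hze : 0 < z ^ e := Real.rpow_pos_of_pos hz e
  split_ifs with hz2
  · have h1 := hM₁ z ⟨hz.le, hz2⟩
    rw [taylor_within_apply, Real.norm_eq_abs] at h1
    have h2 : ∑ j ∈ Finset.range (n + 1), ((j.factorial : ℝ)⁻¹ * (z - 0) ^ j) •
        iteratedDerivWithin j (fun z : ℝ => (1 - z) ^ (s - 1)) (Set.Icc 0 (1 / 2)) 0 =
        ∑ j ∈ Finset.range (n + 1), c j * z ^ j := by
      refine Finset.sum_congr rfl fun j _ => ?_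
      simp only [hc, smul_eq_mul, sub_zero]
      ring
    rw [h2, sub_zero] at h1
    have h3 : z ≤ z ^ e := by
      calc z = z ^ (1 : ℝ) := (Real.rpow_one z).symm
        _ ≤ z ^ e := Real.rpow_le_rpow_of_exponent_ge hz (by linarith) he1
    calc _ ≤ M₁ * z ^ (n + 1) := h1
      _ ≤ |M₁| * z ^ (n + 1) := by gcongr; exact le_abs_self _
      _ = |M₁| * (z ^ n * z) := by ring
      _ ≤ |M₁| * (z ^ n * z ^ e) := by gcongr
      _ ≤ _ := by gcongr; exact le_max_left _ _
  · have hz3 : 1 ≤ 2 * z := by linarith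
    have h3 : 1 ≤ 2 * z ^ e := by
      have h4 : (1 : ℝ) ≤ (2 * z) ^ e := Real.one_le_rpow hz3 he0
      rw [Real.mul_rpow (by norm_num) hz.le] at h4
      have h5 : (2 : ℝ) ^ e ≤ 2 := by
        calc (2 : ℝ) ^ e ≤ 2 ^ (1 : ℝ) := Real.rpow_le_rpow_of_exponent_le (by norm_num) he1
          _ = 2 := Real.rpow_one 2
      nlinarith
    rw [zero_sub, abs_neg]
    calc |∑ j ∈ Finset.range (n + 1), c j * z ^ j|
        ≤ ∑ j ∈ Finset.range (n + 1), |c j * z ^ j| := Finset.abs_sum_le_sum_abs _ _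
      _ ≤ ∑ j ∈ Finset.range (n + 1), |c j| * (2 * z) ^ n := by
          refine Finset.sum_le_sum fun j hj => ?_
          rw [abs_mul, abs_of_pos (pow_pos hz j)]
          refine mul_le_mul_of_nonneg_left ?_ (abs_nonneg _)
          calc z ^ j ≤ (2 * z) ^ j := by gcongr; linarith
            _ ≤ (2 * z) ^ n := pow_le_pow_right₀ hz3 (by
              have := Finset.mem_range.1 hj; omega)
      _ = M₂ * 2 ^ n * z ^ n * 1 := by rw [← Finset.sum_mul, mul_pow]; ring
      _ ≤ M₂ * 2 ^ n * z ^ n * (2 * z ^ e) := by gcongr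
      _ = (M₂ * 2 ^ n * 2) * (z ^ n * z ^ e) := by ring
      _ ≤ _ := by gcongr; exact le_max_right _ _

/-- The part of the kernel with `1 + y ≥ 2 (1 + x)`. -/
def farK (s x y : ℝ) : ℝ := if 2 * (1 + x) ≤ 1 + y then rk s x y else 0

/-- The part of the kernel with `1 + y < 2 (1 + x)`. -/
def nearK (s x y : ℝ) : ℝ := if 2 * (1 + x) ≤ 1 + y then 0 else rk s x y

theorem nearK_add_farK (s x y : ℝ) : nearK s x y + farK s x y = rk s x y := by
  unfold nearK farK
  split_ifs <;> simp

theorem nearK_nonneg {s : ℝ} (hs : 0 < s) (x y : ℝ) : 0 ≤ nearK s x y := by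
  unfold nearK
  split_ifs
  · exact le_rfl
  · exact rk_nonneg hs x y

theorem nearK_le {s : ℝ} (hs : 0 < s) (x y : ℝ) : nearK s x y ≤ rk s x y := by
  unfold nearK
  split_ifs
  · exact rk_nonneg hs x y
  · exact le_rfl

theorem measurable_nearK (s : ℝ) : Measurable (fun p : ℝ × ℝ => nearK s p.1 p.2) := by
  unfold nearK
  exact Measurable.ite (measurableSet_le (by fun_prop) (by fun_prop)) measurable_const
    (measurable_rk s)

theorem measurable_nearK_right (s x : ℝ) : Measurable (fun y => nearK s x y) :=
  (measurable_nearK s).comp (measurable_const.prodMk measurable_id)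

theorem measurable_farK_right (s x : ℝ) : Measurable (fun y => farK s x y) := by
  unfold farK
  exact Measurable.ite (measurableSet_le (by fun_prop) (by fun_prop)) (measurable_rk_right s x)
    measurable_const

theorem integrableOn_nearK {s : ℝ} (hs : 0 < s) (x : ℝ) :
    IntegrableOn (fun y => nearK s x y) Lam := by
  refine Integrable.mono' (integrableOn_rk_right hs x) (measurable_nearK_right s x).aestronglyMeasurable
    (Filter.Eventually.of_forall fun y => ?_)
  rw [Real.norm_of_nonneg (nearK_nonneg hs x y)]
  exact nearK_le hs x y

theorem setIntegral_nearK_le {s : ℝ} (hs : 0 < s) {x z : ℝ} (hx : -1 ≤ x) (hz : z ≤ 1)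
    (h : ∀ y ∈ Lam, z ≤ y → nearK s x y = 0) :
    ∫ y in Lam, nearK s x y ≤ rk (s + 1) x z := by
  rw [← setIntegral_rk_mul_rk hs one_pos hx hz]
  refine setIntegral_mono_on (integrableOn_nearK hs x)
    (integrable_rk_mul_rk hs one_pos x z).integrableOn measurableSet_Lam fun y hy => ?_
  rcases lt_or_ge y z with h1 | h1
  · rw [rk_one, if_pos h1, mul_one]
    exact nearK_le hs x y
  · rw [h y hy h1]
    exact mul_nonneg (rk_nonneg hs _ _) (rk_nonneg one_pos _ _)

/-- For x ≥ 0 the integral is at most (1-x)^s / Γ(s+1), which absorbs the singular weight at 1. For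
x < 0 the near kernel lives on y < 1 + 2x, so its integral is of order (1+x)^s. The weight then
leaves (1+x)^{s-k}, which is comparable with the weight at y because 1 + y < 2(1+x) and s < k. -/
theorem jw_mul_integral_nearK_le {k : ℕ} {s : ℝ} (hs : s ∈ Set.Ioo ((k : ℝ) - 1) k) (hs0 : 0 < s)
    {x y : ℝ} (hx : x ∈ Lam) (hy : y ∈ Lam) (hxy : 1 + y < 2 * (1 + x)) :
    jw (-s) (-k) x * ∫ y in Lam, nearK s x y ≤
      (Real.Gamma (s + 1))⁻¹ * 2 ^ ((k : ℝ) - s) * (1 + y) ^ (s - k) := by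
  have hG := Real.Gamma_pos_of_pos (by linarith : 0 < s + 1)
  have ht : 0 < 1 + x := by linarith [hx.1]
  have hσ : 0 < 1 + y := by linarith [hy.1]
  have hr : 0 < 1 - x := by linarith [hx.2]
  have hk0 : (0 : ℝ) ≤ k := k.cast_nonneg
  have hneg : s - k ≤ 0 := by linarith [hs.2]
  have hI : 0 ≤ ∫ y in Lam, nearK s x y := integral_nonneg fun y => nearK_nonneg hs0 x y
  have hhalf : ∀ τ : ℝ, 0 < τ → 2 ^ ((k : ℝ) - s) * τ ^ (s - k) = (τ / 2) ^ (s - k) := by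
    intro τ hτ
    rw [Real.div_rpow hτ.le (by norm_num), div_eq_mul_inv, ← Real.rpow_neg (by norm_num)]
    rw [neg_sub, mul_comm]
  rw [mul_assoc, hhalf _ hσ]
  rcases le_or_gt 0 x with h0 | h0
  · have h1 : ∫ y in Lam, nearK s x y ≤ rk (s + 1) x 1 :=
      setIntegral_nearK_le hs0 hx.1.le le_rfl fun y hy h => absurd hy.2 (not_lt.2 h)
    rw [rk_of_lt hx.2, add_sub_cancel_right] at h1
    have h2 : (1 + x) ^ (-(k : ℝ)) ≤ 1 := Real.rpow_le_one_of_one_le_of_nonpos (by linarith)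
      (by linarith)
    have h3 : (1 - x) ^ (-s) * (1 - x) ^ s = 1 := by rw [← Real.rpow_add hr]; simp
    have h4 : 1 ≤ ((1 + y) / 2) ^ (s - k) :=
      Real.one_le_rpow_of_pos_of_le_one_of_nonpos (by positivity) (by linarith [hy.2]) hneg
    have h5 : 0 < (1 - x) ^ (-s) := Real.rpow_pos_of_pos hr _
    have h6 : 0 < (1 + x) ^ (-(k : ℝ)) := Real.rpow_pos_of_pos ht _
    have h7 : 0 < (1 - x) ^ s := Real.rpow_pos_of_pos hr _
    calc jw (-s) (-k) x * ∫ y in Lam, nearK s x y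
        ≤ (1 - x) ^ (-s) * 1 * ((Real.Gamma (s + 1))⁻¹ * (1 - x) ^ s) := by
          unfold jw
          gcongr
      _ = (Real.Gamma (s + 1))⁻¹ * ((1 - x) ^ (-s) * (1 - x) ^ s) := by ring
      _ = (Real.Gamma (s + 1))⁻¹ * 1 := by rw [h3]
      _ ≤ _ := by gcongr
  · have h1 : ∫ y in Lam, nearK s x y ≤ rk (s + 1) x (1 + 2 * x) := by
      refine setIntegral_nearK_le hs0 hx.1.le (by linarith) fun y hy h => ?_
      unfold nearK
      rw [if_pos (by linarith)]
    rw [rk_of_lt (by linarith), add_sub_cancel_right, show 1 + 2 * x - x = 1 + x by ring] at h1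
    have h2 : (1 - x) ^ (-s) ≤ 1 := Real.rpow_le_one_of_one_le_of_nonpos (by linarith)
      (by linarith)
    have h3 : (1 + x) ^ (-(k : ℝ)) * (1 + x) ^ s = (1 + x) ^ (s - k) := by
      rw [← Real.rpow_add ht]
      congr 1
      ring
    have h4 : (1 + x) ^ (s - k) ≤ ((1 + y) / 2) ^ (s - k) :=
      Real.rpow_le_rpow_of_nonpos (by positivity) (by linarith) hneg
    have h5 : 0 < (1 + x) ^ s := Real.rpow_pos_of_pos ht _
    have h6 : 0 < (1 + x) ^ (-(k : ℝ)) := Real.rpow_pos_of_pos ht _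
    calc jw (-s) (-k) x * ∫ y in Lam, nearK s x y
        ≤ 1 * (1 + x) ^ (-(k : ℝ)) * ((Real.Gamma (s + 1))⁻¹ * (1 + x) ^ s) := by
          unfold jw
          gcongr
      _ = (Real.Gamma (s + 1))⁻¹ * ((1 + x) ^ (-(k : ℝ)) * (1 + x) ^ s) := by ring
      _ ≤ _ := by rw [h3]; gcongr

/-- A Schur test: Cauchy-Schwarz against the near kernel, the bound above for its weighted mass,
then Tonelli and the boundedness of ∫ `rk s x y` dx. -/
theorem lintegral_near_le {k : ℕ} {s : ℝ} (hs : s ∈ Set.Ioo ((k : ℝ) - 1) k) (hs0 : 0 < s)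
    {g : ℝ → ℝ} (hg : AEMeasurable g (volume.restrict Lam)) :
    ∫⁻ x in Lam, ENNReal.ofReal (jw (-s) (-k) x * (∫ y in Lam, nearK s x y * g y) ^ 2) ≤
      ENNReal.ofReal ((Real.Gamma (s + 1))⁻¹ * 2 ^ ((k : ℝ) - s) *
        ((Real.Gamma (s + 1))⁻¹ * 2 ^ (s + 1 - 1))) *
      ∫⁻ y in Lam, ENNReal.ofReal (jw 0 (s - k) y * g y ^ 2) := by
  have hG := Real.Gamma_pos_of_pos (by linarith : 0 < s + 1)
  set c := (Real.Gamma (s + 1))⁻¹ * 2 ^ ((k : ℝ) - s) with hc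
  have hc0 : 0 < c := by positivity
  set b := (Real.Gamma (s + 1))⁻¹ * (2 : ℝ) ^ (s + 1 - 1) with hb
  have hm : AEMeasurable (Function.uncurry fun x y => ENNReal.ofReal (rk s x y) *
      ENNReal.ofReal (c * (jw 0 (s - k) y * g y ^ 2)))
      ((volume.restrict Lam).prod (volume.restrict Lam)) := by
    refine AEMeasurable.mul (measurable_rk s).ennreal_ofReal.aemeasurable ?_
    have : AEMeasurable (fun y => ENNReal.ofReal (c * (jw 0 (s - k) y * g y ^ 2)))
        (volume.restrict Lam) :=
      (((measurable_jw 0 (s - k)).aemeasurable.mul (hg.pow_const 2)).const_mul c).ennreal_ofReal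
    exact this.comp_snd
  calc ∫⁻ x in Lam, ENNReal.ofReal (jw (-s) (-k) x * (∫ y in Lam, nearK s x y * g y) ^ 2)
      ≤ ∫⁻ x in Lam, ∫⁻ y in Lam, ENNReal.ofReal (rk s x y) *
          ENNReal.ofReal (c * (jw 0 (s - k) y * g y ^ 2)) := by
        refine setLIntegral_mono' measurableSet_Lam fun x hx => ?_
        have hj := (jw_pos (-s) (-k) hx).le
        have hI : 0 ≤ ∫ y in Lam, nearK s x y := integral_nonneg fun y => nearK_nonneg hs0 x y
        rw [ENNReal.ofReal_mul hj]
        refine (mul_le_mul_right (ofReal_integral_mul_sq_le (nearK_nonneg hs0 x)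
          (measurable_nearK_right s x).aemeasurable hg) _).trans ?_
        rw [← ofReal_integral_eq_lintegral_ofReal (integrableOn_nearK hs0 x)
          (Filter.Eventually.of_forall fun y => nearK_nonneg hs0 x y), ← mul_assoc,
          ← ENNReal.ofReal_mul hj, ← lintegral_const_mul' _ _ ENNReal.ofReal_ne_top]
        refine setLIntegral_mono' measurableSet_Lam fun y hy => ?_
        rw [← ENNReal.ofReal_mul (mul_nonneg hj hI), ← ENNReal.ofReal_mul (rk_nonneg hs0 _ _)]
        refine ENNReal.ofReal_le_ofReal ?_
        rcases le_or_gt (2 * (1 + x)) (1 + y) with h | h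
        · have h0 : nearK s x y = 0 := if_pos h
          rw [h0, zero_mul, mul_zero]
          exact mul_nonneg (rk_nonneg hs0 _ _)
            (mul_nonneg hc0.le (mul_nonneg (jw_pos _ _ hy).le (sq_nonneg _)))
        · have h1 := jw_mul_integral_nearK_le hs hs0 hx hy h
          have h2 : nearK s x y = rk s x y := if_neg (not_le.2 h)
          rw [h2]
          have h3 := mul_le_mul_of_nonneg_right h1
            (mul_nonneg (rk_nonneg hs0 x y) (sq_nonneg (g y)))
          refine h3.trans (le_of_eq ?_)
          simp only [jw, Real.rpow_zero, one_mul]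
          ring
    _ = ∫⁻ y in Lam, ∫⁻ x in Lam, ENNReal.ofReal (rk s x y) *
          ENNReal.ofReal (c * (jw 0 (s - k) y * g y ^ 2)) := lintegral_lintegral_swap hm
    _ ≤ ∫⁻ y in Lam, ENNReal.ofReal (c * b) * ENNReal.ofReal (jw 0 (s - k) y * g y ^ 2) := by
        refine setLIntegral_mono' measurableSet_Lam fun y hy => ?_
        have hjg : 0 ≤ jw 0 (s - k) y * g y ^ 2 := mul_nonneg (jw_pos _ _ hy).le (sq_nonneg _)
        rw [lintegral_mul_const' _ _ ENNReal.ofReal_ne_top,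
          ← ofReal_integral_eq_lintegral_ofReal (integrableOn_rk_left hs0 y)
          (Filter.Eventually.of_forall fun x => rk_nonneg hs0 x y),
          setIntegral_rk_left hs0 hy.2.le, ← ENNReal.ofReal_mul (rk_nonneg (by linarith) _ _),
          ← ENNReal.ofReal_mul (by positivity)]
        refine ENNReal.ofReal_le_ofReal ?_
        have h1 : rk (s + 1) (-1) y ≤ b := rk_le (by linarith) le_rfl hy.2.le
        calc rk (s + 1) (-1) y * (c * (jw 0 (s - k) y * g y ^ 2)) ≤
            b * (c * (jw 0 (s - k) y * g y ^ 2)) := by gcongr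
          _ = _ := by ring
    _ = _ := lintegral_const_mul' _ _ ENNReal.ofReal_ne_top

theorem two_mul_ofReal (a : ℝ) : 2 * ENNReal.ofReal a = ENNReal.ofReal (2 * a) := by
  rw [ENNReal.ofReal_mul (by norm_num)]
  simp

theorem norm_sq_HSpace {s : ℝ} {k : ℕ} (g : HSpace s k) :
    ENNReal.ofReal (‖g‖ ^ 2) = ∫⁻ y in Lam, ENNReal.ofReal (jw 0 (s - k) y * g y ^ 2) := by
  rw [← eLpNorm_sq_jacobi, Lp.norm_def, ENNReal.ofReal_pow ENNReal.toReal_nonneg,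
    ENNReal.ofReal_toReal (Lp.eLpNorm_ne_top g)]

/-- Cauchy-Schwarz in H against (1+y)^{-e}; the hypothesis on e says precisely that this power is
square integrable for the weight (1+y)^{s-k}. -/
theorem exists_weighted_bound {s : ℝ} {k : ℕ} {e : ℝ} (he : -1 < s - k - 2 * e) :
    ∃ D : ℝ, 0 ≤ D ∧ ∀ g : HSpace s k,
      IntegrableOn (fun y => (1 + y) ^ (s - k - e) * |g y|) Lam ∧
      ∫ y in Lam, (1 + y) ^ (s - k - e) * |g y| ≤ D * ‖g‖ := by
  have hm : MemLp (fun y : ℝ => (1 + y) ^ (-e)) 2 (jacobiMeasure 0 (s - k)) := by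
    rw [memLp_jacobi_iff]
    refine ⟨aestronglyMeasurable_one_add_rpow _, ?_⟩
    refine (integrableOn_jw (by norm_num : (-1 : ℝ) < 0) he).congr_fun (fun y hy => ?_)
      measurableSet_Lam
    have hy1 : 0 < 1 + y := by linarith [hy.1]
    simp only [jw, Real.rpow_zero, one_mul]
    rw [sq, ← Real.rpow_add hy1, ← Real.rpow_add hy1]
    congr 1
    ring
  refine ⟨‖hm.toLp _‖, norm_nonneg _, fun g => ?_⟩
  have hg : MemLp (fun y => |g y|) 2 (jacobiMeasure 0 (s - k)) := (Lp.memLp g).norm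
  have hprod : ∀ y ∈ Lam, jw 0 (s - k) y * ((1 + y) ^ (-e) * |g y|) =
      (1 + y) ^ (s - k - e) * |g y| := by
    intro y hy
    have hy1 : 0 < 1 + y := by linarith [hy.1]
    simp only [jw, Real.rpow_zero, one_mul]
    rw [← mul_assoc, ← Real.rpow_add hy1]
    rfl
  constructor
  · have := integrable_jacobi_iff.1 (hm.integrable_mul hg)
    exact IntegrableOn.congr_fun this hprod measurableSet_Lam
  · have h1 : ‖hg.toLp _‖ = ‖g‖ := by
      have h0 : eLpNorm (fun y => |g y|) 2 (jacobiMeasure 0 (s - k)) =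
          eLpNorm g 2 (jacobiMeasure 0 (s - k)) :=
        eLpNorm_congr_norm_ae (Filter.Eventually.of_forall fun y => by simp)
      rw [Lp.norm_toLp, h0, Lp.norm_def]
    have h2 := real_inner_le_norm (hm.toLp _) (hg.toLp _)
    rw [h1, inner_HSpace] at h2
    refine le_trans (le_of_eq (integral_congr_ae ?_)) h2
    filter_upwards [coeFn_toLp_ae hm, coeFn_toLp_ae hg, ae_restrict_mem measurableSet_Lam]
      with y h3 h4 hy
    rw [h3, h4, hprod y hy]

theorem integrableOn_weight_mul {s : ℝ} {k : ℕ} (hs : s ∈ Set.Ioo ((k : ℝ) - 1) k) (p : ℝ[X])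
    (g : HSpace s k) : IntegrableOn (fun x => (1 + x) ^ (s - k) * p.eval x * g x) Lam := by
  have h := integrable_jacobi_iff.1 ((memLp_eval (by norm_num : (-1 : ℝ) < 0)
    (by linarith [hs.1] : -1 < s - k) p).integrable_mul (Lp.memLp g))
  refine IntegrableOn.congr_fun h (fun x _ => ?_) measurableSet_Lam
  simp only [jw, Real.rpow_zero, one_mul, Pi.mul_apply]
  ring

theorem inner_polyH_eq_zero {s : ℝ} {k : ℕ} (hs : s ∈ Set.Ioo ((k : ℝ) - 1) k) {g : HSpace s k}
    (hg : g ∈ (lowPoly hs)ᗮ) {p : ℝ[X]} (hp : p ∈ degreeLT ℝ k) :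
    ∫ x in Lam, (1 + x) ^ (s - k) * p.eval x * g x = 0 := by
  rw [← inner_polyH_left hs]
  exact (Submodule.mem_orthogonal _ _).1 hg _ ⟨p, hp, rfl⟩

/-- With z = (1+x)/(1+y) ≤ 1/2 the kernel is (1+y)^{s-1}(1-z)^{s-1}/Γ(s). The first k Taylor terms
in z form (1+y)^{s-k} times a polynomial of degree less than k in y, to which g is orthogonal. The
remainder carries the factor (1+x)^{k-1+e}, the decay at -1 that the weight (1+x)^{-k} requires. -/
theorem abs_integral_farK_le {s : ℝ} {k : ℕ} (hk : 1 ≤ k) (hs : s ∈ Set.Ioo ((k : ℝ) - 1) k)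
    {e : ℝ} (he0 : 0 ≤ e) (he1 : e ≤ 1) (he : -1 < s - k - 2 * e) :
    ∃ M : ℝ, 0 ≤ M ∧ ∀ g ∈ (lowPoly hs)ᗮ, ∀ x ∈ Lam,
      IntegrableOn (fun y => rk s x y * g y) Lam →
      |∫ y in Lam, farK s x y * g y| ≤ M * ((1 + x) ^ (k - 1) * (1 + x) ^ e) * ‖g‖ := by
  have hs0 : 0 < s := by
    have : (1 : ℝ) ≤ k := by exact_mod_cast hk
    linarith [hs.1]
  have hG := Real.Gamma_pos_of_pos hs0
  obtain ⟨c, M, hM0, hM⟩ := exists_taylor_kernel s he0 he1 hk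
  obtain ⟨D, hD0, hD⟩ := exists_weighted_bound (s := s) (k := k) he
  refine ⟨(Real.Gamma s)⁻¹ * M * D, by positivity, fun g hg x hx hint => ?_⟩
  have ht : 0 < 1 + x := by linarith [hx.1]
  -- Here x is a parameter: multiplying the Taylor sum by (1+y)^{k-1} clears the denominators, since
  -- j ≤ k - 1.
  set Q : ℝ[X] := ∑ j ∈ Finset.range k,
    C ((Real.Gamma s)⁻¹ * c j * (1 + x) ^ j) * (1 + X) ^ (k - 1 - j) with hQ
  have hQmem : Q ∈ degreeLT ℝ k := by
    refine Submodule.sum_mem _ fun j hj => ?_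
    rw [C_mul']
    refine Submodule.smul_mem _ _ ?_
    rw [mem_degreeLT]
    refine degree_le_natDegree.trans_lt ?_
    have h1 : (1 + X : ℝ[X]).natDegree = 1 := by
      rw [add_comm]
      exact natDegree_X_add_C (1 : ℝ)
    rw [natDegree_pow, h1]
    exact_mod_cast (by omega : (k - 1 - j) * 1 < k)
  have hQe : ∀ y ∈ Lam, (1 + y) ^ (s - k) * Q.eval y = (Real.Gamma s)⁻¹ * (1 + y) ^ (s - 1) *
      ∑ j ∈ Finset.range k, c j * ((1 + x) / (1 + y)) ^ j := by
    intro y hy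
    have hσ : 0 < 1 + y := by linarith [hy.1]
    simp only [hQ, eval_finsetSum, eval_mul, eval_C, eval_pow, eval_add, eval_one, eval_X]
    rw [Finset.mul_sum, Finset.mul_sum]
    refine Finset.sum_congr rfl fun j hj => ?_
    have hj' : j ≤ k - 1 := by
      have := Finset.mem_range.1 hj
      omega
    have h1 : (1 + y) ^ (s - 1) = (1 + y) ^ (s - k) * (1 + y) ^ (k - 1) := by
      rw [← Real.rpow_natCast, ← Real.rpow_add hσ]
      congr 1
      push_cast [hk]
      ring
    have h2 : (1 + y) ^ (k - 1) = (1 + y) ^ (k - 1 - j) * (1 + y) ^ j := by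
      rw [← pow_add]
      congr 1
      omega
    rw [h1, h2, div_pow]
    field_simp
  have hfar : ∀ y ∈ Lam, farK s x y = (Real.Gamma s)⁻¹ * (1 + y) ^ (s - 1) *
      (if (1 + x) / (1 + y) ≤ 1 / 2 then (1 - (1 + x) / (1 + y)) ^ (s - 1) else 0) := by
    intro y hy
    have hσ : 0 < 1 + y := by linarith [hy.1]
    have hiff : (1 + x) / (1 + y) ≤ 1 / 2 ↔ 2 * (1 + x) ≤ 1 + y := by
      rw [div_le_div_iff₀ hσ (by norm_num)]
      constructor <;> intro h <;> linarith
    unfold farK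
    simp only [hiff]
    split_ifs with h
    · have hxy : x < y := by linarith
      rw [rk_of_lt hxy, mul_assoc, ← Real.mul_rpow hσ.le]
      · congr 2
        field_simp
        ring
      · rw [sub_nonneg, div_le_one hσ]
        linarith
    · simp
  have hdiff : ∀ y ∈ Lam, |farK s x y - (1 + y) ^ (s - k) * Q.eval y| ≤
      (Real.Gamma s)⁻¹ * M * ((1 + x) ^ (k - 1) * (1 + x) ^ e) * (1 + y) ^ (s - k - e) := by
    intro y hy
    have hσ : 0 < 1 + y := by linarith [hy.1]
    have hσ1 : 0 < (1 + y) ^ (s - 1) := Real.rpow_pos_of_pos hσ _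
    rw [hfar y hy, hQe y hy, ← mul_sub, abs_mul, abs_of_pos (by positivity)]
    refine (mul_le_mul_of_nonneg_left (hM _ (div_pos ht hσ)) (by positivity)).trans (le_of_eq ?_)
    have h1 : (1 + y) ^ (s - 1) = (1 + y) ^ (s - k - e) * (1 + y) ^ (k - 1) * (1 + y) ^ e := by
      rw [← Real.rpow_natCast, ← Real.rpow_add hσ, ← Real.rpow_add hσ]
      congr 1
      push_cast [hk]
      ring
    have hσe : 0 < (1 + y) ^ e := Real.rpow_pos_of_pos hσ _
    rw [h1, div_pow, Real.div_rpow ht.le hσ.le]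
    field_simp
  have hi1 : IntegrableOn (fun y => farK s x y * g y) Lam := by
    refine Integrable.mono' hint.norm ((measurable_farK_right s x).aestronglyMeasurable.mul
      (integrableOn_HSpace hs g).aestronglyMeasurable) (Filter.Eventually.of_forall fun y => ?_)
    rw [norm_mul, norm_mul]
    refine mul_le_mul_of_nonneg_right ?_ (norm_nonneg _)
    unfold farK
    split_ifs
    · exact le_rfl
    · simp
  have hi2 := integrableOn_weight_mul hs Q g
  have heq : ∫ y in Lam, farK s x y * g y =
      ∫ y in Lam, (farK s x y - (1 + y) ^ (s - k) * Q.eval y) * g y := by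
    simp only [sub_mul]
    rw [integral_sub hi1 hi2, inner_polyH_eq_zero hs hg hQmem, sub_zero]
  rw [heq]
  calc |∫ y in Lam, (farK s x y - (1 + y) ^ (s - k) * Q.eval y) * g y|
      ≤ ∫ y in Lam, |(farK s x y - (1 + y) ^ (s - k) * Q.eval y) * g y| :=
        abs_integral_le_integral_abs
    _ ≤ ∫ y in Lam, (Real.Gamma s)⁻¹ * M * ((1 + x) ^ (k - 1) * (1 + x) ^ e) *
          ((1 + y) ^ (s - k - e) * |g y|) := by
        refine integral_mono_of_nonneg (Filter.Eventually.of_forall fun y => abs_nonneg _)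
          ((hD g).1.const_mul _) ?_
        filter_upwards [ae_restrict_mem measurableSet_Lam] with y hy
        rw [abs_mul, ← mul_assoc]
        exact mul_le_mul_of_nonneg_right (hdiff y hy) (abs_nonneg _)
    _ ≤ (Real.Gamma s)⁻¹ * M * ((1 + x) ^ (k - 1) * (1 + x) ^ e) * (D * ‖g‖) := by
        rw [integral_const_mul]
        have hte : 0 < (1 + x) ^ e := Real.rpow_pos_of_pos ht _
        exact mul_le_mul_of_nonneg_left (hD g).2 (by positivity)
    _ = _ := by ring

/-- The weighted estimate `‖I_+^s g‖_{ω^{(-s,-k)}} ≤ C ‖g‖_{ω^{(0,s-k)}}` for `g` orthogonal to the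
polynomials of degree less than `k`. -/
theorem exists_fracInt_estimate {s : ℝ} {k : ℕ} (hk : 1 ≤ k) (hs : s ∈ Set.Ioo ((k : ℝ) - 1) k) :
    ∃ C : ℝ, 0 ≤ C ∧ ∀ g ∈ (lowPoly hs)ᗮ,
      eLpNorm (fracInt s g) 2 (jacobiMeasure (-s) (-k)) ^ 2 ≤ ENNReal.ofReal (C * ‖g‖ ^ 2) := by
  have hk1 : (1 : ℝ) ≤ k := by exact_mod_cast hk
  have hs0 : 0 < s := by linarith [hs.1]
  have hG := Real.Gamma_pos_of_pos (by linarith : 0 < s + 1)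
  -- Any positive e with -1 < s - k - 2e and e ≤ 1 would do. Positivity is needed for k = 1, where
  -- the final weight (1+x)^{k-2+2e} must be integrable.
  set e : ℝ := (s - k + 1) / 4 with he
  have he0 : 0 < e := by rw [he]; linarith [hs.1]
  obtain ⟨M, hM0, hM⟩ := abs_integral_farK_le hk hs he0.le (by rw [he]; linarith [hs.2])
    (by rw [he]; linarith [hs.1])
  set c := (Real.Gamma (s + 1))⁻¹ * 2 ^ ((k : ℝ) - s) *
        ((Real.Gamma (s + 1))⁻¹ * 2 ^ (s + 1 - 1)) with hc
  have hc0 : 0 ≤ c := by positivity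
  have hjint : IntegrableOn (jw 0 (k - 2 + 2 * e)) Lam :=
    integrableOn_jw (by norm_num) (by linarith)
  set J : ℝ := ∫ x in Lam, jw 0 (k - 2 + 2 * e) x with hJ
  have hJ0 : 0 ≤ J := setIntegral_nonneg measurableSet_Lam fun x hx => (jw_pos _ _ hx).le
  refine ⟨2 * c + 2 * (M ^ 2 * J), by positivity, fun g hg => ?_⟩
  have hgi := integrableOn_HSpace hs g
  have hB : ∀ᵐ x ∂(volume.restrict Lam),
      jw (-s) (-k) x * (∫ y in Lam, farK s x y * g y) ^ 2 ≤
        M ^ 2 * ‖g‖ ^ 2 * jw 0 (k - 2 + 2 * e) x := by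
    filter_upwards [ae_integrable_rk hs0 hgi, ae_restrict_mem measurableSet_Lam] with x hint hx
    have ht : 0 < 1 + x := by linarith [hx.1]
    -- For x ≥ 0 no y < 1 satisfies 2(1+x) ≤ 1+y, so the far part is absent where (1-x)^{-s} is
    -- singular.
    rcases le_or_gt 0 x with h0 | h0
    · have h1 : ∫ y in Lam, farK s x y * g y = 0 := by
        refine setIntegral_eq_zero_of_forall_eq_zero fun y hy => ?_
        simp only [farK, if_neg (by linarith [hy.2] : ¬ 2 * (1 + x) ≤ 1 + y), zero_mul]
      rw [h1]
      have := jw_pos 0 (k - 2 + 2 * e) hx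
      have : 0 ≤ M ^ 2 * ‖g‖ ^ 2 * jw 0 (k - 2 + 2 * e) x := by positivity
      simpa using this
    · have h1 := hM g hg x hx hint
      have h2 : (∫ y in Lam, farK s x y * g y) ^ 2 ≤
          (M * ((1 + x) ^ (k - 1) * (1 + x) ^ e) * ‖g‖) ^ 2 := by
        rw [← sq_abs (∫ y in Lam, farK s x y * g y)]
        gcongr
      have h3 : jw (-s) (-k) x ≤ (1 + x) ^ (-(k : ℝ)) := by
        have h4 : (1 - x) ^ (-s) ≤ 1 :=
          Real.rpow_le_one_of_one_le_of_nonpos (by linarith) (by linarith)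
        have h5 : 0 < (1 + x) ^ (-(k : ℝ)) := Real.rpow_pos_of_pos ht _
        unfold jw
        nlinarith
      have h6 : (1 + x) ^ (-(k : ℝ)) * ((1 + x) ^ (k - 1) * (1 + x) ^ e) ^ 2 =
          jw 0 (k - 2 + 2 * e) x := by
        simp only [jw, Real.rpow_zero, one_mul]
        rw [← Real.rpow_natCast (1 + x) (k - 1), ← Real.rpow_add ht, ← Real.rpow_natCast,
          ← Real.rpow_mul ht.le, ← Real.rpow_add ht]
        congr 1
        push_cast [hk]
        ring
      have h7 : 0 < (1 + x) ^ (-(k : ℝ)) := Real.rpow_pos_of_pos ht _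
      calc jw (-s) (-k) x * (∫ y in Lam, farK s x y * g y) ^ 2
          ≤ (1 + x) ^ (-(k : ℝ)) * (M * ((1 + x) ^ (k - 1) * (1 + x) ^ e) * ‖g‖) ^ 2 := by
            gcongr
        _ = M ^ 2 * ‖g‖ ^ 2 *
            ((1 + x) ^ (-(k : ℝ)) * ((1 + x) ^ (k - 1) * (1 + x) ^ e) ^ 2) := by ring
        _ = _ := by rw [h6]
  have hsplit : ∀ᵐ x ∂(volume.restrict Lam), ENNReal.ofReal (jw (-s) (-k) x * fracInt s g x ^ 2) ≤
      2 * ENNReal.ofReal (jw (-s) (-k) x * (∫ y in Lam, nearK s x y * g y) ^ 2) +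
      2 * ENNReal.ofReal (M ^ 2 * ‖g‖ ^ 2 * jw 0 (k - 2 + 2 * e) x) := by
    filter_upwards [hB, ae_integrable_rk hs0 hgi, ae_restrict_mem measurableSet_Lam]
      with x hBx hint hx
    have hj := jw_pos (-s) (-k) hx
    have hj2 := jw_pos 0 (k - 2 + 2 * e) hx
    have hdom : ∀ K : ℝ → ℝ, Measurable K → (∀ y, |K y| ≤ rk s x y) →
        IntegrableOn (fun y => K y * g y) Lam := by
      intro K hKm hK
      refine Integrable.mono' hint.norm (hKm.aestronglyMeasurable.mul
        hgi.aestronglyMeasurable) (Filter.Eventually.of_forall fun y => ?_)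
      rw [norm_mul, norm_mul, Real.norm_of_nonneg (rk_nonneg hs0 x y)]
      exact mul_le_mul_of_nonneg_right (hK y) (norm_nonneg _)
    have hi1 := hdom (fun y => nearK s x y) (measurable_nearK_right s x) fun y => by
      rw [abs_of_nonneg (nearK_nonneg hs0 x y)]
      exact nearK_le hs0 x y
    have hi2 := hdom (fun y => farK s x y) (measurable_farK_right s x) fun y => by
      unfold farK
      split_ifs
      · rw [abs_of_nonneg (rk_nonneg hs0 x y)]
      · rw [abs_zero]
        exact rk_nonneg hs0 x y
    have hsum : fracInt s g x = (∫ y in Lam, nearK s x y * g y) + ∫ y in Lam, farK s x y * g y := by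
      rw [fracInt_eq _ hx.1.le, ← integral_add hi1 hi2]
      congr 1
      funext y
      rw [← add_mul, nearK_add_farK]
    rw [hsum, two_mul_ofReal, two_mul_ofReal,
      ← ENNReal.ofReal_add (by positivity) (by positivity)]
    refine ENNReal.ofReal_le_ofReal ?_
    set A := ∫ y in Lam, nearK s x y * g y
    set B := ∫ y in Lam, farK s x y * g y
    nlinarith [mul_nonneg hj.le (sq_nonneg (A - B))]
  rw [eLpNorm_sq_jacobi]
  refine (lintegral_mono_ae hsplit).trans ?_
  have hm2 : Measurable fun x => 2 * ENNReal.ofReal (M ^ 2 * ‖g‖ ^ 2 * jw 0 (k - 2 + 2 * e) x) :=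
    ((measurable_jw _ _).const_mul _).ennreal_ofReal.const_mul _
  rw [lintegral_add_right _ hm2, lintegral_const_mul' _ _ (by simp),
    lintegral_const_mul' _ _ (by simp)]
  have hnear := lintegral_near_le hs hs0 hgi.aestronglyMeasurable.aemeasurable
  rw [← norm_sq_HSpace, ← hc, ← ENNReal.ofReal_mul hc0] at hnear
  have hfarI : ∫⁻ x in Lam, ENNReal.ofReal (M ^ 2 * ‖g‖ ^ 2 * jw 0 (k - 2 + 2 * e) x) =
      ENNReal.ofReal (M ^ 2 * ‖g‖ ^ 2 * J) := by
    rw [hJ, ← integral_const_mul, ofReal_integral_eq_lintegral_ofReal (hjint.const_mul _)]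
    filter_upwards [ae_restrict_mem measurableSet_Lam] with x hx
    have := jw_pos 0 (k - 2 + 2 * e) hx
    simp only [Pi.zero_apply]
    positivity
  rw [hfarI]
  calc 2 * _ + 2 * ENNReal.ofReal (M ^ 2 * ‖g‖ ^ 2 * J)
      ≤ 2 * ENNReal.ofReal (c * ‖g‖ ^ 2) + 2 * ENNReal.ofReal (M ^ 2 * ‖g‖ ^ 2 * J) := by
        gcongr
    _ = ENNReal.ofReal ((2 * c + 2 * (M ^ 2 * J)) * ‖g‖ ^ 2) := by
        rw [two_mul_ofReal, two_mul_ofReal,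
          ← ENNReal.ofReal_add (by positivity) (by positivity)]
        congr 1
        ring

/-! ### Pointwise bounds for test functions. -/

theorem IsTest.comp_neg {φ : ℝ → ℝ} (h : IsTest φ) : IsTest (fun x => φ (-x)) := by
  refine ⟨h.1.comp contDiff_neg, h.2.1.comp_homeomorph (Homeomorph.neg ℝ), ?_⟩
  have h1 : tsupport (fun x => φ (-x)) ⊆ (fun x : ℝ => -x) ⁻¹' tsupport φ :=
    closure_minimal (fun x hx => subset_closure hx)
      ((isClosed_tsupport φ).preimage continuous_neg)
  exact fun x hx => neg_mem_Lam.1 (h.2.2 (h1 hx))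

theorem IsTest.eq_setIntegral_right {φ : ℝ → ℝ} (h : IsTest φ) {k : ℕ} (hk : 1 ≤ k) {x : ℝ}
    (hx : x ∈ Lam) :
    φ x = ∫ y in Lam, rk k x y * ((-1) ^ k * _root_.iteratedDeriv k φ y) := by
  have h1 := (h.isChain k).fracInt_eq hk hx
  rw [GJF.fracInt_eq _ hx.1.le] at h1
  simpa using h1.symm

theorem IsTest.eq_setIntegral_left {φ : ℝ → ℝ} (h : IsTest φ) {k : ℕ} (hk : 1 ≤ k) {x : ℝ}
    (hx : x ∈ Lam) : φ x = ∫ y in Lam, rk k y x * _root_.iteratedDeriv k φ y := by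
  have h1 := h.comp_neg.eq_setIntegral_right hk (neg_mem_Lam.2 hx)
  rw [neg_neg] at h1
  rw [h1, ← setIntegral_comp_neg]
  congr 1
  funext y
  rw [iteratedDeriv_comp_neg, neg_neg, rk_neg_neg, smul_eq_mul, ← mul_assoc ((-1 : ℝ) ^ k),
    ← mul_pow]
  simp

theorem IsTest.hasWeakDeriv {φ : ℝ → ℝ} (h : IsTest φ) {k : ℕ} (hk : 1 ≤ k) :
    HasWeakDeriv k φ (_root_.iteratedDeriv k φ) := by
  have h1 := hasWeakDeriv_fracInt hk ((h.isChain k).integrable k le_rfl)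
  have h2 : (fun x => (-1 : ℝ) ^ k * ((-1) ^ k * _root_.iteratedDeriv k φ x)) =
      _root_.iteratedDeriv k φ := by
    funext x
    rw [← mul_assoc, ← mul_pow]
    simp
  rw [h2] at h1
  refine h1.congr ?_
  filter_upwards [ae_restrict_mem measurableSet_Lam] with x hx
  simpa using (h.isChain k).fracInt_eq hk hx

theorem abs_iteratedDeriv_ae {s : ℝ} {k : ℕ} (hs : s ∈ Set.Ioo ((k : ℝ) - 1) k) (φ : testSpace) :
    ∀ᵐ y ∂(volume.restrict Lam),
      |iteratedDeriv k φ y| = (1 + y) ^ (s - k) * |derivH hs φ y| := by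
  filter_upwards [derivH_ae hs φ, ae_restrict_mem measurableSet_Lam] with y h1 hy
  have hσ : 0 < 1 + y := by linarith [hy.1]
  rw [h1, abs_mul, abs_of_pos (Real.rpow_pos_of_pos hσ _), ← mul_assoc, ← Real.rpow_add hσ]
  simp

/-- The pointwise bound for test functions in terms of the norm of the `k`-th derivative. -/
theorem exists_test_bound {s : ℝ} {k : ℕ} (hk : 1 ≤ k) (hs : s ∈ Set.Ioo ((k : ℝ) - 1) k)
    {e : ℝ} (he0 : 0 ≤ e) (he : -1 < s - k - 2 * e) :
    ∃ M : ℝ, 0 ≤ M ∧ ∀ φ : testSpace, ∀ x ∈ Lam,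
      |(φ : ℝ → ℝ) x| ≤ M * jw (k - 1) (k - 1 + e) x * ‖derivH hs φ‖ := by
  have hk1 : (1 : ℝ) ≤ k := by exact_mod_cast hk
  have hG := Real.Gamma_pos_of_pos (by linarith : (0 : ℝ) < k)
  -- For x ≥ 0, φ is represented from the right end and e = 0 suffices. For x < 0 it is represented
  -- from the left end, and the additional decay (1+x)^e has to be gained.
  obtain ⟨D₀, hD₀0, hD₀⟩ := exists_weighted_bound (s := s) (k := k) (e := 0) (by linarith [hs.1])
  obtain ⟨D, hD0, hD⟩ := exists_weighted_bound (s := s) (k := k) he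
  refine ⟨(Real.Gamma k)⁻¹ * max D₀ D, by positivity, fun φ x hx => ?_⟩
  have ht : 0 < 1 + x := by linarith [hx.1]
  have hr : 0 < 1 - x := by linarith [hx.2]
  have hN : 0 ≤ ‖derivH hs φ‖ := norm_nonneg _
  unfold jw
  rcases le_or_gt 0 x with h0 | h0
  · have h1 : 1 ≤ (1 + x) ^ ((k : ℝ) - 1 + e) := Real.one_le_rpow (by linarith) (by linarith)
    have h2 : 0 < (1 - x) ^ ((k : ℝ) - 1) := Real.rpow_pos_of_pos hr _
    calc |(φ : ℝ → ℝ) x| = |∫ y in Lam, rk k x y * ((-1) ^ k * iteratedDeriv k φ y)| := by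
          rw [← IsTest.eq_setIntegral_right φ.2 hk hx]
      _ ≤ ∫ y in Lam, |rk k x y * ((-1) ^ k * iteratedDeriv k φ y)| := abs_integral_le_integral_abs
      _ ≤ ∫ y in Lam, (Real.Gamma k)⁻¹ * (1 - x) ^ ((k : ℝ) - 1) *
            ((1 + y) ^ (s - k - 0) * |derivH hs φ y|) := by
          refine integral_mono_of_nonneg (Filter.Eventually.of_forall fun y => abs_nonneg _)
            ((hD₀ _).1.const_mul _) ?_
          filter_upwards [abs_iteratedDeriv_ae hs φ, ae_restrict_mem measurableSet_Lam] with y h3 hy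
          rw [abs_mul, abs_mul, abs_pow, abs_neg, abs_one, one_pow, one_mul, h3, sub_zero,
            abs_of_nonneg (rk_nonneg (by linarith) x y)]
          have hσ : 0 < (1 + y) ^ (s - k) := Real.rpow_pos_of_pos (by linarith [hy.1]) _
          refine mul_le_mul_of_nonneg_right ?_ (by positivity)
          rcases lt_or_ge x y with hxy | hxy
          · rw [rk_of_lt hxy]
            have : (y - x) ^ ((k : ℝ) - 1) ≤ (1 - x) ^ ((k : ℝ) - 1) :=
              Real.rpow_le_rpow (by linarith) (by linarith [hy.2]) (by linarith)
            gcongr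
          · rw [rk_of_le hxy]
            positivity
      _ ≤ (Real.Gamma k)⁻¹ * (1 - x) ^ ((k : ℝ) - 1) * (D₀ * ‖derivH hs φ‖) := by
          rw [integral_const_mul]
          exact mul_le_mul_of_nonneg_left (hD₀ _).2 (by positivity)
      _ ≤ (Real.Gamma k)⁻¹ * (1 - x) ^ ((k : ℝ) - 1) * (max D₀ D * ‖derivH hs φ‖) * 1 := by
          rw [mul_one]
          gcongr
          exact le_max_left _ _
      _ ≤ (Real.Gamma k)⁻¹ * (1 - x) ^ ((k : ℝ) - 1) * (max D₀ D * ‖derivH hs φ‖) *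
            (1 + x) ^ ((k : ℝ) - 1 + e) := by
          have : 0 ≤ max D₀ D := hD0.trans (le_max_right _ _)
          gcongr
      _ = _ := by ring
  · have h1 : 1 ≤ (1 - x) ^ ((k : ℝ) - 1) := Real.one_le_rpow (by linarith) (by linarith)
    have h2 : 0 < (1 + x) ^ ((k : ℝ) - 1 + e) := Real.rpow_pos_of_pos ht _
    calc |(φ : ℝ → ℝ) x| = |∫ y in Lam, rk k y x * iteratedDeriv k φ y| := by
          rw [← IsTest.eq_setIntegral_left φ.2 hk hx]
      _ ≤ ∫ y in Lam, |rk k y x * iteratedDeriv k φ y| := abs_integral_le_integral_abs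
      _ ≤ ∫ y in Lam, (Real.Gamma k)⁻¹ * (1 + x) ^ ((k : ℝ) - 1 + e) *
            ((1 + y) ^ (s - k - e) * |derivH hs φ y|) := by
          refine integral_mono_of_nonneg (Filter.Eventually.of_forall fun y => abs_nonneg _)
            ((hD _).1.const_mul _) ?_
          filter_upwards [abs_iteratedDeriv_ae hs φ, ae_restrict_mem measurableSet_Lam] with y h3 hy
          have hσ : 0 < 1 + y := by linarith [hy.1]
          rw [abs_mul, h3, abs_of_nonneg (rk_nonneg (by linarith) y x), ← mul_assoc, ← mul_assoc]
          refine mul_le_mul_of_nonneg_right ?_ (abs_nonneg _)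
          have hσ1 : 0 < (1 + y) ^ (s - k) := Real.rpow_pos_of_pos hσ _
          have hσ2 : 0 < (1 + y) ^ (s - k - e) := Real.rpow_pos_of_pos hσ _
          rcases lt_or_ge y x with hxy | hxy
          · rw [rk_of_lt hxy]
            have h4 : (x - y) ^ ((k : ℝ) - 1) ≤ (1 + x) ^ ((k : ℝ) - 1) :=
              Real.rpow_le_rpow (by linarith) (by linarith [hy.1]) (by linarith)
            -- The gain at -1: as y < x, part of the weight at y is traded for a power of 1 + x.
            have h5 : (1 + y) ^ e ≤ (1 + x) ^ e := Real.rpow_le_rpow hσ.le (by linarith) he0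
            have h6 : (1 + y) ^ (s - k) = (1 + y) ^ (s - k - e) * (1 + y) ^ e := by
              rw [← Real.rpow_add hσ]
              congr 1
              ring
            have h7 : 0 < (1 + y) ^ e := Real.rpow_pos_of_pos hσ _
            have h8 : 0 < (1 + x) ^ ((k : ℝ) - 1) := Real.rpow_pos_of_pos ht _
            rw [h6, Real.rpow_add ht]
            calc (Real.Gamma k)⁻¹ * (x - y) ^ ((k : ℝ) - 1) * ((1 + y) ^ (s - k - e) * (1 + y) ^ e)
                ≤ (Real.Gamma k)⁻¹ * (1 + x) ^ ((k : ℝ) - 1) *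
                  ((1 + y) ^ (s - k - e) * (1 + x) ^ e) := by gcongr
              _ = _ := by ring
          · rw [rk_of_le hxy, zero_mul]
            positivity
      _ ≤ (Real.Gamma k)⁻¹ * (1 + x) ^ ((k : ℝ) - 1 + e) * (D * ‖derivH hs φ‖) := by
          rw [integral_const_mul]
          exact mul_le_mul_of_nonneg_left (hD _).2 (by positivity)
      _ ≤ (Real.Gamma k)⁻¹ * (1 + x) ^ ((k : ℝ) - 1 + e) * (max D₀ D * ‖derivH hs φ‖) * 1 := by
          rw [mul_one]
          gcongr
          exact le_max_right _ _
      _ ≤ (Real.Gamma k)⁻¹ * (1 + x) ^ ((k : ℝ) - 1 + e) * (max D₀ D * ‖derivH hs φ‖) *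
            (1 - x) ^ ((k : ℝ) - 1) := by
          have : 0 ≤ max D₀ D := hD0.trans (le_max_right _ _)
          gcongr
      _ = _ := by ring

/-- The pointwise majorant lies in the dual of the space containing f. This is where e > 0 is
indispensable if k = 1. -/
theorem memLp_jw_bound {s : ℝ} {k : ℕ} (hk : 1 ≤ k) (hs : s ∈ Set.Ioo ((k : ℝ) - 1) k)
    {e : ℝ} (he : 0 < e) :
    MemLp (jw (k - 1) (k - 1 + e)) 2 (jacobiMeasure (-s) (-k)) := by
  have hk1 : (1 : ℝ) ≤ k := by exact_mod_cast hk
  rw [memLp_jacobi_iff]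
  refine ⟨(measurable_jw _ _).aestronglyMeasurable, ?_⟩
  refine (integrableOn_jw (α := 2 * k - 2 - s) (β := k - 2 + 2 * e) (by linarith [hs.2])
    (by linarith)).congr_fun (fun x hx => ?_) measurableSet_Lam
  simp only [sq]
  rw [jw_mul_jw _ _ _ _ hx, jw_mul_jw _ _ _ _ hx]
  congr 1 <;> ring

/-! ### Riesz representation, and the comparison of weighted norms. -/

/-- A bounded functional factoring through `T` is represented by an element of the closure of the
range of `T`. -/
theorem exists_mem_closure_range_inner_eq {E H : Type*} [AddCommGroup E] [Module ℝ E]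
    [NormedAddCommGroup H] [InnerProductSpace ℝ H] [CompleteSpace H] (T : E →ₗ[ℝ] H)
    (l : E →ₗ[ℝ] ℝ) {C : ℝ} (h : ∀ x, |l x| ≤ C * ‖T x‖) :
    ∃ g ∈ (LinearMap.range T).topologicalClosure, ∀ x, inner ℝ g (T x) = l x := by
  -- The bound makes l vanish on the kernel of T, so l descends to the range, where it is
  -- continuous.
  have hker : LinearMap.ker T ≤ LinearMap.ker l := by
    intro x hx
    rw [LinearMap.mem_ker] at hx ⊢
    have := h x
    rw [hx, norm_zero, mul_zero] at this
    exact abs_nonpos_iff.1 this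
  set l' : LinearMap.range T →ₗ[ℝ] ℝ :=
    ((LinearMap.ker T).liftQ l hker).comp T.quotKerEquivRange.symm.toLinearMap with hl'
  have hl'T : ∀ x, l' ⟨T x, LinearMap.mem_range_self T x⟩ = l x := by
    intro x
    simp only [hl', LinearMap.comp_apply, LinearEquiv.coe_coe]
    rw [LinearMap.quotKerEquivRange_symm_apply_image]
    simp
  obtain ⟨G, hG, -⟩ := exists_extension_norm_eq (LinearMap.range T) (l'.mkContinuous C (by
    rintro ⟨_, x, rfl⟩
    rw [hl'T]
    exact h x))
  set K := (LinearMap.range T).topologicalClosure with hK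
  have : CompleteSpace K := (Submodule.isClosed_topologicalClosure _).completeSpace_coe
  -- The Riesz vector of the Hahn-Banach extension is projected onto the closed range; this does not
  -- change its products with the range.
  refine ⟨K.starProjection ((InnerProductSpace.toDual ℝ H).symm G),
    Submodule.starProjection_apply_mem _ _, fun x => ?_⟩
  have hx : T x ∈ K := Submodule.le_topologicalClosure _ (LinearMap.mem_range_self T x)
  rw [Submodule.inner_starProjection_left_eq_right, Submodule.starProjection_eq_self_iff.2 hx,
    InnerProductSpace.toDual_symm_apply]
  have := hG ⟨T x, LinearMap.mem_range_self T x⟩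
  rw [this, LinearMap.mkContinuous_apply, hl'T]

theorem eq_of_sq_eq {a b : ℝ≥0∞} (h : a ^ 2 = b ^ 2) : a = b := by
  have hsq : ∀ a : ℝ≥0∞, (a ^ 2) ^ (1 / 2 : ℝ) = a := fun a => by
    rw [← ENNReal.rpow_natCast, ← ENNReal.rpow_mul]
    norm_num
  rw [← hsq a, ← hsq b, h]

/-- Multiplication by (1+x)^{k-s} carries the norm of D^k v in V isometrically to the norm of H. -/
theorem eLpNorm_weight {s : ℝ} {k : ℕ} (w : ℝ → ℝ) :
    eLpNorm (fun x => (1 + x) ^ ((k : ℝ) - s) * w x) 2 (jacobiMeasure 0 (s - k)) =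
      eLpNorm w 2 (jacobiMeasure 0 (k - s)) := by
  refine eq_of_sq_eq ?_
  rw [eLpNorm_sq_jacobi, eLpNorm_sq_jacobi]
  refine setLIntegral_congr_fun measurableSet_Lam fun x hx => ?_
  have hσ : 0 < 1 + x := by linarith [hx.1]
  simp only [jw, Real.rpow_zero, one_mul]
  rw [mul_pow, sq ((1 + x) ^ ((k : ℝ) - s)), ← mul_assoc, ← mul_assoc, ← Real.rpow_add hσ]
  simp

theorem memLp_weight {s : ℝ} {k : ℕ} {w : ℝ → ℝ} (hw : MemLp w 2 (jacobiMeasure 0 (k - s))) :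
    MemLp (fun x => (1 + x) ^ ((k : ℝ) - s) * w x) 2 (jacobiMeasure 0 (s - k)) := by
  refine ⟨aestronglyMeasurable_jacobi_iff.2 ((aestronglyMeasurable_one_add_rpow _).mul
    (aestronglyMeasurable_jacobi_iff.1 hw.1)), ?_⟩
  rw [eLpNorm_weight]
  exact hw.2

theorem inner_weight {s : ℝ} {k : ℕ} (g : HSpace s k) {w : ℝ → ℝ}
    (hw : MemLp w 2 (jacobiMeasure 0 (k - s))) :
    inner ℝ g ((memLp_weight hw).toLp _) = pairing g w := by
  rw [inner_HSpace]
  refine integral_congr_ae ?_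
  filter_upwards [coeFn_toLp_ae (memLp_weight hw), ae_restrict_mem measurableSet_Lam] with x h1 hx
  have hσ : 0 < 1 + x := by linarith [hx.1]
  have h2 : (1 + x) ^ (s - k) * (1 + x) ^ ((k : ℝ) - s) = 1 := by
    rw [← Real.rpow_add hσ]
    simp
  rw [h1]
  simp only [jw, Real.rpow_zero, one_mul]
  linear_combination (g x * w x) * h2

theorem left_le_sqrt_add_sq (a b : ℝ≥0∞) : a ≤ (a ^ 2 + b ^ 2) ^ (1 / 2 : ℝ) := by
  calc a = (a ^ 2) ^ (1 / 2 : ℝ) := by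
        rw [← ENNReal.rpow_natCast, ← ENNReal.rpow_mul]
        norm_num
    _ ≤ _ := ENNReal.rpow_le_rpow le_self_add (by norm_num)

theorem right_le_sqrt_add_sq (a b : ℝ≥0∞) : b ≤ (a ^ 2 + b ^ 2) ^ (1 / 2 : ℝ) := by
  rw [add_comm]
  exact left_le_sqrt_add_sq b a

theorem sqrt_add_sq_le {a b ε : ℝ≥0∞} (ha : a ≤ ε) (hb : b ≤ ε) :
    (a ^ 2 + b ^ 2) ^ (1 / 2 : ℝ) ≤ 2 * ε := by
  calc (a ^ 2 + b ^ 2) ^ (1 / 2 : ℝ) ≤ ((2 * ε) ^ 2) ^ (1 / 2 : ℝ) := by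
        refine ENNReal.rpow_le_rpow ?_ (by norm_num)
        calc a ^ 2 + b ^ 2 ≤ ε ^ 2 + ε ^ 2 := by gcongr
          _ = 2 * ε ^ 2 := by ring
          _ ≤ 4 * ε ^ 2 := by gcongr; norm_num
          _ = (2 * ε) ^ 2 := by ring
    _ = 2 * ε := by
        rw [← ENNReal.rpow_natCast, ← ENNReal.rpow_mul]
        norm_num

section

open Filter Topology

theorem eq_zero_of_forall_le_mul {a K : ℝ≥0∞} (hK : K ≠ ⊤) (h : ∀ ε, 0 < ε → a ≤ K * ε) :
    a = 0 := by
  have h1 : Tendsto (fun ε : ℝ≥0∞ => K * ε) (𝓝[>] 0) (𝓝 (K * 0)) :=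
    (ENNReal.Tendsto.const_mul tendsto_id (Or.inr hK)).mono_left nhdsWithin_le_nhds
  rw [mul_zero] at h1
  exact le_antisymm (ge_of_tendsto h1 (eventually_nhdsWithin_of_forall fun ε hε => h ε hε)) zero_le

theorem exists_eLpNorm_fracInt_le {s : ℝ} {k : ℕ} (hk : 1 ≤ k)
    (hs : s ∈ Set.Ioo ((k : ℝ) - 1) k) :
    ∃ K : ℝ≥0∞, K ≠ ⊤ ∧ ∀ g ∈ (lowPoly hs)ᗮ,
      eLpNorm (fracInt s g) 2 (jacobiMeasure (-s) (-k)) ≤ K * ‖g‖ₑ := by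
  obtain ⟨C, hC0, hC⟩ := exists_fracInt_estimate hk hs
  refine ⟨ENNReal.ofReal (√C), ENNReal.ofReal_ne_top, fun g hg => ?_⟩
  have h1 : ENNReal.ofReal (C * ‖g‖ ^ 2) = (ENNReal.ofReal (√C) * ‖g‖ₑ) ^ 2 := by
    rw [← ofReal_norm, ← ENNReal.ofReal_mul (Real.sqrt_nonneg _),
      ← ENNReal.ofReal_pow (by positivity), mul_pow, Real.sq_sqrt hC0]
  have h2 := hC g hg
  rw [h1] at h2
  exact (ENNReal.pow_le_pow_left_iff (by norm_num)).1 h2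

/-! ### Test functions and the fractional derivative -/

theorem IsTest.eq_fracInt_fracInt {s : ℝ} {k : ℕ} (hk : 1 ≤ k) (hs : s ∈ Set.Ioo ((k : ℝ) - 1) k)
    {φ : ℝ → ℝ} (h : IsTest φ) {x : ℝ} (hx : x ∈ Lam) :
    φ x = fracInt s (fracInt (k - s) (fun x => (-1) ^ k * _root_.iteratedDeriv k φ x)) x := by
  have hk1 : (1 : ℝ) ≤ k := by exact_mod_cast hk
  rw [fracInt_fracInt (by linarith [hs.1]) (by linarith [hs.2]) (by linarith)
    ((h.iteratedDeriv k).integrableOn.const_mul _) hx.1.le, add_sub_cancel]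
  simpa using ((h.isChain k).fracInt_eq hk hx).symm

theorem integrableOn_of_memLp_U {s : ℝ} {k : ℕ} (hs0 : 0 < s)
    {u : ℝ → ℝ} (hu : MemLp u 2 (jacobiMeasure (-s) (-k))) : IntegrableOn u Lam :=
  integrableOn_of_memLp_jacobi (by linarith) (by linarith [k.cast_nonneg (α := ℝ)]) hu

theorem rlDeriv_sub_test {s : ℝ} {k : ℕ} (hk : 1 ≤ k) (hs : s ∈ Set.Ioo ((k : ℝ) - 1) k)
    {u : ℝ → ℝ} (hu : IntegrableOn u Lam) (hw : ∃ g, HasWeakDeriv k (fracInt (k - s) u) g)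
    (φ : testSpace) :
    rlDeriv s k (u - (φ : ℝ → ℝ)) =ᵐ[volume.restrict Lam] rlDeriv s k u - ((rlH hs φ : HSpace s k) : ℝ → ℝ) := by
  have h0 : 0 < (k : ℝ) - s := by linarith [hs.2]
  set r := fracInt (k - s) (fun x => (-1) ^ k * iteratedDeriv k φ x) with hr
  have hri : IntegrableOn r Lam :=
    integrableOn_fracInt h0 ((IsTest.iteratedDeriv φ.2 k).integrableOn.const_mul _)
  have h1 : HasWeakDeriv k (fracInt (k - s) φ) (fun x => (-1) ^ k * r x) := by
    refine hasWeakDeriv_fracInt_fracInt hk hs hri ?_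
    filter_upwards [ae_restrict_mem measurableSet_Lam] with x hx
    exact IsTest.eq_fracInt_fracInt hk hs φ.2 hx
  have h2 := ((weakDeriv_spec hw).sub h1).congr
    (fracInt_sub_ae h0 hu (IsTest.integrableOn φ.2)).symm
  filter_upwards [h2.weakDeriv_ae_eq, rlH_ae hs φ] with x hx hx2
  rw [Pi.sub_apply, hx2]
  simp only [rlDeriv, hx, Pi.sub_apply, mul_sub]
  rw [← mul_assoc, ← mul_pow]
  simp [hr]

/-- A test function is I_+^s of its own fractional derivative, so approximation in H becomes
approximation of I_+^s g by test functions. -/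
theorem fracInt_sub_rlH {s : ℝ} {k : ℕ} (hk : 1 ≤ k) (hs : s ∈ Set.Ioo ((k : ℝ) - 1) k)
    (g : HSpace s k) (φ : testSpace) :
    fracInt s (g - rlH hs φ : HSpace s k) =ᵐ[volume.restrict Lam] fracInt s g - (φ : ℝ → ℝ) := by
  have hk1 : (1 : ℝ) ≤ k := by exact_mod_cast hk
  have hs0 : 0 < s := by linarith [hs.1]
  have h1 : ((g - rlH hs φ : HSpace s k) : ℝ → ℝ) =ᵐ[volume.restrict Lam] (g : ℝ → ℝ) - ((rlH hs φ : HSpace s k) : ℝ → ℝ) :=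
    ae_jacobiMeasure_iff.1 (Lp.coeFn_sub g (rlH hs φ))
  filter_upwards [fracInt_sub_ae hs0 (integrableOn_HSpace hs g)
    (integrableOn_HSpace hs (rlH hs φ)), ae_restrict_mem measurableSet_Lam] with x hx hxL
  rw [fracInt_congr h1 hxL.1.le, hx, Pi.sub_apply, Pi.sub_apply,
    fracInt_congr (rlH_ae hs φ) hxL.1.le, ← IsTest.eq_fracInt_fracInt hk hs φ.2 hxL]

theorem rlH_mem {s : ℝ} {k : ℕ} (hs : s ∈ Set.Ioo ((k : ℝ) - 1) k) (φ : testSpace) :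
    rlH hs φ ∈ (lowPoly hs)ᗮ := by
  rw [← closure_range_rlH]
  exact Submodule.le_topologicalClosure _ (LinearMap.mem_range_self _ _)

theorem enorm_sub_rlH {s : ℝ} {k : ℕ} (hs : s ∈ Set.Ioo ((k : ℝ) - 1) k) (g : HSpace s k)
    (φ : testSpace) : ‖g - rlH hs φ‖ₑ =
      eLpNorm ((g : ℝ → ℝ) - ((rlH hs φ : HSpace s k) : ℝ → ℝ)) 2 (jacobiMeasure 0 (s - k)) := by
  rw [Lp.enorm_def]
  exact eLpNorm_congr_ae (Lp.coeFn_sub _ _)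

/-- The elements of `U` are the `I_+^s g` with `g = D_+^s u` orthogonal to the polynomials of degree
less than `k`. -/
theorem mem_spaceU_imp {s : ℝ} {k : ℕ} (hk : 1 ≤ k) (hs : s ∈ Set.Ioo ((k : ℝ) - 1) k)
    {u : ℝ → ℝ} (hu : u ∈ spaceU s k) :
    hu.2.2.1.toLp (rlDeriv s k u) ∈ (lowPoly hs)ᗮ ∧
      u =ᵐ[volume.restrict Lam] fracInt s (hu.2.2.1.toLp (rlDeriv s k u)) := by
  have hk1 : (1 : ℝ) ≤ k := by exact_mod_cast hk
  have hs0 : 0 < s := by linarith [hs.1]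
  set g : HSpace s k := hu.2.2.1.toLp (rlDeriv s k u) with hg
  have hui := integrableOn_of_memLp_U hs0 hu.1
  have happ : ∀ ε : ℝ≥0∞, 0 < ε → ∃ φ : testSpace,
      eLpNorm (u - (φ : ℝ → ℝ)) 2 (jacobiMeasure (-s) (-k)) < ε ∧ ‖g - rlH hs φ‖ₑ < ε := by
    intro ε hε
    obtain ⟨φ, hφ, hn⟩ := hu.2.2.2 ε hε
    refine ⟨⟨φ, hφ⟩, (left_le_sqrt_add_sq _ _).trans_lt hn, ?_⟩
    refine lt_of_le_of_lt (le_of_eq ?_) ((right_le_sqrt_add_sq _ _).trans_lt hn)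
    rw [enorm_sub_rlH]
    refine eLpNorm_jacobi_congr ?_
    filter_upwards [rlDeriv_sub_test hk hs hui hu.2.1 ⟨φ, hφ⟩, coeFn_toLp_ae hu.2.2.1]
      with x h1 h2
    rw [h1, Pi.sub_apply, Pi.sub_apply, hg, h2]
  have hgm : g ∈ (lowPoly hs)ᗮ := by
    rw [← closure_range_rlH]
    refine EMetric.mem_closure_iff.2 fun ε hε => ?_
    obtain ⟨φ, -, hφ⟩ := happ ε hε
    exact ⟨rlH hs φ, LinearMap.mem_range_self _ _, by rwa [edist_eq_enorm_sub]⟩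
  refine ⟨hgm, ?_⟩
  obtain ⟨K, hK, hest⟩ := exists_eLpNorm_fracInt_le hk hs
  have hfm : AEStronglyMeasurable (fracInt s g) (jacobiMeasure (-s) (-k)) :=
    aestronglyMeasurable_jacobi_iff.2
      (integrableOn_fracInt hs0 (integrableOn_HSpace hs g)).aestronglyMeasurable
  -- Approximants φ satisfy φ → u by definition of U, and φ = I_+^s D_+^s φ → I_+^s g by the
  -- weighted estimate. Both limits are in the same norm.
  have hz : eLpNorm (u - fracInt s g) 2 (jacobiMeasure (-s) (-k)) = 0 := by
    refine eq_zero_of_forall_le_mul (K := 1 + K) (by simp [hK]) fun ε hε => ?_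
    obtain ⟨φ, h1, h2⟩ := happ ε hε
    have h3 := hest _ (Submodule.sub_mem _ hgm (rlH_mem hs φ))
    rw [eLpNorm_jacobi_congr (fracInt_sub_rlH hk hs g φ)] at h3
    have h4 : u - fracInt s g = (u - (φ : ℝ → ℝ)) - (fracInt s g - (φ : ℝ → ℝ)) := by abel
    have hφm : AEStronglyMeasurable (φ : ℝ → ℝ) (jacobiMeasure (-s) (-k)) :=
      (IsTest.memLp φ.2 _ _).1
    rw [h4]
    refine (eLpNorm_sub_le (hu.1.1.sub hφm) (hfm.sub hφm) (by norm_num)).trans ?_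
    rw [add_mul, one_mul]
    gcongr
    exact h3.trans (by gcongr)
  have h5 := (eLpNorm_eq_zero_iff (hu.1.1.sub hfm) (by norm_num)).1 hz
  filter_upwards [ae_jacobiMeasure_iff.1 h5] with x hx
  exact sub_eq_zero.1 hx

/-- The converse of `mem_spaceU_imp`: g is a limit of fractional derivatives of test functions, and
the weighted estimate upgrades this to convergence in the norm of U. -/
theorem fracInt_mem_spaceU {s : ℝ} {k : ℕ} (hk : 1 ≤ k) (hs : s ∈ Set.Ioo ((k : ℝ) - 1) k)
    {g : HSpace s k} (hg : g ∈ (lowPoly hs)ᗮ) :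
    fracInt s g ∈ spaceU s k ∧ rlDeriv s k (fracInt s g) =ᵐ[volume.restrict Lam] g := by
  have hk1 : (1 : ℝ) ≤ k := by exact_mod_cast hk
  have hs0 : 0 < s := by linarith [hs.1]
  have hgi := integrableOn_HSpace hs g
  obtain ⟨K, hK, hest⟩ := exists_eLpNorm_fracInt_le hk hs
  have hwd := hasWeakDeriv_fracInt_fracInt hk hs hgi (ae_eq_refl (fracInt s g))
  have hrl := rlDeriv_ae_eq_of_hasWeakDeriv hwd
  have hmem : MemLp (fracInt s g) 2 (jacobiMeasure (-s) (-k)) :=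
    ⟨aestronglyMeasurable_jacobi_iff.2 (integrableOn_fracInt hs0 hgi).aestronglyMeasurable,
      (hest g hg).trans_lt (ENNReal.mul_lt_top hK.lt_top enorm_lt_top)⟩
  refine ⟨⟨hmem, ⟨_, hwd⟩, memLp_jacobi_congr hrl.symm (Lp.memLp g), fun ε hε => ?_⟩, hrl⟩
  -- With distance below δ in H, both components of the norm of U are at most (1 + K) δ, and
  -- `sqrt_add_sq_le` costs the factor 2.
  obtain ⟨δ, hδ0, hδ⟩ := ENNReal.exists_nnreal_pos_mul_lt (a := 2 * (1 + K))
    (ENNReal.mul_ne_top (by norm_num) (by simp [hK])) hε.ne'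
  have hcl : g ∈ closure (LinearMap.range (rlH hs) : Set (HSpace s k)) := by
    have := closure_range_rlH hs ▸ hg
    exact this
  obtain ⟨_, ⟨φ, rfl⟩, hφ⟩ := EMetric.mem_closure_iff.1 hcl δ (by exact_mod_cast hδ0)
  rw [edist_eq_enorm_sub] at hφ
  refine ⟨φ, φ.2, lt_of_le_of_lt (sqrt_add_sq_le (ε := (1 + K) * δ) ?_ ?_) ?_⟩
  · rw [← eLpNorm_jacobi_congr (fracInt_sub_rlH hk hs g φ)]
    refine (hest _ (Submodule.sub_mem _ hg (rlH_mem hs φ))).trans ?_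
    exact mul_le_mul' le_add_self hφ.le
  · have h1 : rlDeriv s k (fracInt s g - (φ : ℝ → ℝ)) =ᵐ[volume.restrict Lam]
        (g : ℝ → ℝ) - ((rlH hs φ : HSpace s k) : ℝ → ℝ) := by
      filter_upwards [rlDeriv_sub_test hk hs (integrableOn_fracInt hs0 hgi) ⟨_, hwd⟩ φ, hrl]
        with x h1 h2
      rw [h1, Pi.sub_apply, Pi.sub_apply, h2]
    rw [eLpNorm_jacobi_congr h1, ← enorm_sub_rlH]
    calc ‖g - rlH hs φ‖ₑ = 1 * ‖g - rlH hs φ‖ₑ := (one_mul _).symm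
      _ ≤ _ := mul_le_mul' le_self_add hφ.le
  · calc 2 * ((1 + K) * δ) = δ * (2 * (1 + K)) := by ring
      _ < ε := hδ

/-! ### The space `V` -/

theorem weakDeriv_sub_test {k : ℕ} (hk : 1 ≤ k) {v : ℝ → ℝ} (hv : ∃ g, HasWeakDeriv k v g)
    {φ : ℝ → ℝ} (hφ : IsTest φ) :
    weakDeriv k (v - φ) =ᵐ[volume.restrict Lam] weakDeriv k v - iteratedDeriv k φ :=
  ((weakDeriv_spec hv).sub (hφ.hasWeakDeriv hk)).weakDeriv_ae_eq

theorem IsTest.mem_spaceV {s : ℝ} {k : ℕ} (hk : 1 ≤ k) {φ : ℝ → ℝ} (h : IsTest φ) :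
    φ ∈ spaceV s k := by
  have h1 := h.hasWeakDeriv hk
  refine ⟨h.memLp _ _, ⟨_, h1⟩, memLp_jacobi_congr h1.weakDeriv_ae_eq.symm
    ((h.iteratedDeriv k).memLp _ _), fun ε hε => ⟨φ, h, ?_⟩⟩
  have h2 : weakDeriv k (φ - φ) =ᵐ[volume.restrict Lam] 0 := by
    filter_upwards [weakDeriv_sub_test hk ⟨_, h1⟩ h, h1.weakDeriv_ae_eq] with x hx hx2
    rw [hx, Pi.sub_apply, hx2, sub_self, Pi.zero_apply]
  unfold normV
  rw [eLpNorm_jacobi_congr h2, sub_self]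
  simpa using hε

/-- Convergence almost everywhere, obtained along a subsequence, is what lets the pointwise bound
for test functions pass to v. -/
theorem exists_approx_of_mem_spaceV {s : ℝ} {k : ℕ} (hk : 1 ≤ k)
    (hs : s ∈ Set.Ioo ((k : ℝ) - 1) k) {v : ℝ → ℝ} (hv : v ∈ spaceV s k) :
    ∃ φ : ℕ → testSpace,
      (∀ᵐ x ∂(volume.restrict Lam), Tendsto (fun n => (φ n : ℝ → ℝ) x) atTop (𝓝 (v x))) ∧
      Tendsto (fun n => derivH hs (φ n)) atTop (𝓝 ((memLp_weight hv.2.2.1).toLp _)) := by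
  set h := (memLp_weight hv.2.2.1).toLp _ with hh
  have happ : ∀ n : ℕ, ∃ φ : testSpace,
      eLpNorm ((φ : ℝ → ℝ) - v) 2 (jacobiMeasure (-k) (-s)) ≤ ((n : ℝ≥0∞) + 1)⁻¹ ∧
      edist (derivH hs φ) h ≤ ((n : ℝ≥0∞) + 1)⁻¹ := by
    intro n
    obtain ⟨φ, hφ, hn⟩ := hv.2.2.2 ((n : ℝ≥0∞) + 1)⁻¹ (by simp)
    refine ⟨⟨φ, hφ⟩, ?_, ?_⟩
    · rw [eLpNorm_sub_comm]
      exact (left_le_sqrt_add_sq _ _).trans hn.le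
    · refine le_trans (le_of_eq ?_) ((right_le_sqrt_add_sq _ _).trans hn.le)
      rw [edist_comm, edist_eq_enorm_sub, Lp.enorm_def, ← eLpNorm_weight]
      refine eLpNorm_congr_ae ((Lp.coeFn_sub _ _).trans (ae_jacobiMeasure_iff.2 ?_))
      filter_upwards [coeFn_toLp_ae (memLp_weight hv.2.2.1), derivH_ae hs ⟨φ, hφ⟩,
        weakDeriv_sub_test hk hv.2.1 hφ] with x h1 h2 h3
      rw [Pi.sub_apply, hh, h1, h2, h3, Pi.sub_apply, mul_sub]
  choose φ hφ1 hφ2 using happ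
  have hlim : Tendsto (fun n : ℕ => ((n : ℝ≥0∞) + 1)⁻¹) atTop (𝓝 0) := by
    have := (ENNReal.tendsto_inv_nat_nhds_zero).comp (tendsto_add_atTop_nat 1)
    refine this.congr fun n => ?_
    simp
  have hconv : Tendsto (fun n => derivH hs (φ n)) atTop (𝓝 h) :=
    tendsto_iff_edist_tendsto_0.2
      (tendsto_of_tendsto_of_tendsto_of_le_of_le tendsto_const_nhds hlim (fun _ => zero_le) hφ2)
  have hmeas : TendstoInMeasure (jacobiMeasure (-k) (-s)) (fun n => (φ n : ℝ → ℝ)) atTop v :=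
    tendstoInMeasure_of_tendsto_eLpNorm (p := 2) (by norm_num)
      (fun n => (IsTest.memLp (φ n).2 _ _).1) hv.1.1
      (tendsto_of_tendsto_of_tendsto_of_le_of_le tendsto_const_nhds hlim (fun _ => zero_le) hφ1)
  obtain ⟨ns, hns, hae⟩ := hmeas.exists_seq_tendsto_ae
  exact ⟨fun n => φ (ns n), ae_jacobiMeasure_iff.1 hae, hconv.comp hns.tendsto_atTop⟩

/-! ### The functional given by f, and the continuous problem. -/

/-- For `v ∈ V` the product `f v` is integrable, and `(f, ·)` is continuous along an approximating
sequence of test functions. -/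
theorem pairing_spaceV {s : ℝ} {k : ℕ} (hk : 1 ≤ k) (hs : s ∈ Set.Ioo ((k : ℝ) - 1) k)
    {f : ℝ → ℝ} (hf : MemLp f 2 (jacobiMeasure s k)) {v : ℝ → ℝ} (hv : v ∈ spaceV s k) :
    IntegrableOn (fun x => f x * v x) Lam ∧ ∃ φ : ℕ → testSpace,
      Tendsto (fun n => pairing f (φ n)) atTop (𝓝 (pairing f v)) ∧
      Tendsto (fun n => derivH hs (φ n)) atTop (𝓝 ((memLp_weight hv.2.2.1).toLp _)) := by
  set e : ℝ := (s - k + 1) / 4 with he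
  have he0 : 0 < e := by rw [he]; linarith [hs.1]
  obtain ⟨M, hM0, hM⟩ := exists_test_bound hk hs he0.le (by rw [he]; linarith [hs.1])
  obtain ⟨φ, hφ1, hφ2⟩ := exists_approx_of_mem_spaceV hk hs hv
  obtain ⟨B, hB⟩ : ∃ B, ∀ n, ‖derivH hs (φ n)‖ ≤ B := by
    obtain ⟨B, hB⟩ := hφ2.norm.bddAbove_range
    exact ⟨B, fun n => hB ⟨n, rfl⟩⟩
  have hfm := integrableOn_mul_of_memLp_jacobi hf (memLp_jw_bound hk hs he0)
  -- Hölder for f and v directly is not available, as their weights are (s,k) and (-k,-s). The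
  -- pointwise bound supplies a common integrable majorant.
  have hbound : Integrable (fun x => M * B * |f x * jw (k - 1) (k - 1 + e) x|)
      (volume.restrict Lam) := hfm.abs.const_mul _
  have hfae := aestronglyMeasurable_jacobi_iff.1 hf.1
  have hle : ∀ n, ∀ x ∈ Lam, |f x * (φ n : ℝ → ℝ) x| ≤ M * B * |f x * jw (k - 1) (k - 1 + e) x| := by
    intro n x hx
    have hj := jw_pos (k - 1) (k - 1 + e) hx
    rw [abs_mul, abs_mul, abs_of_pos hj]
    calc |f x| * |(φ n : ℝ → ℝ) x| ≤ |f x| * (M * jw (k - 1) (k - 1 + e) x * B) := by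
          gcongr
          exact (hM (φ n) x hx).trans (by gcongr; exact hB n)
      _ = _ := by ring
  have hlim : ∀ᵐ x ∂(volume.restrict Lam),
      Tendsto (fun n => f x * (φ n : ℝ → ℝ) x) atTop (𝓝 (f x * v x)) := by
    filter_upwards [hφ1] with x hx
    exact hx.const_mul _
  have hvm := aestronglyMeasurable_jacobi_iff.1 hv.1.1
  refine ⟨Integrable.mono' hbound (hfae.mul hvm) ?_, φ, ?_, hφ2⟩
  · filter_upwards [hlim, ae_restrict_mem measurableSet_Lam] with x hx hxL
    exact le_of_tendsto hx.norm (Eventually.of_forall fun n => hle n x hxL)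
  · refine tendsto_integral_of_dominated_convergence _
      (fun n => hfae.mul (IsTest.continuous (φ n).2).aestronglyMeasurable) hbound (fun n => ?_) hlim
    filter_upwards [ae_restrict_mem measurableSet_Lam] with x hx
    exact hle n x hx

/-- The functional `(f, ·)` is represented by some `g` orthogonal to the polynomials of degree less
than `k`. -/
theorem exists_representer {s : ℝ} {k : ℕ} (hk : 1 ≤ k) (hs : s ∈ Set.Ioo ((k : ℝ) - 1) k)
    {f : ℝ → ℝ} (hf : MemLp f 2 (jacobiMeasure s k)) :
    ∃ g ∈ (lowPoly hs)ᗮ, ∀ φ : testSpace, inner ℝ g (derivH hs φ) = pairing f φ := by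
  set e : ℝ := (s - k + 1) / 4 with he
  have he0 : 0 < e := by rw [he]; linarith [hs.1]
  obtain ⟨M, hM0, hM⟩ := exists_test_bound hk hs he0.le (by rw [he]; linarith [hs.1])
  have hfm := integrableOn_mul_of_memLp_jacobi hf (memLp_jw_bound hk hs he0)
  have hi : ∀ φ : testSpace, IntegrableOn (fun x => f x * (φ : ℝ → ℝ) x) Lam := fun φ =>
    integrableOn_mul_of_memLp_jacobi hf (IsTest.memLp φ.2 _ _)
  let l : testSpace →ₗ[ℝ] ℝ :=
    { toFun := fun φ => pairing f φ
      map_add' := fun φ ψ => by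
        simp only [pairing, Submodule.coe_add, Pi.add_apply, mul_add]
        exact integral_add (hi φ) (hi ψ)
      map_smul' := fun c φ => by
        simp only [pairing, Submodule.coe_smul, Pi.smul_apply, smul_eq_mul, mul_left_comm _ c,
          RingHom.id_apply]
        exact integral_const_mul _ _ }
  obtain ⟨g, hg, hgl⟩ := exists_mem_closure_range_inner_eq (derivH hs) l
    (C := M * ∫ x in Lam, |f x * jw (k - 1) (k - 1 + e) x|) (fun φ => by
      calc |∫ x in Lam, f x * (φ : ℝ → ℝ) x| ≤ ∫ x in Lam, |f x * (φ : ℝ → ℝ) x| :=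
            abs_integral_le_integral_abs
        _ ≤ ∫ x in Lam, M * ‖derivH hs φ‖ * |f x * jw (k - 1) (k - 1 + e) x| := by
            refine setIntegral_mono_on (hi φ).abs (hfm.abs.const_mul _) measurableSet_Lam
              fun x hx => ?_
            have hj := jw_pos (k - 1) (k - 1 + e) hx
            rw [abs_mul, abs_mul, abs_of_pos hj]
            calc |f x| * |(φ : ℝ → ℝ) x| ≤
                |f x| * (M * jw (k - 1) (k - 1 + e) x * ‖derivH hs φ‖) := by
                  gcongr
                  exact hM φ x hx
              _ = _ := by ring
        _ = _ := by rw [integral_const_mul]; ring)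
  rw [closure_range_derivH] at hg
  exact ⟨g, hg, hgl⟩

/-- Unique solvability of the continuous problem. -/
theorem exists_unique_weakSolution {s : ℝ} {k : ℕ} (hk : 1 ≤ k)
    (hs : s ∈ Set.Ioo ((k : ℝ) - 1) k) {f : ℝ → ℝ} (hf : MemLp f 2 (jacobiMeasure s k)) :
    ∃ u, IsWeakSolution s k f u ∧
      ∀ u', IsWeakSolution s k f u' → u' =ᵐ[volume.restrict Lam] u := by
  obtain ⟨g, hg, hgl⟩ := exists_representer hk hs hf
  obtain ⟨hU, hrl⟩ := fracInt_mem_spaceU hk hs hg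
  refine ⟨fracInt s g, ⟨hU, fun v hv => ?_⟩, fun u' hu' => ?_⟩
  · obtain ⟨-, φ, h1, h2⟩ := pairing_spaceV hk hs hf hv
    -- The equation is known on test functions; both sides pass to the limit along the sequence
    -- approximating v.
    have h3 : Tendsto (fun n => pairing f (φ n)) atTop
        (𝓝 (inner ℝ g ((memLp_weight hv.2.2.1).toLp _))) := by
      simp only [← hgl]
      exact tendsto_const_nhds.inner h2
    rw [tendsto_nhds_unique h1 h3, inner_weight g hv.2.2.1]
    refine integral_congr_ae ?_
    filter_upwards [hrl] with x hx
    rw [hx]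
  · obtain ⟨hm, hae⟩ := mem_spaceU_imp hk hs hu'.1
    set g' : HSpace s k := hu'.1.2.2.1.toLp (rlDeriv s k u') with hg'
    -- Testing with test functions puts the difference into P, while membership of both solutions in
    -- U puts it into P^⊥.
    have h1 : g' - g ∈ lowPoly hs := by
      rw [← orthogonal_range_derivH, Submodule.mem_orthogonal']
      rintro _ ⟨φ, rfl⟩
      rw [inner_sub_left, hgl, inner_derivH, sub_eq_zero, ← hu'.2 φ (IsTest.mem_spaceV hk φ.2)]
      refine integral_congr_ae ?_
      filter_upwards [coeFn_toLp_ae hu'.1.2.2.1, (IsTest.hasWeakDeriv φ.2 hk).weakDeriv_ae_eq]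
        with x hx1 hx2
      rw [hg', hx1, hx2]
    have h2 : g' - g ∈ (lowPoly hs)ᗮ := Submodule.sub_mem _ hm hg
    have h3 : g' = g := by
      have := (Submodule.mem_orthogonal _ _).1 h2 _ h1
      exact sub_eq_zero.1 (inner_self_eq_zero.1 this)
    rw [← h3]
    exact hae

end

/-! ### The chain of derivatives of `(1 - x)^s ψ` -/

/-- The polynomials `θ_j` with `(-1)^j D^j ((1 - x)^s ψ) = (1 - x)^{s-j} θ_j`. -/
def chainPoly (s : ℝ) : ℕ → ℝ[X] →ₗ[ℝ] ℝ[X]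
  | 0 => LinearMap.id
  | j + 1 => (s - j) • chainPoly s j - LinearMap.mulLeft ℝ (1 - X) ∘ₗ derivative ∘ₗ chainPoly s j

theorem chainPoly_zero (s : ℝ) (ψ : ℝ[X]) : chainPoly s 0 ψ = ψ := rfl

theorem chainPoly_succ (s : ℝ) (j : ℕ) (ψ : ℝ[X]) : chainPoly s (j + 1) ψ =
    (s - j) • chainPoly s j ψ - (1 - X) * derivative (chainPoly s j ψ) := rfl

/-- Differentiation lowers the degree and the factor 1 - X restores at most what was lost. -/
theorem chainPoly_mem_degreeLT (s : ℝ) {n : ℕ} {ψ : ℝ[X]} (hψ : ψ ∈ degreeLT ℝ n) (j : ℕ) :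
    chainPoly s j ψ ∈ degreeLT ℝ n := by
  induction j with
  | zero => exact hψ
  | succ j ih =>
    rw [chainPoly_succ]
    refine Submodule.sub_mem _ (Submodule.smul_mem _ _ ih) ?_
    rcases eq_or_ne (chainPoly s j ψ) 0 with h0 | h0
    · simp [h0]
    rcases eq_or_ne (derivative (chainPoly s j ψ)) 0 with h1 | h1
    · simp [h1]
    rw [mem_degreeLT] at ih ⊢
    refine lt_of_le_of_lt ?_ ih
    rw [degree_eq_natDegree h0]
    refine degree_le_natDegree.trans ?_
    norm_cast
    refine natDegree_mul_le.trans ?_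
    rw [natDegree_one_sub_X]
    have h2 := natDegree_derivative_lt (p := chainPoly s j ψ) fun h => h1 (by
      rw [eq_C_of_natDegree_eq_zero h, derivative_C])
    omega

theorem pow_dvd_chainPoly (s : ℝ) {k : ℕ} {ψ : ℝ[X]} (hψ : (X - C (-1)) ^ k ∣ ψ) (j : ℕ) :
    (X - C (-1)) ^ (k - j) ∣ chainPoly s j ψ := by
  induction j with
  | zero => exact hψ
  | succ j ih =>
    rw [chainPoly_succ]
    refine dvd_sub ?_ (Dvd.dvd.mul_left ?_ _)
    · rw [smul_eq_C_mul]
      exact ((pow_dvd_pow _ (by omega : k - (j + 1) ≤ k - j)).trans ih).mul_left _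
    · exact pow_sub_one_dvd_derivative_of_pow_dvd ih

/-- For j < k the zero at 1 comes from s - j > 0 and the zero at -1 from the factor (X+1)^{k-j}. At
j = k only integrability survives, by s - k > -1. -/
theorem isChain_chainPoly {s : ℝ} {k : ℕ} (hs : (k : ℝ) - 1 < s) {ψ : ℝ[X]}
    (hψ : (X - C (-1)) ^ k ∣ ψ) :
    IsChain k (fun j x => (1 - x) ^ (s - j) * (chainPoly s j ψ).eval x) := by
  have hpos : ∀ j < k, 0 < s - j := fun j hj => by
    have : (j : ℝ) + 1 ≤ k := by exact_mod_cast hj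
    linarith
  refine ⟨fun j hj => ?_, fun j hj x hx => ?_, fun j hj => ?_, fun j hj => ?_, fun j hj => ?_⟩
  · refine ContinuousOn.mul (fun x hx => ?_) (Polynomial.continuous _).continuousOn
    exact ((continuousAt_const.sub continuousAt_id).rpow_const
      (Or.inr (hpos j hj).le)).continuousWithinAt
  · have h1x : 0 < 1 - x := by linarith [hx.2]
    have h1 : HasDerivAt (fun x : ℝ => (1 - x) ^ (s - j)) (-1 * (s - j) * (1 - x) ^ (s - j - 1)) x :=
      ((hasDerivAt_id x).const_sub 1).rpow_const (Or.inl h1x.ne')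
    refine (h1.mul ((chainPoly s j ψ).hasDerivAt x)).congr_deriv ?_
    have h2 : (1 - x) ^ (s - j) = (1 - x) * (1 - x) ^ (s - j - 1) := by
      rw [mul_comm, ← Real.rpow_add_one h1x.ne', sub_add_cancel]
    rw [chainPoly_succ, h2, Nat.cast_succ, ← sub_sub]
    simp only [eval_sub, eval_smul, eval_mul, eval_one, eval_X, smul_eq_mul]
    ring
  · refine integrableOn_one_sub_rpow_mul_eval ?_ _
    have : (j : ℝ) ≤ k := by exact_mod_cast hj
    linarith
  · have h1 : (X - C (-1)) ∣ chainPoly s j ψ :=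
      (dvd_pow_self _ (by omega)).trans (pow_dvd_chainPoly s hψ j)
    have h2 := dvd_iff_isRoot.1 h1
    rw [IsRoot.def.1 h2, mul_zero]
  · simp [Real.zero_rpow (hpos j hj).ne']

/-! ### The action of `I_+^ρ` on polynomials -/

theorem eq_of_forall_mem_Lam {p q : ℝ[X]} (h : ∀ x ∈ Lam, p.eval x = q.eval x) : p = q :=
  eq_of_infinite_eval_eq p q
    ((Set.Ioo_infinite (by norm_num : (-1 : ℝ) < 1)).mono fun x hx => h x hx)

theorem eq_zero_of_ae_eval_eq_zero {p : ℝ[X]}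
    (h : ∀ᵐ x ∂(volume.restrict Lam), p.eval x = 0) : p = 0 := by
  refine eq_of_forall_mem_Lam fun x hx => ?_
  rw [eval_zero]
  exact Measure.eqOn_open_of_ae_eq (g := fun _ => (0 : ℝ)) h isOpen_Lam p.continuous.continuousOn
    continuousOn_const hx

theorem integrableOn_rk_mul_rpow_mul_eval {ρ : ℝ} (h0 : 0 < ρ) (h1 : ρ < 1) (r : ℝ[X]) (x : ℝ) :
    IntegrableOn (fun y => rk ρ x y * ((1 - y) ^ (-ρ) * r.eval y)) Lam := by
  obtain ⟨M, _, hM⟩ := exists_bound_eval r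
  have := Integrable.mul_bdd (c := M) (integrable_rk_mul_one_sub_rpow h0 (by linarith : -1 < -ρ) x)
    (g := fun y => r.eval y) r.continuous.aestronglyMeasurable (by
      filter_upwards [ae_restrict_mem measurableSet_Lam] with y hy
      exact hM y ⟨hy.1.le, hy.2.le⟩)
  refine Integrable.congr this (Filter.Eventually.of_forall fun y => ?_)
  exact mul_assoc _ _ _

/-- The linear map on polynomials given by `r ↦ I_+^ρ ((1 - x)^{-ρ} r)`. -/
theorem exists_linearMap_fracInt {ρ : ℝ} (h0 : 0 < ρ) (h1 : ρ < 1) :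
    ∃ T : ℝ[X] →ₗ[ℝ] ℝ[X], (∀ n, ∀ r ∈ degreeLT ℝ n, T r ∈ degreeLT ℝ n) ∧
      ∀ r, ∀ x ∈ Lam, fracInt ρ (fun y => (1 - y) ^ (-ρ) * r.eval y) x = (T r).eval x := by
  have hex : ∀ r : ℝ[X], ∃ p : ℝ[X], ∀ x ∈ Lam,
      fracInt ρ (fun y => (1 - y) ^ (-ρ) * r.eval y) x = p.eval x := fun r => by
    have hr : r ∈ degreeLT ℝ (r.natDegree + 1) :=
      mem_degreeLT.2 (degree_le_natDegree.trans_lt (by exact_mod_cast Nat.lt_succ_self _))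
    obtain ⟨p, -, hp⟩ := exists_fracInt_eq_eval h0 h1 hr
    exact ⟨p, fun x hx => hp x ⟨hx.1.le, hx.2⟩⟩
  choose T hT using hex
  refine ⟨⟨⟨T, fun r r' => ?_⟩, fun c r => ?_⟩, fun n r hr => ?_, hT⟩
  · refine eq_of_forall_mem_Lam fun x hx => ?_
    rw [eval_add, ← hT _ x hx, ← hT _ x hx, ← hT _ x hx, fracInt_eq _ hx.1.le,
      fracInt_eq _ hx.1.le, fracInt_eq _ hx.1.le,
      ← integral_add (integrableOn_rk_mul_rpow_mul_eval h0 h1 r x)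
        (integrableOn_rk_mul_rpow_mul_eval h0 h1 r' x)]
    simp only [eval_add, mul_add]
  · refine eq_of_forall_mem_Lam fun x hx => ?_
    simp only [RingHom.id_apply, eval_smul, smul_eq_mul]
    rw [← hT _ x hx, ← hT _ x hx, fracInt_eq _ hx.1.le, fracInt_eq _ hx.1.le, ← integral_const_mul]
    congr 1
    funext y
    simp only [eval_smul, smul_eq_mul]
    ring
  · obtain ⟨p, hp, hpe⟩ := exists_fracInt_eq_eval h0 h1 hr
    have : T r = p := eq_of_forall_mem_Lam fun x hx => by rw [← hT r x hx, hpe x ⟨hx.1.le, hx.2⟩]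
    change T r ∈ _
    rwa [this]

theorem eq_zero_of_setIntegral_mul_sq {W : ℝ → ℝ} (hW : ∀ x ∈ Lam, 0 < W x) {p : ℝ[X]}
    (hi : IntegrableOn (fun x => W x * p.eval x ^ 2) Lam)
    (h : ∫ x in Lam, W x * p.eval x ^ 2 = 0) : p = 0 := by
  refine eq_zero_of_ae_eval_eq_zero ?_
  rw [setIntegral_eq_zero_iff_of_nonneg_ae ?_ hi] at h
  · filter_upwards [h, ae_restrict_mem measurableSet_Lam] with x hx hxL
    have := (hW x hxL).ne'
    simpa [this] using hx
  · filter_upwards [ae_restrict_mem measurableSet_Lam] with x hx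
    exact mul_nonneg (hW x hx).le (sq_nonneg _)

theorem mem_degreeLT_of_iterate_derivative_eq_zero {k : ℕ} {p : ℝ[X]}
    (h : derivative^[k] p = 0) : p ∈ degreeLT ℝ k := by
  rw [mem_degreeLT, degree_lt_iff_coeff_zero]
  intro m hm
  have h1 := coeff_iterate_derivative (k := k) p (m - k)
  rw [h, Nat.sub_add_cancel hm, coeff_zero] at h1
  have h2 : (m.descFactorial k : ℝ) ≠ 0 := by
    exact_mod_cast (Nat.descFactorial_pos.2 hm).ne'
  rw [nsmul_eq_mul] at h1
  exact (mul_eq_zero.1 h1.symm).resolve_left h2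

/-- `D_+^s` maps `(1 - x)^s ψ` to a polynomial depending linearly and injectively on `ψ`, also modulo
the polynomials of degree less than `k`. -/
theorem exists_linearMap_rlDeriv {s : ℝ} {k : ℕ} (hk : 1 ≤ k) (hs : s ∈ Set.Ioo ((k : ℝ) - 1) k) :
    ∃ G : ℝ[X] →ₗ[ℝ] ℝ[X], (∀ n, ∀ r ∈ degreeLT ℝ n, G r ∈ degreeLT ℝ n) ∧
      ∀ ψ, (X - C (-1)) ^ k ∣ ψ →
        (rlDeriv s k (fun x => (1 - x) ^ s * ψ.eval x) =ᵐ[volume.restrict Lam]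
          fun x => (G ψ).eval x) ∧ (derivative^[k] (G ψ) = 0 → ψ = 0) := by
  have hk1 : (1 : ℝ) ≤ k := by exact_mod_cast hk
  have hs0 : 0 < s := by linarith [hs.1]
  have hρ0 : 0 < (k : ℝ) - s := by linarith [hs.2]
  have hρ1 : (k : ℝ) - s < 1 := by linarith [hs.1]
  obtain ⟨T, hTn, hT⟩ := exists_linearMap_fracInt hρ0 hρ1
  -- With ρ = k - s: (-1)^k D^k((1-x)^s ψ) is (1-x)^{-ρ} times a polynomial, and I_+^ρ maps this to
  -- a polynomial.
  refine ⟨T ∘ₗ chainPoly s k, fun n r hr => hTn n _ (chainPoly_mem_degreeLT s hr k),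
    fun ψ hψ => ?_⟩
  have hch := isChain_chainPoly hs.1 hψ
  set w : ℝ → ℝ := fun y => (1 - y) ^ (-((k : ℝ) - s)) * (chainPoly s k ψ).eval y with hw
  have hwk : (fun x : ℝ => (1 - x) ^ (s - (k : ℝ)) * (chainPoly s k ψ).eval x) = w := by
    simp only [hw, neg_sub]
  have hwi : IntegrableOn w Lam := integrableOn_one_sub_rpow_mul_eval (by linarith) _
  have hTw := hT (chainPoly s k ψ)
  set p : ℝ[X] := T (chainPoly s k ψ) with hp
  have hu : ∀ x ∈ Lam, fracInt k w x = (1 - x) ^ s * ψ.eval x := by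
    intro x hx
    have h1 := hch.fracInt_eq hk hx
    rw [hwk] at h1
    simpa [chainPoly_zero] using h1
  have hss : ∀ x ∈ Lam, fracInt s (fracInt (k - s) w) x = fracInt k w x := by
    intro x hx
    rw [fracInt_fracInt hs0 hρ0 (by linarith) hwi hx.1.le, add_sub_cancel]
  refine ⟨?_, fun hder => ?_⟩
  · have h1 := rlDeriv_ae_eq_of_hasWeakDeriv (hasWeakDeriv_fracInt_fracInt hk hs
      (integrableOn_fracInt hρ0 hwi) (u := fun x => (1 - x) ^ s * ψ.eval x) (by
        filter_upwards [ae_restrict_mem measurableSet_Lam] with x hx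
        rw [hss x hx, hu x hx]))
    filter_upwards [h1, ae_restrict_mem measurableSet_Lam] with x hx hxL
    rw [hx, hTw x hxL]
    rfl
  · have hpk : p ∈ degreeLT ℝ k := mem_degreeLT_of_iterate_derivative_eq_zero hder
    -- By the chain, w is orthogonal to low degree polynomials, so p = I_+^ρ w is orthogonal to them
    -- for the weight (1+x)^{-ρ}. If p itself has low degree, it is orthogonal to itself and
    -- vanishes.
    have horth := setIntegral_weight_mul_fracInt_eq_zero hρ0 hρ1 hwi (fun q hq => by
      rw [← hwk]
      exact hch.integral_mul_eval_eq_zero hq) hpk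
    have hp0 : p = 0 := by
      refine eq_zero_of_setIntegral_mul_sq (W := fun x => (1 + x) ^ (-((k : ℝ) - s)))
        (fun x hx => Real.rpow_pos_of_pos (by linarith [hx.1]) _) ?_ ?_
      · have := integrableOn_one_add_rpow_mul_eval (by linarith : -1 < -((k : ℝ) - s)) (p ^ 2)
        simpa only [eval_pow] using this
      · rw [← horth]
        refine setIntegral_congr_fun measurableSet_Lam fun x hx => ?_
        rw [hTw x hx]
        ring
    have hw0 : w =ᵐ[volume.restrict Lam] 0 := by
      refine ae_eq_zero_of_fracInt hρ0 hρ1 hwi ?_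
      filter_upwards [ae_restrict_mem measurableSet_Lam] with x hx
      rw [hTw x hx, hp0, eval_zero, Pi.zero_apply]
    refine eq_of_forall_mem_Lam fun x hx => ?_
    have h1 := hu x hx
    rw [fracInt_congr hw0 hx.1.le] at h1
    have h2 : 0 < (1 - x) ^ s := Real.rpow_pos_of_pos (by linarith [hx.2]) _
    have h3 : fracInt k (0 : ℝ → ℝ) x = 0 := by simp [fracInt]
    rw [h3] at h1
    rw [eval_zero]
    exact (mul_eq_zero.1 h1.symm).resolve_left h2.ne'

/-! ### Reflection -/

theorem HasWeakDeriv.comp_neg {k : ℕ} {w g : ℝ → ℝ} (h : HasWeakDeriv k w g)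
    (hw : IntegrableOn w Lam) (hg : IntegrableOn g Lam) :
    HasWeakDeriv k (fun x => w (-x)) (fun x => (-1) ^ k * g (-x)) := by
  refine ⟨(integrableOn_comp_neg hw).locallyIntegrableOn,
    IntegrableOn.locallyIntegrableOn ((integrableOn_comp_neg hg).const_mul _), fun φ hφ => ?_⟩
  have h1 := h.2.2 _ hφ.comp_neg
  have h2 : (-1 : ℝ) ^ k * (-1) ^ k = 1 := by rw [← mul_pow]; simp
  unfold pairing at h1 ⊢
  rw [← setIntegral_comp_neg, ← setIntegral_comp_neg fun x => g x * φ (-x)] at h1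
  simp only [iteratedDeriv_comp_neg, neg_neg, smul_eq_mul, mul_left_comm _ ((-1 : ℝ) ^ k)] at h1
  simp only [mul_assoc]
  rw [integral_const_mul] at h1 ⊢
  rw [← h1, ← mul_assoc, h2, one_mul]

theorem iterate_derivative_comp_neg_X (p : ℝ[X]) (k : ℕ) :
    derivative^[k] (p.comp (-X)) = (-1) ^ k * (derivative^[k] p).comp (-X) := by
  induction k generalizing p with
  | zero => simp
  | succ k ih => simp [ih (derivative p), derivative_comp, pow_succ]

theorem pow_dvd_comp_neg_X {k : ℕ} {a : ℝ} {q : ℝ[X]} (h : (X - C a) ^ k ∣ q) :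
    (X - C (-a)) ^ k ∣ q.comp (-X) := by
  obtain ⟨r, rfl⟩ := h
  rw [mul_comp]
  refine Dvd.dvd.mul_right ?_ _
  rw [pow_comp, sub_comp, X_comp, C_comp, ← neg_add', neg_pow, C_neg, sub_neg_eq_add]
  exact Dvd.intro_left _ rfl

/-- Integration by parts against the weak derivative of `(1 + x)^s q`. -/
theorem pairing_eval_weakDeriv {s : ℝ} {k : ℕ} (hk : 1 ≤ k) (hs : s ∈ Set.Ioo ((k : ℝ) - 1) k)
    {q : ℝ[X]} (hq : (X - C 1) ^ k ∣ q) (p : ℝ[X]) :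
    pairing (fun x => p.eval x) (weakDeriv k (fun x => (1 + x) ^ s * q.eval x)) =
      (-1) ^ k * ∫ x in Lam, (1 + x) ^ s * (q * derivative^[k] p).eval x := by
  -- Reflection moves the zero of order k from 1 to -1, so the chain built for (1-x)^s serves also
  -- for (1+x)^s.
  have hch := isChain_chainPoly hs.1 (pow_dvd_comp_neg_X hq)
  set F : ℕ → ℝ → ℝ := fun j x => (1 - x) ^ (s - j) * (chainPoly s j (q.comp (-X))).eval x with hF
  have hF0 : ∀ x, F 0 (-x) = (1 + x) ^ s * q.eval x := fun x => by
    simp [hF, chainPoly_zero]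
  have h2 : (-1 : ℝ) ^ k * (-1) ^ k = 1 := by rw [← mul_pow]; simp
  have h1 : HasWeakDeriv k (F 0) (fun x => (-1) ^ k * F k x) := by
    refine (hasWeakDeriv_fracInt hk (hch.integrable k le_rfl)).congr ?_
    filter_upwards [ae_restrict_mem measurableSet_Lam] with x hx
    exact hch.fracInt_eq hk hx
  have h3 := h1.comp_neg (hch.integrable 0 (by omega)) ((hch.integrable k le_rfl).const_mul _)
  simp only [hF0, ← mul_assoc, h2, one_mul] at h3
  have h4 := hch.integral_mul_eval (p.comp (-X))
  rw [← setIntegral_comp_neg, ← setIntegral_comp_neg fun x => F 0 x * _] at h4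
  simp only [iterate_derivative_comp_neg_X, hF0, eval_mul, eval_pow, eval_neg, eval_one, eval_comp,
    eval_X, neg_neg] at h4
  have h5 : pairing (fun x => p.eval x) (weakDeriv k (fun x => (1 + x) ^ s * q.eval x)) =
      ∫ x in Lam, F k (-x) * p.eval x := by
    refine integral_congr_ae ?_
    filter_upwards [h3.weakDeriv_ae_eq] with x hx
    rw [hx, mul_comm]
  rw [h5, h4, ← integral_const_mul]
  congr 1
  funext x
  rw [eval_mul]
  ring

/-! ### The discrete problem -/

theorem forall_iterate_derivative_eval_iff_dvd {k : ℕ} {a : ℝ} {p : ℝ[X]} :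
    (∀ l < k, (derivative^[l] p).eval a = 0) ↔ (X - C a) ^ k ∣ p := by
  rcases eq_or_ne p 0 with rfl | hp
  · simp
  rcases k with _ | n
  · simp
  rw [← le_rootMultiplicity_iff hp, Nat.succ_le_iff,
    lt_rootMultiplicity_iff_isRoot_iterate_derivative hp]
  simp only [Nat.lt_succ_iff, IsRoot.def]

/-- The polynomials of degree at most `N` that vanish at `a` to order `k`. -/
def vanishingPoly (k N : ℕ) (a : ℝ) : Submodule ℝ ℝ[X] :=
  degreeLT ℝ (N + 1) ⊓ (Ideal.span {(X - C a) ^ k}).restrictScalars ℝ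

theorem mem_vanishingPoly {k N : ℕ} {a : ℝ} {p : ℝ[X]} :
    p ∈ vanishingPoly k N a ↔ p ∈ degreeLT ℝ (N + 1) ∧ (X - C a) ^ k ∣ p := by
  rw [vanishingPoly, Submodule.mem_inf, Submodule.restrictScalars_mem, Ideal.mem_span_singleton]

theorem natDegree_le_iff_mem_degreeLT {N : ℕ} {p : ℝ[X]} :
    p.natDegree ≤ N ↔ p ∈ degreeLT ℝ (N + 1) := by
  rcases eq_or_ne p 0 with rfl | hp
  · simp
  · rw [mem_degreeLT, ← Nat.lt_succ_iff, natDegree_lt_iff_degree_lt hp]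

instance finite_vanishingPoly (k N : ℕ) (a : ℝ) : Module.Finite ℝ (vanishingPoly k N a) :=
  Submodule.finiteDimensional_of_le (inf_le_left : vanishingPoly k N a ≤ degreeLT ℝ (N + 1))

/-- Reflection X ↦ -X embeds one space into the other. Only one inequality is needed, as the
injectivity of the discrete form provides the opposite one. -/
theorem finrank_vanishingPoly_le (k N : ℕ) (a : ℝ) :
    Module.finrank ℝ (vanishingPoly k N a) ≤ Module.finrank ℝ (vanishingPoly k N (-a)) := by
  let L : ℝ[X] →ₗ[ℝ] ℝ[X] :=
    { toFun := fun p => p.comp (-X)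
      map_add' := fun p q => add_comp
      map_smul' := fun c p => smul_comp _ _ _ }
  have hL : Function.Injective L := fun p q h => by
    have h1 : (p.comp (-X)).comp (-X) = (q.comp (-X)).comp (-X) := congrArg (fun r => comp r (-X)) h
    simpa [comp_assoc] using h1
  have hmem : ∀ p : vanishingPoly k N a, (L.domRestrict _) p ∈ vanishingPoly k N (-a) := fun p => by
    obtain ⟨h1, h2⟩ := mem_vanishingPoly.1 p.2
    exact mem_vanishingPoly.2 ⟨comp_mem_degreeLT h1 (by simp), pow_dvd_comp_neg_X h2⟩
  refine LinearMap.finrank_le_finrank_of_injective (f := (L.domRestrict _).codRestrict _ hmem) ?_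
  intro p q h
  exact Subtype.ext (hL (congrArg Subtype.val h))

/-- The zero of order k at 1 makes (1+x)^s q square integrable for the weight dual to that of f: the
exponents become 2k - s and 2s - k, both above -1. -/
theorem integrableOn_mul_one_add_rpow {s : ℝ} {k : ℕ} (hk : 1 ≤ k)
    (hs : s ∈ Set.Ioo ((k : ℝ) - 1) k) {f : ℝ → ℝ} (hf : MemLp f 2 (jacobiMeasure s k)) {q : ℝ[X]}
    (hq : (X - C 1) ^ k ∣ q) : IntegrableOn (fun x => f x * ((1 + x) ^ s * q.eval x)) Lam := by
  have hk1 : (1 : ℝ) ≤ k := by exact_mod_cast hk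
  obtain ⟨r, rfl⟩ := hq
  refine integrableOn_mul_of_memLp_jacobi hf (memLp_jacobi_iff.2 ⟨?_, ?_⟩)
  · exact (integrableOn_one_add_rpow_mul_eval (by linarith [hs.1]) _).aestronglyMeasurable
  · have h1 : IntegrableOn (fun x => jw (2 * k - s) (2 * s - k) x * (r ^ 2).eval x) Lam := by
      obtain ⟨M, _, hM⟩ := exists_bound_eval (r ^ 2)
      refine Integrable.mul_bdd (c := M) (integrableOn_jw (by linarith [hs.2]) (by linarith [hs.1]))
        (r ^ 2).continuous.aestronglyMeasurable ?_
      filter_upwards [ae_restrict_mem measurableSet_Lam] with x hx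
      exact hM x ⟨hx.1.le, hx.2.le⟩
    refine h1.congr_fun (fun x hx => ?_) measurableSet_Lam
    have ha : 0 < 1 - x := by linarith [hx.2]
    have hb : 0 < 1 + x := by linarith [hx.1]
    have e1 : (1 - x) ^ (2 * k - s) = (1 - x) ^ (-s) * ((x - 1) ^ k) ^ 2 := by
      rw [← pow_mul, mul_comm k 2, pow_mul, ← neg_sq, neg_sub, ← pow_mul, ← Real.rpow_natCast,
        ← Real.rpow_add ha]
      push_cast
      ring_nf
    have e2 : (1 + x) ^ (2 * s - k) = (1 + x) ^ (-(k : ℝ)) * ((1 + x) ^ s) ^ 2 := by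
      rw [← Real.rpow_natCast _ 2, ← Real.rpow_mul hb.le, ← Real.rpow_add hb]
      push_cast
      ring_nf
    simp only [jw, e1, e2, eval_mul, eval_pow, eval_sub, eval_X, eval_C]
    ring

/-- Unique solvability of the discrete problem. -/
theorem existsUnique_discreteSolution {s : ℝ} {k : ℕ} (hk : 1 ≤ k)
    (hs : s ∈ Set.Ioo ((k : ℝ) - 1) k) {f : ℝ → ℝ} (hf : MemLp f 2 (jacobiMeasure s k)) (N : ℕ) :
    ∃! uN, IsDiscreteSolution s k N f uN := by
  have hk1 : (1 : ℝ) ≤ k := by exact_mod_cast hk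
  have hs1 : -1 < s := by linarith [hs.1]
  obtain ⟨G, hGn, hG⟩ := exists_linearMap_rlDeriv hk hs
  let l : ℝ[X] →ₗ[ℝ] ℝ :=
    { toFun := fun r => (-1) ^ k * ∫ x in Lam, (1 + x) ^ s * r.eval x
      map_add' := fun p q => by
        simp only [eval_add, mul_add]
        rw [integral_add (integrableOn_one_add_rpow_mul_eval hs1 p)
          (integrableOn_one_add_rpow_mul_eval hs1 q), mul_add]
      map_smul' := fun c p => by
        simp only [eval_smul, smul_eq_mul, mul_left_comm _ c, integral_const_mul,
          RingHom.id_apply] }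
  let B : vanishingPoly k N (-1) →ₗ[ℝ] Module.Dual ℝ (vanishingPoly k N 1) :=
    LinearMap.mk₂ ℝ (fun ψ q => l (q.1 * derivative^[k] (G ψ.1)))
      (fun ψ ψ' q => by simp [mul_add]) (fun c ψ q => by simp)
      (fun ψ q q' => by simp [add_mul]) (fun c ψ q => by simp)
  let m : Module.Dual ℝ (vanishingPoly k N 1) :=
    { toFun := fun q => pairing f (fun x => (1 + x) ^ s * q.1.eval x)
      map_add' := fun q q' => by
        simp only [pairing, Submodule.coe_add, eval_add, mul_add]
        exact integral_add (integrableOn_mul_one_add_rpow hk hs hf (mem_vanishingPoly.1 q.2).2)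
          (integrableOn_mul_one_add_rpow hk hs hf (mem_vanishingPoly.1 q'.2).2)
      map_smul' := fun c q => by
        simp only [pairing, Submodule.coe_smul, eval_smul, smul_eq_mul, mul_left_comm _ c,
          integral_const_mul, RingHom.id_apply] }
  -- In this form all k derivatives act on the polynomial Gψ, so the test polynomial can be chosen
  -- freely.
  have hB : ∀ ψ : vanishingPoly k N (-1), ∀ q : vanishingPoly k N 1,
      bilin s k (fun x => (1 - x) ^ s * ψ.1.eval x) (fun x => (1 + x) ^ s * q.1.eval x) =
        B ψ q := by
    intro ψ q
    refine Eq.trans (integral_congr_ae ?_)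
      (pairing_eval_weakDeriv hk hs (mem_vanishingPoly.1 q.2).2 (G ψ.1))
    filter_upwards [(hG ψ.1 (mem_vanishingPoly.1 ψ.2).2).1] with x hx
    rw [hx]
  have hinj : Function.Injective B := by
    refine (injective_iff_map_eq_zero B).2 fun ψ hψ => ?_
    obtain ⟨hψN, hψk⟩ := mem_vanishingPoly.1 ψ.2
    refine Subtype.ext ((hG ψ.1 hψk).2 ?_)
    by_contra hne
    set h := derivative^[k] (G ψ.1) with hh
    have hdeg := natDegree_iterate_derivative (G ψ.1) k
    have hGN := natDegree_le_iff_mem_degreeLT.2 (hGn _ _ hψN)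
    have hkG : k ≤ (G ψ.1).natDegree := by
      by_contra hlt
      exact hne (iterate_derivative_eq_zero (not_le.1 hlt))
    -- The test polynomial (1-X)^k D^k(Gψ) has degree at most k + (N - k) = N, and it turns the form
    -- into a weighted square of D^k(Gψ).
    have hq : (1 - X) ^ k * h ∈ vanishingPoly k N 1 := by
      refine mem_vanishingPoly.2 ⟨natDegree_le_iff_mem_degreeLT.1 ?_, ?_⟩
      · refine natDegree_mul_le.trans ?_
        have := natDegree_pow_le (p := (1 - X : ℝ[X])) (n := k)
        rw [natDegree_one_sub_X] at this
        rw [← hh] at hdeg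
        omega
      · refine Dvd.dvd.mul_right (pow_dvd_pow_of_dvd ?_ k) _
        rw [← neg_sub X 1, C_1]
        exact (dvd_neg).2 dvd_rfl
    have h0 : B ψ ⟨_, hq⟩ = 0 := by rw [hψ]; rfl
    have h1 : (-1 : ℝ) ^ k * ∫ x in Lam, (1 + x) ^ s * ((1 - X) ^ k * h * h).eval x = 0 := h0
    have h2 := (mul_eq_zero.1 h1).resolve_left (pow_ne_zero _ (by norm_num))
    have e : ∀ x : ℝ, (1 + x) ^ s * ((1 - X) ^ k * h * h).eval x =
        (1 + x) ^ s * (1 - x) ^ k * h.eval x ^ 2 := fun x => by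
      simp only [eval_mul, eval_pow, eval_sub, eval_one, eval_X]
      ring
    have hi := integrableOn_one_add_rpow_mul_eval hs1 ((1 - X) ^ k * h * h)
    simp only [e] at h2 hi
    refine hne (eq_zero_of_setIntegral_mul_sq (fun x hx => ?_) hi h2)
    exact mul_pos (Real.rpow_pos_of_pos (by linarith [hx.1]) _) (pow_pos (by linarith [hx.2]) _)
  -- No dimension is computed, so N < k, where both spaces are zero, requires no separate case.
  have hfin : Module.finrank ℝ (vanishingPoly k N (-1)) =
      Module.finrank ℝ (Module.Dual ℝ (vanishingPoly k N 1)) := by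
    refine le_antisymm (LinearMap.finrank_le_finrank_of_injective hinj) ?_
    rw [Subspace.dual_finrank_eq]
    exact finrank_vanishingPoly_le k N 1
  obtain ⟨ψ, hψ⟩ :=
    (LinearMap.injective_iff_surjective_of_finrank_eq_finrank hfin).1 hinj m
  have hmem : ∀ {a : ℝ} {p : ℝ[X]}, p ∈ vanishingPoly k N a ↔
      p.natDegree ≤ N ∧ ∀ l < k, (derivative^[l] p).eval a = 0 := fun {a p} => by
    rw [mem_vanishingPoly, natDegree_le_iff_mem_degreeLT, forall_iterate_derivative_eval_iff_dvd]
  refine ⟨fun x => (1 - x) ^ s * ψ.1.eval x, ⟨?_, ?_⟩, ?_⟩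
  · exact ⟨ψ.1, (hmem.1 ψ.2).1, (hmem.1 ψ.2).2, rfl⟩
  · rintro _ ⟨q, hq1, hq2, rfl⟩
    have := hB ψ ⟨q, hmem.2 ⟨hq1, hq2⟩⟩
    rw [hψ] at this
    exact this
  · rintro _ ⟨⟨ψ', h1, h2, rfl⟩, hsol⟩
    have h3 : B ⟨ψ', hmem.2 ⟨h1, h2⟩⟩ = m := by
      ext q
      rw [← hB]
      exact hsol _ ⟨q.1, (hmem.1 q.2).1, (hmem.1 q.2).2, rfl⟩
    rw [← hinj (h3.trans hψ.symm)]

end GJF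

end

theorem theorem5p3 (k : ℕ) (hk : 1 ≤ k) (s : ℝ) (hs : s ∈ Set.Ioo ((k : ℝ) - 1) k)
    (f : ℝ → ℝ) (hf : MemLp f 2 (GJF.jacobiMeasure s k)) :
    (∀ v ∈ GJF.spaceV s k, IntegrableOn (fun x => f x * v x) GJF.Lam) ∧
    (∃ u, GJF.IsWeakSolution s k f u ∧
      ∀ u', GJF.IsWeakSolution s k f u' → u' =ᵐ[volume.restrict GJF.Lam] u) ∧
    (∀ N : ℕ, ∃! uN, GJF.IsDiscreteSolution s k N f uN) := by
  exact ⟨fun _ hv => (GJF.pairing_spaceV hk hs hf hv).1, GJF.exists_unique_weakSolution hk hs hf,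
    GJF.existsUnique_discreteSolution hk hs hf⟩
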